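/- **Setting.** There are $m$ parties $P_1,\dots,P_m$; one of them, $P_{\mathsf{pivot}}$, holds a vector $(x_1,\dots,x_n)$ of $l$-bit strings, and every other $P_j$ holds $n$ finite sets $X_{j,1},\dots,X_{j,n}$ of $l$-bit strings. Let $\mathbb F$ be a finite field whose elements are encoded by bit strings, and let $Q$ be a set predicate formula, i.e. a formula built with $\wedge,\vee$ from literals $x\in X_j$, $x\notin X_j$ ($j\neq\mathsf{pivot}$); $|\mathsf{OR}|$ is the number of its $\vee$-operators. All these parameters may depend on the security parameter $\lambda$, and $m,n,l$, the number of literals of $Q$ and the bit length of field elements are polynomially bounded in $\lambda$. $[r]$ denotes an additive sharing $r=\sum_i r_i$ over $\mathbb F$, where $P_i$ holds $r_i$. **Ideal functionality $\mathcal F^Q_{\mathsf{bMZS}}$.** Give $\mathbf s_i=(s_{i,1},\dots,s_{i,n})$ to $P_i$, where $(s_{i,k})$ is uniform in $\mathbb F^{m\times n}$ subject to: $\sum_i s_{i,k}=0$ for every $k$ with $Q(x_k,(X_{j,k})_j)=1$. **Hybrid functionalities.** - $\mathcal F_{\mathsf{bOPPRF}}$: the sender inputs $n$ sets $S_k$ of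 key-value pairs, the receiver inputs $(x_k)_k$; for each $k$ a uniform key $\kappa_k$ and a hint $h_k$ for $(\kappa_k,S_k)$ are generated and given to the sender, and the receiver gets $F(\kappa_k,h_k,x_k)\in\mathbb F$. Here $F$ is a programmable PRF: it takes exactly the programmed values at the programmed points, for every polynomial-size programmed set its values at polynomially many distinct unprogrammed points are computationally indistinguishable from uniform (to someone who does not know key and hint), keys have polynomial length, and hints have length polynomial in $\lambda+|S_k|$. - $\mathcal F_{\mathsf{bssPMT}}$: for each $k$, the sender (input $X_k$) and the receiver (input $x_k$) get random bits $e^0_k,e^1_k$ with $e^0_k\oplus e^1_k=1$ iff $x_k\in X_k$. - $\mathcal F_{\mathsf{ROT}}$: the sender gets uniform $r^0,r^1\in\mathbb F$, the receiver with choice bit $e$ gets $r^e$. **Protocol $\Pi^Q_{\mathsf{bMZS}}$** (the steps are done for all instances $k=1,\dots,n$ in parallel). 1. For every occurrence of a literal $x\in X_j$: $P_j$ samples $r_k\in\mathbb F$ uniformly and programs the value $-r_k$ at all points of $X_{j,k}$; $P_j$ as sender and $P_{\mathsf{pivot}}$ as receiver with input $(x_k)$ invoke $\mathcal F_{\mathsf{bOPPRF}}$;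 the shares are $r_k$ for $P_j$, the received value for $P_{\mathsf{pivot}}$, and $0$ for the others. For every occurrence of a literal $x\notin X_j$: $P_j$ and $P_{\mathsf{pivot}}$ invoke $\mathcal F_{\mathsf{bssPMT}}$ and get $e^0_k$ and $e^1_k$; they then invoke $\mathcal F_{\mathsf{ROT}}$ with $P_j$ as sender and $P_{\mathsf{pivot}}$ as receiver with choice bit $e^1_k$; the shares are $-r_k^{e^0_k}$ for $P_j$, $r_k^{e^1_k}$ for $P_{\mathsf{pivot}}$, and $0$ for the others. 2. The formula is evaluated gate by gate: $\wedge$ by local addition of shares; $\vee$ by secure multiplication of the two sharings $[r],[r']$ with a fresh Beaver triple $([a],[b],[c])$, i.e. opening $d=r-a$ and $e=r'-b$ and setting $[rr']=de+d[b]+e[a]+[c]$. 3. For the resulting sharing $[r]$, with a fresh Beaver triple $([a],[b],[c])$, the parties open $u=r+a$ and output the shares of $[s]=u[b]-[c]$ (so that $s=r\cdot b$). Beaver triples (uniform sharings of uniform $a,b$ and of $c=ab$) are dealt in an offline phase. A value is opened by sending all shares to a fixed leader (any party), who sends the sum to all parties. The view of a party consists of its input, its random choices, its shares of the triples and everything it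 receives. **Computational model.** Efficient algorithms are probabilistic circuits over Boolean operations, selection, concatenation and comparison of bit strings, the operations of $\mathbb F$ and sampling from $\mathbb F$, and the algorithms of the programmable PRF, each at unit cost (hard-wired words cost their length plus one). Computational indistinguishability $\overset{c}{\approx}$ of two ensembles means that every family of distinguishing circuits of size polynomial in $\lambda$ has advantage negligible in $\lambda$. **Theorem.** (1) *Security.* There is a simulator $\mathsf{Sim}$, namely a family of circuits that depend only on $m$, $n$, $Q$, the indices of pivot and leader, the set of corrupted parties and the sizes of the corrupted parties' sets (neither on $\lambda$, $\mathbb F$, $l$ nor on the programmable PRF), of size polynomial in $m+n$ plus the number of literals of $Q$ plus the total size of the corrupted parties' sets, such that the following holds for all parameters as above. Let $\sigma=\sigma(\lambda)\in\mathbb N$ be such that $2^{-\sigma}$ is negligible in $\lambda$, and suppose $|\mathbb F|\ge|\mathsf{OR}|\cdot n\cdot 2^\sigma$ and $|\mathbb F|\ge 2^\sigma$. Then for every set $\mathbf P_{\mathcal A}$ of $t<m$ corrupted parties (chosen for each $\lambda$) and all inputs $\mathbf x$ of polynomially bounded total size, $$\{\mathsf{Sim}(\mathbf P_{\mathcal A},\mathbf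 x_{\mathcal A},\mathbf s_{\mathcal A}),\ \mathbf s_1,\dots,\mathbf s_m\}\ \overset{c}{\approx}\ \{\mathsf{View}^{\Pi}_{\mathcal A}(\mathbf x),\ \mathsf{Output}^{\Pi}(\mathbf x)\},$$ where $(\mathbf s_1,\dots,\mathbf s_m)$ is the output of $\mathcal F^Q_{\mathsf{bMZS}}$ on $\mathbf x$ and $\Pi=\Pi^Q_{\mathsf{bMZS}}$ is run in the $(\mathcal F_{\mathsf{bOPPRF}},\mathcal F_{\mathsf{bssPMT}},\mathcal F_{\mathsf{ROT}})$-hybrid model. That is, $\Pi^Q_{\mathsf{bMZS}}$ securely realizes $\mathcal F^Q_{\mathsf{bMZS}}$ against semi-honest adversaries corrupting $t<m$ parties. (2) *Correctness.* For all parameters as above (without the assumptions on $\sigma$ and $|\mathbb F|$) and all inputs of polynomially bounded total size, there is a negligible $\nu$ such that the statistical distance between $\mathsf{Output}^\Pi(\mathbf x)$ and the output of $\mathcal F^Q_{\mathsf{bMZS}}$ is at most $\nu(\lambda)+\dfrac{(|\mathsf{OR}|+1)\,n}{|\mathbb F|}$. In particular it is at most $\nu(\lambda)+2\cdot2^{-\sigma}$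 if $|\mathsf{OR}|\ge1$ and $|\mathbb F|\ge|\mathsf{OR}|\cdot n\cdot2^\sigma$. -/

import Mathlib

namespace ZeroSharing

noncomputable section

/-! ### Words, programmable PRFs, set predicate formulas, protocol parameters -/

/-- A word is a finite bit string.  Everything that a party sees is encoded by words. -/
abbrev Word := List Bool

/-- The `k`-bit string written in a word (missing bits are read as `false`). -/
def ofBits (k : ℕ) (w : Word) : Fin k → Bool := fun i => w.getD i false

/-- A finite set of key-value pairs is functional if every key has at most one value. -/
def Functional {α β : Type} (S : Finset (α × β)) : Prop :=
  ∀ x y y', (x, y) ∈ S → (x, y') ∈ S → y = y'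

/-- A programmable function family with `l`-bit inputs and values in `F`: the key is a uniform
bit string, the hint is sampled from the key and the set of programmed points, and the function
given by key and hint takes the programmed values.  (Pseudorandomness is `IsPPRF` below.) -/
structure PPRF (l : ℕ) (F : Type) where
  keyLen : ℕ
  hint : (Fin keyLen → Bool) → Finset ((Fin l → Bool) × F) → PMF Word
  eval : (Fin keyLen → Bool) → Word → (Fin l → Bool) → F
  programmed : ∀ (k : Fin keyLen → Bool) (S : Finset ((Fin l → Bool) × F)) (h : Word)
    (x : Fin l → Bool) (y : F),
    Functional S → h ∈ (hint k S).support → (x, y) ∈ S → eval k h x = y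

/-- Set predicate formulas, built by `∧` and `∨` from the literals `x ∈ X_j` and `x ∉ X_j`. -/
inductive SetFormula (ι : Type) where
  | mem (j : ι) : SetFormula ι
  | notMem (j : ι) : SetFormula ι
  | and (A B : SetFormula ι) : SetFormula ι
  | or (A B : SetFormula ι) : SetFormula ι

namespace SetFormula

/-- Truth of `Q(x, X)`. -/
def Holds {ι E : Type} (x : E) (X : ι → Finset E) : SetFormula ι → Prop
  | mem j => x ∈ X j
  | notMem j => x ∉ X j
  | and A B => A.Holds x X ∧ B.Holds x X
  | or A B => A.Holds x X ∨ B.Holds x X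

/-- The number of `∨` operators. -/
def orCount {ι : Type} : SetFormula ι → ℕ
  | mem _ => 0
  | notMem _ => 0
  | and A B => A.orCount + B.orCount
  | or A B => A.orCount + B.orCount + 1

/-- The number of (occurrences of) literals. -/
def literals {ι : Type} : SetFormula ι → ℕ
  | mem _ => 1
  | notMem _ => 1
  | and A B => A.literals + B.literals
  | or A B => A.literals + B.literals

end SetFormula

/-- The combinatorial parameters of the protocol: `m` parties, the pivot, the party that leads
the openings, the batch size `n`, and the formula `Q` about the sets of the parties other than the
pivot. -/
structure Shape where
  m : ℕ
  pivot : Fin m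
  leader : Fin m
  n : ℕ
  Q : SetFormula {j : Fin m // j ≠ pivot}

/-- The index type of the parties other than the pivot. -/
abbrev Shape.Other (s : Shape) : Type := {j : Fin s.m // j ≠ s.pivot}

/-- All parameters of the protocol: also the element length `l`, a finite field with an encoding
of its elements by bit strings, and the programmable function family behind batch OPPRF. -/
structure Params extends Shape where
  l : ℕ
  F : Type
  [field : Field F]
  [fintype : Fintype F]
  fieldLen : ℕ
  encF : F ↪ (Fin fieldLen → Bool)
  pprf : PPRF l F

attribute [instance] Params.field Params.fintype

namespace Params

variable (p : Params)

/-- The set elements. -/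
abbrev Elt : Type := Fin p.l → Bool

/-- The PPRF keys. -/
abbrev Key : Type := Fin p.pprf.keyLen → Bool

/-- One field element for each party and each instance. -/
abbrev Shares : Type := Fin p.m → Fin p.n → p.F

/-- The word that encodes a field element. -/
def wordF (a : p.F) : Word := List.ofFn (p.encF a)

/-- The field element encoded by a word. -/
def decF (w : Word) : p.F := Function.invFun p.encF (ofBits p.fieldLen w)

/-- The encoding of a vector of `n` field elements. -/
def wordsF (a : Fin p.n → p.F) : List Word := List.ofFn fun k => p.wordF (a k)

end Params

/-! ### The model of computation

Probabilistic circuits, written as straight-line programs.  The memory is a list of words; each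
instruction appends one word to it.  Besides Boolean operations, the basis consists of the
operations of the field and the algorithms of the PPRF. -/

inductive Instr where
  /-- a hard-wired word -/
  | const (w : Word)
  /-- a uniform bit -/
  | coin
  /-- the `t`-th bit of a word -/
  | bit (i t : ℕ)
  /-- negated conjunction of the first bits of two words -/
  | nand (i j : ℕ)
  /-- concatenation of two words -/
  | append (i j : ℕ)
  /-- equality test of two words -/
  | eq (i j : ℕ)
  /-- word `i` if the first bit of word `c` is `1`, and word `j` otherwise -/
  | select (c i j : ℕ)
  /-- a uniform field element -/
  | rand
  | add (i j : ℕ)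
  | neg (i : ℕ)
  | mul (i j : ℕ)
  /-- a uniform PPRF key -/
  | key
  /-- a hint for a key and a list of programmed points -/
  | hint (k : ℕ) (pts : List (ℕ × ℕ))
  /-- evaluation of the PPRF at a key, a hint and an element -/
  | eval (k h x : ℕ)

/-- The cost of an instruction. -/
def Instr.cost : Instr → ℕ
  | .const w => w.length + 1
  | .hint _ pts => pts.length + 1
  | _ => 1

/-- The word in register `i`. -/
def reg (mem : List Word) (i : ℕ) : Word := mem.getD i []

open Classical in
/-- The distribution of the word computed by an instruction. -/
def Instr.step (p : Params) (mem : List Word) : Instr → PMF Word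
  | .const w => pure w
  | .coin => (PMF.uniformOfFintype Bool).map fun b => [b]
  | .bit i t => pure [(reg mem i).getD t false]
  | .nand i j => pure [!((reg mem i).headD false && (reg mem j).headD false)]
  | .append i j => pure (reg mem i ++ reg mem j)
  | .eq i j => pure [decide (reg mem i = reg mem j)]
  | .select c i j => pure (if (reg mem c).headD false then reg mem i else reg mem j)
  | .rand => (PMF.uniformOfFintype p.F).map p.wordF
  | .add i j => pure (p.wordF (p.decF (reg mem i) + p.decF (reg mem j)))
  | .neg i => pure (p.wordF (-p.decF (reg mem i)))
  | .mul i j => pure (p.wordF (p.decF (reg mem i) * p.decF (reg mem j)))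
  | .key => (PMF.uniformOfFintype p.Key).map List.ofFn
  | .hint k pts => p.pprf.hint (ofBits _ (reg mem k))
      (pts.map fun q => (ofBits p.l (reg mem q.1), p.decF (reg mem q.2))).toFinset
  | .eval k h x => pure (p.wordF
      (p.pprf.eval (ofBits _ (reg mem k)) (reg mem h) (ofBits p.l (reg mem x))))

/-- A circuit: its instructions, and the registers that are output. -/
structure Circuit where
  code : List Instr
  out : List ℕ

/-- The size of a circuit. -/
def Circuit.size (C : Circuit) : ℕ := (C.code.map Instr.cost).sum + C.out.length

/-- The memory after the execution of a list of instructions. -/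
def runCode (p : Params) : List Instr → List Word → PMF (List Word)
  | [], mem => pure mem
  | i :: is, mem => do
    let w ← i.step p mem
    runCode p is (mem ++ [w])

/-- The output distribution of a circuit. -/
def Circuit.run (p : Params) (C : Circuit) (input : List Word) : PMF (List Word) :=
  (runCode p C.code input).map fun mem => C.out.map (reg mem)

/-- The probability that a circuit accepts, i.e. that its first output word is `1`. -/
def Circuit.accept (p : Params) (C : Circuit) (D : PMF (List Word)) : ℝ :=
  (((D.bind (C.run p)).map fun o => decide (o.head? = some [true])) true).toReal

/-! ### Indistinguishability -/

/-- Polynomially bounded functions of the security parameter. -/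
def PolyBdd (f : ℕ → ℕ) : Prop := ∃ q : Polynomial ℕ, ∀ κ, f κ ≤ q.eval κ

/-- Negligible functions of the security parameter. -/
def Negligible (ν : ℕ → ℝ) : Prop :=
  Asymptotics.SuperpolynomialDecay Filter.atTop (fun κ : ℕ => (κ : ℝ)) ν

/-- Computational indistinguishability, against circuit families of polynomial size. -/
def CompIndist (P : ℕ → Params) (X Y : ℕ → PMF (List Word)) : Prop :=
  ∀ D : ℕ → Circuit, PolyBdd (fun κ => (D κ).size) →
    Negligible fun κ => |(D κ).accept (P κ) (X κ) - (D κ).accept (P κ) (Y κ)|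

/-- Statistical distance. -/
def statDist {α : Type} (X Y : PMF α) : ℝ := (∑' a, |(X a).toReal - (Y a).toReal|) / 2

/-- The values at `q` of the PPRF programmed with the points `S`. -/
def pprfValues (p : Params) (S : Finset (p.Elt × p.F)) (q : List p.Elt) : PMF (List Word) := do
  let k ← PMF.uniformOfFintype p.Key
  let h ← p.pprf.hint k S
  pure (q.map fun x => p.wordF (p.pprf.eval k h x))

/-- A list of independent uniform field elements. -/
def uniformValues (p : Params) (μ : ℕ) : PMF (List Word) :=
  (PMF.uniformOfFintype (Fin μ → p.F)).map fun f => List.ofFn fun i => p.wordF (f i)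

/-- The family is a programmable PRF: whatever points are programmed, the values at polynomially
many other inputs are pseudorandom; hints have polynomial length. -/
def IsPPRF (P : ℕ → Params) : Prop :=
  (∀ (S : ∀ κ, Finset ((P κ).Elt × (P κ).F)) (q : ∀ κ, List (P κ).Elt),
    (∀ κ, Functional (S κ)) → PolyBdd (fun κ => (S κ).card) →
    (∀ κ, (q κ).Nodup) → PolyBdd (fun κ => (q κ).length) →
    (∀ κ, ∀ x ∈ q κ, ∀ y, (x, y) ∉ S κ) →
    CompIndist P (fun κ => pprfValues (P κ) (S κ) (q κ))
      (fun κ => uniformValues (P κ) (q κ).length)) ∧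
  ∃ b : Polynomial ℕ, ∀ (κ : ℕ) (k : (P κ).Key) (S : Finset ((P κ).Elt × (P κ).F)) (h : Word),
    h ∈ ((P κ).pprf.hint k S).support → h.length ≤ b.eval (κ + S.card)

/-- All size parameters are polynomial in the security parameter. -/
structure PolyParams (P : ℕ → Params) : Prop where
  m : PolyBdd fun κ => (P κ).m
  n : PolyBdd fun κ => (P κ).n
  l : PolyBdd fun κ => (P κ).l
  literals : PolyBdd fun κ => (P κ).Q.literals
  fieldLen : PolyBdd fun κ => (P κ).fieldLen
  keyLen : PolyBdd fun κ => (P κ).pprf.keyLen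

/-! ### The ideal functionalities -/

/-- Independent samples from `n` distributions. -/
def piPMF {α : Type} : {n : ℕ} → (Fin n → PMF α) → PMF (Fin n → α)
  | 0, _ => pure Fin.elim0
  | _ + 1, d => do
    let a ← d 0
    let t ← piPMF fun i => d i.succ
    pure (Fin.cons a t)

/-- The inputs: the elements of the pivot, and the sets of the other parties. -/
structure Input (p : Params) where
  x : Fin p.n → p.Elt
  X : p.toShape.Other → Fin p.n → Finset p.Elt

/-- The total number of set elements in an input. -/
def Input.size {p : Params} (inp : Input p) : ℕ := ∑ j, ∑ k, (inp.X j k).card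

/-- The truth-value of `Q` on the inputs of instance `k`. -/
def Input.Holds {p : Params} (inp : Input p) (k : Fin p.n) : Prop :=
  p.Q.Holds (inp.x k) fun j => inp.X j k

open Classical in
/-- Batch membership zero-sharing: uniform shares that add up to `0` in every instance in which
the formula is true. -/
def bMZS {p : Params} (inp : Input p) : PMF p.Shares :=
  PMF.uniformOfFinset
    (Finset.univ.filter fun s : p.Shares => ∀ k, inp.Holds k → ∑ i, s i k = 0)
    ⟨0, by simp⟩

/-- Batch OPPRF: the sender programs the points `S k` and obtains keys and hints, the receiver
obtains the values at its queries. -/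
def bOPPRF (p : Params) (S : Fin p.n → Finset (p.Elt × p.F)) (x : Fin p.n → p.Elt) :
    PMF ((Fin p.n → p.Key) × (Fin p.n → Word) × (Fin p.n → p.F)) := do
  let key ← PMF.uniformOfFintype (Fin p.n → p.Key)
  let h ← piPMF fun k => p.pprf.hint (key k) (S k)
  pure (key, h, fun k => p.pprf.eval (key k) (h k) (x k))

/-- Batch ssPMT: random bits `e.1` of the sender and `e.2` of the receiver whose sum modulo 2 is
the membership bit. -/
def bssPMT (p : Params) (X : Fin p.n → Finset p.Elt) (x : Fin p.n → p.Elt) :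
    PMF ((Fin p.n → Bool) × (Fin p.n → Bool)) :=
  PMF.uniformOfFinset
    (Finset.univ.filter fun e : (Fin p.n → Bool) × (Fin p.n → Bool) =>
      ∀ k, xor (e.1 k) (e.2 k) = decide (x k ∈ X k))
    ⟨(fun _ => false, fun k => decide (x k ∈ X k)), by simp⟩

/-- `n` instances of random OT: the sender obtains `r false k` and `r true k`, the receiver with
choice bits `e` obtains `r (e k) k`. -/
def bROT (p : Params) (e : Fin p.n → Bool) : PMF ((Bool → Fin p.n → p.F) × (Fin p.n → p.F)) :=
  (PMF.uniformOfFintype (Bool → Fin p.n → p.F)).map fun r => (r, fun k => r (e k) k)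

/-- Shares of three vectors. -/
structure Triples (p : Params) where
  a : p.Shares
  b : p.Shares
  c : p.Shares

open Classical in
/-- `n` Beaver triples: uniform sharings of `a`, `b` and of `c = a b`. -/
def beaver (p : Params) : PMF (Triples p) :=
  (PMF.uniformOfFinset
    (Finset.univ.filter fun t : p.Shares × p.Shares × p.Shares =>
      ∀ k, ∑ i, t.2.2 i k = (∑ i, t.1 i k) * ∑ i, t.2.1 i k)
    ⟨0, by simp⟩).map fun t => ⟨t.1, t.2.1, t.2.2⟩

/-! ### The protocol -/

/-- The views of the parties. -/
abbrev Views (p : Params) : Type := Fin p.m → List Word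

/-- Executions: probabilistic computations that extend the views of the parties. -/
abbrev Exec (p : Params) (α : Type) : Type := StateT (Views p) PMF α

/-- Sample from a distribution. -/
def sample {p : Params} {α : Type} (d : PMF α) : Exec p α := StateT.lift d

/-- Every party `i` sees the words `ws i`. -/
def recordAll {p : Params} (ws : Fin p.m → List Word) : Exec p Unit :=
  modify fun v i => v i ++ ws i

/-- Party `i` sees the words `ws`. -/
def record {p : Params} (i : Fin p.m) (ws : List Word) : Exec p Unit :=
  recordAll fun i' => if i' = i then ws else []

/-- The sharing in which the pivot holds `u`, party `j` holds `r`, and all others hold `0`. -/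
def twoPartyShares {p : Params} (u : Fin p.n → p.F) (j : p.toShape.Other) (r : Fin p.n → p.F) :
    p.Shares :=
  fun i => if i = p.pivot then u else if i = j.1 then r else 0

/-- Relaxed batch membership zero-sharing for the literal `x ∈ X_j`. -/
def shareMem {p : Params} (inp : Input p) (j : p.toShape.Other) : Exec p p.Shares := do
  let r ← sample (PMF.uniformOfFintype (Fin p.n → p.F))
  record j.1 (p.wordsF r)
  let (key, h, u) ← sample (bOPPRF p (fun k => inp.X j k ×ˢ {-r k}) inp.x)
  record j.1 (List.ofFn fun k => List.ofFn (key k))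
  record j.1 (List.ofFn h)
  record p.pivot (p.wordsF u)
  pure (twoPartyShares u j r)

/-- Relaxed batch membership zero-sharing for the literal `x ∉ X_j`. -/
def shareNotMem {p : Params} (inp : Input p) (j : p.toShape.Other) : Exec p p.Shares := do
  let (e0, e1) ← sample (bssPMT p (inp.X j) inp.x)
  record j.1 (List.ofFn fun k => [e0 k])
  record p.pivot (List.ofFn fun k => [e1 k])
  let (r, u) ← sample (bROT p e1)
  record j.1 (p.wordsF (r false) ++ p.wordsF (r true))
  record p.pivot (p.wordsF u)
  pure (twoPartyShares u j fun k => -r (e0 k) k)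

/-- Opening of `n` shared values: every party sends its shares to the leader, who adds them up
and sends the sums to every party. -/
def opening {p : Params} (s : p.Shares) : Exec p (Fin p.n → p.F) := do
  recordAll fun i =>
    if i = p.leader then
      ((List.finRange p.m).filter fun j => j ≠ p.leader).flatMap fun j => p.wordsF (s j)
    else p.wordsF fun k => ∑ j, s j k
  pure fun k => ∑ j, s j k

/-- Every party receives its shares of fresh Beaver triples, prepared in the offline phase. -/
def dealTriples {p : Params} : Exec p (Triples p) := do
  let t ← sample (beaver p)
  recordAll fun i => p.wordsF (t.a i) ++ p.wordsF (t.b i) ++ p.wordsF (t.c i)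
  pure t

/-- `n` secure multiplications, each with a Beaver triple and two openings. -/
def multiply {p : Params} (r r' : p.Shares) : Exec p p.Shares := do
  let t ← dealTriples
  let d ← opening (r - t.a)
  let e ← opening (r' - t.b)
  pure fun i k =>
    (if i = p.leader then d k * e k else 0) + d k * t.b i k + e k * t.a i k + t.c i k

/-- The simple predicative sharing stage and the formula emulation stage. -/
def emulate {p : Params} (inp : Input p) : SetFormula p.toShape.Other → Exec p p.Shares
  | .mem j => shareMem inp j
  | .notMem j => shareNotMem inp j
  | .and A B => do
    let r ← emulate inp A
    let r' ← emulate inp B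
    pure (r + r')
  | .or A B => do
    let r ← emulate inp A
    let r' ← emulate inp B
    multiply r r'

/-- The transformation from relaxed to standard: multiplication by the random sharing `b` of a
Beaver triple, with one opening. -/
def transform {p : Params} (r : p.Shares) : Exec p p.Shares := do
  let t ← dealTriples
  let u ← opening (r + t.a)
  pure fun i k => u k * t.b i k - t.c i k

/-- The encoding of the input of party `i`. -/
def Input.words {p : Params} (inp : Input p) (i : Fin p.m) : List Word :=
  if h : i = p.pivot then List.ofFn fun k => List.ofFn (inp.x k)
  else (List.finRange p.n).flatMap fun k => (inp.X ⟨i, h⟩ k).toList.map List.ofFn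

/-- The joint distribution of the outputs and the views of all parties in an execution of the
batch membership zero-sharing protocol. -/
def protocol {p : Params} (inp : Input p) : PMF (p.Shares × Views p) :=
  (emulate inp p.Q >>= transform).run inp.words

/-- The outputs of the protocol. -/
def protocolOutput {p : Params} (inp : Input p) : PMF p.Shares := (protocol inp).map Prod.fst

/-! ### Security -/

/-- The concatenation of the words of the parties in `A`. -/
def collect {p : Params} (A : Finset (Fin p.m)) (ws : Fin p.m → List Word) : List Word :=
  ((List.finRange p.m).filter fun i => i ∈ A).flatMap ws

/-- The joint view of the parties in `A`, followed by the outputs of all parties. -/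
def realEnsemble {p : Params} (A : Finset (Fin p.m)) (inp : Input p) : PMF (List Word) := do
  let (s, v) ← protocol inp
  pure (collect A v ++ collect Finset.univ fun i => p.wordsF (s i))

/-- The simulated view, computed from the inputs and outputs of the parties in `A`, followed by
the outputs of the ideal functionality. -/
def idealEnsemble {p : Params} (Sim : Circuit) (A : Finset (Fin p.m)) (inp : Input p) :
    PMF (List Word) := do
  let s ← bMZS inp
  let w ← Sim.run p (collect A inp.words ++ collect A fun i => p.wordsF (s i))
  pure (w ++ collect Finset.univ fun i => p.wordsF (s i))

/-- The sizes of the sets held by the parties in `A` (the length of the input of a simulator). -/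
def Input.sizes {p : Params} (inp : Input p) (A : Finset (Fin p.m)) : p.toShape.Other → Fin p.n → ℕ :=
  fun j k => if j.1 ∈ A then (inp.X j k).card else 0

/-- A simulator is a family of circuits, one for each choice of the combinatorial parameters, the
set of corrupted parties, and the sizes of their sets (which fix the number of words that the
simulator receives).  It does not depend on the field, the PPRF or the security parameter. -/
abbrev Simulator : Type :=
  ∀ s : Shape, Finset (Fin s.m) → (s.Other → Fin s.n → ℕ) → Circuit

/-- The simulator has polynomial size. -/
def PolySize (Sim : Simulator) : Prop :=
  ∃ b : Polynomial ℕ, ∀ s A N,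
    (Sim s A N).size ≤ b.eval (s.m + s.n + s.Q.literals + ∑ j, ∑ k, N j k)

/-- With this simulator, the protocol securely computes batch membership zero-sharing in the
presence of semi-honest corruption of any `t < m` parties. -/
def SecurelyComputes (Sim : Simulator) (P : ℕ → Params) : Prop :=
  ∀ (A : ∀ κ, Finset (Fin (P κ).m)) (inp : ∀ κ, Input (P κ)),
    (∀ κ, (A κ).card < (P κ).m) → PolyBdd (fun κ => (inp κ).size) →
    CompIndist P
      (fun κ => idealEnsemble (Sim (P κ).toShape (A κ) ((inp κ).sizes (A κ))) (A κ) (inp κ))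
      (fun κ => realEnsemble (A κ) (inp κ))

end

end ZeroSharing

namespace ZeroSharing
noncomputable section
open PMF

/-! ### Couplings -/

/-! Transcripts carry, besides shares and views, the value of the formula: a literal contributes the
sum of its shares, `∧` adds values and `∨` multiplies them. In a true instance the value is `0` with
certainty. In a false one it hits any given point with probability at most `(orCount + 1) * δ`,
where `δ` bounds both `1 / |F|` and the point masses of a PPRF value at an unprogrammed point: at
`∧` the other summand is held fixed; at `∨` either the first factor vanishes or one divides by it
(`evalFormula_value_le`). Equality with a constant is tested by a small circuit, so pseudorandomness
gives `δ = 1 / |F| + ν` with `ν` negligible (`pprfValue_le`).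

Let `h` be an honest party. Its share of `c` in a Beaver triple can absorb the constraint `c = a b`,
and the masks `a`, `b` can be translated to compensate for honest shares that are not known. Hence
independent uniform triples produce the same corrupted views (`couple_mul`, `couple_looseEval`). In
the final step the output shares add up to `r b` with `b` uniform, so they are uniform subject to
adding up to `0` exactly where `r = 0`; given the output, `c` can be solved for (`couple_trans`).
Thus, with no error in the outputs and the corrupted views, the real execution becomes one that
first evaluates the formula and then samples the output from its value (`couple_protocol`). Passing
from there to the ideal output costs `n * (orCount + 1) * δ` by a union bound
(`statDist_outputFirst_le`). Looking only at the outputs, this is correctness.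

Once the outputs are ideal, they are independent of the evaluation of the formula, and only the
literals remain to be simulated. Separately, the two ssPMT bits are uniform; what cannot be sampled
exactly without honest inputs is the PPRF value that a corrupted pivot receives from an honest
sender. The corrupted views are therefore generated from a pool of `n` field elements per literal
(`couple_pool`), and the simulator fills the pool with uniform elements. A hybrid argument exchanges
the entries one by one (`abs_probTrue_listPMF_sub_le`): all else is hard-wired into a circuit that
distinguishes a single PPRF value from a uniform element. This needs the simulation as an actual
circuit with a size bound (`impl_viewsB`, `costs_viewsB`) and one negligible bound valid for all
circuits of a given size (`exists_best_test`). -/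

theorem bind_congr_of_support {α β : Type} (μ : PMF α) {f g : α → PMF β}
    (h : ∀ a ∈ μ.support, f a = g a) : μ.bind f = μ.bind g := by
  ext b
  simp only [PMF.bind_apply]
  refine tsum_congr fun a => ?_
  by_cases ha : a ∈ μ.support
  · rw [h a ha]
  · rw [(μ.apply_eq_zero_iff a).2 ha, zero_mul, zero_mul]

theorem map_congr_of_support {α β : Type} (μ : PMF α) {f g : α → β}
    (h : ∀ a ∈ μ.support, f a = g a) : μ.map f = μ.map g :=
  bind_congr_of_support μ fun a ha => by simp [h a ha]

/-- Two distributions have a coupling that is supported in a relation. -/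
def Couple {α β : Type} (μ : PMF α) (ν : PMF β) (R : α → β → Prop) : Prop :=
  ∃ E : PMF (α × β), E.map Prod.fst = μ ∧ E.map Prod.snd = ν ∧ ∀ e ∈ E.support, R e.1 e.2

namespace Couple

variable {α β γ α' β' : Type}

theorem of_map {μ : PMF α} {ν : PMF β} {R : α → β → Prop} (τ : PMF γ) (f : γ → α) (g : γ → β)
    (hf : μ = τ.map f) (hg : ν = τ.map g) (h : ∀ c ∈ τ.support, R (f c) (g c)) :
    Couple μ ν R := by
  refine ⟨τ.map fun c => (f c, g c), ?_, ?_, ?_⟩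
  · rw [PMF.map_comp, hf]; rfl
  · rw [PMF.map_comp, hg]; rfl
  · intro e he
    obtain ⟨c, hc, rfl⟩ := (PMF.mem_support_map_iff _ _ _).1 he
    exact h c hc

protected theorem pure {R : α → β → Prop} {a : α} {b : β} (h : R a b) :
    Couple (PMF.pure a) (PMF.pure b) R :=
  of_map (PMF.pure ()) (fun _ => a) (fun _ => b) (by simp [PMF.pure_map])
    (by simp [PMF.pure_map]) fun _ _ => h

theorem refl_of {μ : PMF α} {R : α → α → Prop} (h : ∀ a ∈ μ.support, R a a) : Couple μ μ R :=
  of_map μ id id (by rw [PMF.map_id]) (by rw [PMF.map_id]) h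

theorem mono {μ : PMF α} {ν : PMF β} {R R' : α → β → Prop} (h : Couple μ ν R)
    (hR : ∀ a b, R a b → R' a b) : Couple μ ν R' := by
  obtain ⟨E, h1, h2, h3⟩ := h
  exact ⟨E, h1, h2, fun e he => hR _ _ (h3 e he)⟩

theorem with_support {μ : PMF α} {ν : PMF β} {R : α → β → Prop} (h : Couple μ ν R) :
    Couple μ ν fun a b => R a b ∧ a ∈ μ.support ∧ b ∈ ν.support := by
  obtain ⟨E, rfl, rfl, h3⟩ := h
  exact ⟨E, rfl, rfl, fun e he => ⟨h3 e he, (PMF.mem_support_map_iff _ _ _).2 ⟨e, he, rfl⟩,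
    (PMF.mem_support_map_iff _ _ _).2 ⟨e, he, rfl⟩⟩⟩

protected theorem bind {μ : PMF α} {ν : PMF β} {R : α → β → Prop} {f : α → PMF α'}
    {g : β → PMF β'} {R' : α' → β' → Prop} (h : Couple μ ν R)
    (h' : ∀ a b, R a b → Couple (f a) (g b) R') : Couple (μ.bind f) (ν.bind g) R' := by
  classical
  obtain ⟨E, rfl, rfl, h3⟩ := h
  have hE : ∀ e : α × β, ∃ E' : PMF (α' × β'), R e.1 e.2 →
      (E'.map Prod.fst = f e.1 ∧ E'.map Prod.snd = g e.2 ∧ ∀ e ∈ E'.support, R' e.1 e.2) := by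
    intro e
    by_cases he : R e.1 e.2
    · obtain ⟨E', h⟩ := h' _ _ he
      exact ⟨E', fun _ => h⟩
    -- Outside the relation, which has probability `0` under `E`, any joint distribution will do.
    · exact ⟨(f e.1).bind fun a => (g e.2).map fun b => (a, b), fun h => absurd h he⟩
  choose E' hE' using hE
  refine ⟨E.bind E', ?_, ?_, ?_⟩
  · rw [PMF.map_bind, PMF.bind_map]
    exact bind_congr_of_support _ fun e he => (hE' e (h3 e he)).1
  · rw [PMF.map_bind, PMF.bind_map]
    exact bind_congr_of_support _ fun e he => (hE' e (h3 e he)).2.1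
  · intro x hx
    obtain ⟨e, he, hx⟩ := (PMF.mem_support_bind_iff _ _ _).1 hx
    exact (hE' e (h3 e he)).2.2 x hx

protected theorem map {μ : PMF α} {ν : PMF β} {R : α → β → Prop} {f : α → α'} {g : β → β'}
    {R' : α' → β' → Prop} (h : Couple μ ν R) (h' : ∀ a b, R a b → R' (f a) (g b)) :
    Couple (μ.map f) (ν.map g) R' :=
  h.bind fun a b hab => Couple.pure (h' a b hab)

theorem map_eq {μ : PMF α} {ν : PMF β} {R : α → β → Prop} {f : α → γ} {g : β → γ}
    (h : Couple μ ν R) (h' : ∀ a b, R a b → f a = g b) : μ.map f = ν.map g := by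
  obtain ⟨E, rfl, rfl, h3⟩ := h
  rw [PMF.map_comp, PMF.map_comp]
  exact map_congr_of_support _ fun e he => h' _ _ (h3 e he)

end Couple

/-! ### Uniform distributions -/

theorem uniformOfFintype_map_equiv {α β : Type} [Fintype α] [Nonempty α] [Fintype β] [Nonempty β]
    (e : α ≃ β) : (uniformOfFintype α).map e = uniformOfFintype β := by
  classical
  ext b
  rw [PMF.map_apply, tsum_eq_single (e.symm b)]
  · simp [Fintype.card_congr e]
  · intro a ha
    rw [if_neg]
    rintro rfl
    simp at ha

theorem uniformOfFintype_prod {α β : Type} [Fintype α] [Nonempty α] [Fintype β] [Nonempty β] :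
    uniformOfFintype (α × β) =
      (uniformOfFintype α).bind fun a => (uniformOfFintype β).map fun b => (a, b) := by
  classical
  ext ⟨a, b⟩
  rw [PMF.bind_apply, tsum_eq_single a, PMF.map_apply, tsum_eq_single b]
  · simp [ENNReal.mul_inv]
  · intro b' hb
    rw [if_neg]
    intro h
    exact hb (Prod.mk.inj h).2.symm
  · intro a' ha
    rw [PMF.map_apply]
    simp [ha.symm]

theorem uniformOfFinset_map_equiv {α β : Type} (e : α ≃ β) {S : Finset α} {T : Finset β}
    (hS : S.Nonempty) (hT : T.Nonempty) (h : ∀ a, a ∈ S ↔ e a ∈ T) :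
    (uniformOfFinset S hS).map e = uniformOfFinset T hT := by
  classical
  have hc : S.card = T.card := by
    refine Finset.card_equiv e ?_
    exact h
  ext b
  rw [PMF.map_apply, tsum_eq_single (e.symm b)]
  · simp [h, hc]
  · intro a ha
    rw [if_neg]
    rintro rfl
    simp at ha

/-- All fibres over the range of a homomorphism are cosets of the kernel and have the same size.
This is the source of every claim below that a linearly constrained sharing is uniform. -/
theorem uniformOfFintype_map_hom {G H : Type} [AddGroup G] [AddGroup H] [Fintype G]
    (f : G →+ H) {T : Finset H} (hT : T.Nonempty) (h1 : ∀ g, f g ∈ T)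
    (h2 : ∀ t ∈ T, ∃ g, f g = t) : (uniformOfFintype G).map f = uniformOfFinset T hT := by
  classical
  let N := (Finset.univ.filter fun g => f g = 0).card
  have hN : ∀ t ∈ T, (Finset.univ.filter fun g => f g = t).card = N := fun t ht =>
    AddMonoidHom.card_fiber_eq_of_mem_range f (by simpa using h2 t ht) ⟨0, by simp⟩
  have hcard : Fintype.card G = T.card * N := by
    rw [← Finset.card_univ, Finset.card_eq_sum_card_fiberwise (f := f) (t := T) fun g _ => h1 g,
      Finset.sum_congr rfl hN, Finset.sum_const, smul_eq_mul]
  have hN0 : N ≠ 0 := Finset.card_ne_zero.2 ⟨0, by simp⟩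
  ext t
  rw [PMF.map_apply, tsum_fintype]
  by_cases ht : t ∈ T
  · rw [uniformOfFinset_apply_of_mem _ ht]
    simp only [uniformOfFintype_apply]
    rw [← Finset.sum_filter, Finset.sum_const]
    have : (Finset.univ.filter fun g => t = f g).card = N := by
      rw [← hN t ht]; congr 1; ext; simp [eq_comm]
    rw [this, hcard, nsmul_eq_mul, Nat.cast_mul, ENNReal.mul_inv (by simp) (by simp), mul_comm,
      mul_assoc, ENNReal.inv_mul_cancel (by exact_mod_cast hN0) (by simp), mul_one]
  · rw [uniformOfFinset_apply_of_notMem _ ht]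
    refine Finset.sum_eq_zero fun g _ => ?_
    rw [if_neg]
    rintro rfl
    exact ht (h1 g)

/-! ### Products -/

theorem piPMF_apply {α : Type} : ∀ {n : ℕ} (d : Fin n → PMF α) (f : Fin n → α),
    piPMF d f = ∏ k, d k (f k)
  | 0, d, f => by
    classical
    show PMF.pure Fin.elim0 f = _
    simp [PMF.pure_apply, Subsingleton.elim f Fin.elim0]
  | n + 1, d, f => by
    classical
    show ((d 0).bind fun a => (piPMF fun i => d i.succ).bind fun t => PMF.pure (Fin.cons a t)) f = _
    rw [PMF.bind_apply, tsum_eq_single (f 0), PMF.bind_apply, tsum_eq_single (Fin.tail f),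
      piPMF_apply, Fin.prod_univ_succ]
    · simp [PMF.pure_apply, Fin.tail]
    · intro t ht
      rw [PMF.pure_apply, if_neg, mul_zero]
      intro h
      exact ht (funext fun i => by simpa [Fin.tail] using (congrFun h i.succ).symm)
    · intro a ha
      rw [PMF.bind_apply, ENNReal.tsum_eq_zero.2, mul_zero]
      intro t
      rw [PMF.pure_apply, if_neg, mul_zero]
      rintro rfl
      exact ha (by simp)

theorem piPMF_zero {α : Type} (d : Fin 0 → PMF α) : piPMF d = PMF.pure Fin.elim0 := rfl

theorem piPMF_succ {α : Type} {n : ℕ} (d : Fin (n + 1) → PMF α) :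
    piPMF d = (d 0).bind fun a => (piPMF fun i => d i.succ).map fun t => Fin.cons a t := rfl

theorem piPMF_uniform {α : Type} [Fintype α] [Nonempty α] {n : ℕ} :
    piPMF (fun _ : Fin n => uniformOfFintype α) = uniformOfFintype (Fin n → α) := by
  classical
  ext f
  rw [piPMF_apply]
  simp [ENNReal.inv_pow]

theorem piPMF_bind {α β : Type} : ∀ {n : ℕ} (d : Fin n → PMF α) (e : Fin n → α → PMF β),
    ((piPMF d).bind fun a => piPMF fun k => e k (a k)) = piPMF fun k => (d k).bind (e k)
  | 0, d, e => by simp [piPMF_zero]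
  | n + 1, d, e => by
    simp only [piPMF_succ, PMF.bind_bind, PMF.bind_map, Function.comp_def, Fin.cons_zero,
      Fin.cons_succ]
    congr 1; funext a
    -- The tail of the first stage is moved past the second-stage sample of the head.
    rw [PMF.bind_comm]
    congr 1; funext b
    rw [← piPMF_bind, PMF.map_bind]

theorem piPMF_pure {α : Type} : ∀ {n : ℕ} (f : Fin n → α),
    piPMF (fun k => PMF.pure (f k)) = PMF.pure f
  | 0, f => by rw [piPMF_zero]; congr 1; exact Subsingleton.elim _ _
  | n + 1, f => by
    rw [piPMF_succ, piPMF_pure, PMF.pure_bind, PMF.pure_map]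
    congr 1; exact Fin.cons_self_tail f

theorem piPMF_map {α β : Type} {n : ℕ} (d : Fin n → PMF α) (g : Fin n → α → β) :
    (piPMF d).map (fun a k => g k (a k)) = piPMF fun k => (d k).map (g k) := by
  have := piPMF_bind d fun k a => PMF.pure (g k a)
  simp only [piPMF_pure] at this
  exact this

theorem piPMF_marginal {α : Type} : ∀ {n : ℕ} (d : Fin n → PMF α) (k : Fin n),
    (piPMF d).map (fun f => f k) = d k
  | n + 1, d, k => by
    rw [piPMF_succ, PMF.map_bind]
    simp only [PMF.map_comp]
    refine Fin.cases ?_ (fun k => ?_) k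
    · simp only [Function.comp_def, Fin.cons_zero]
      conv_rhs => rw [← PMF.bind_pure (d 0)]
      congr 1; funext a
      exact PMF.map_const _ _
    · simp only [Function.comp_def, Fin.cons_succ]
      rw [piPMF_marginal (fun i => d i.succ) k, PMF.bind_const]

theorem mem_support_piPMF {α : Type} {n : ℕ} {d : Fin n → PMF α} {f : Fin n → α}
    (h : f ∈ (piPMF d).support) (k : Fin n) : f k ∈ (d k).support := by
  rw [PMF.mem_support_iff, piPMF_apply, Finset.prod_ne_zero_iff] at h
  exact h k (Finset.mem_univ k)

/-- Independent samples from a list of distributions. -/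
def listPMF {α : Type} : List (PMF α) → PMF (List α)
  | [] => PMF.pure []
  | d :: ds => d.bind fun a => (listPMF ds).map fun l => a :: l

theorem listPMF_append {α : Type} : ∀ ds es : List (PMF α),
    listPMF (ds ++ es) = (listPMF ds).bind fun l => (listPMF es).map fun l' => l ++ l'
  | [], es => by simp only [listPMF, List.nil_append, PMF.pure_bind]; exact (PMF.map_id _).symm
  | d :: ds, es => by
    simp only [listPMF, List.cons_append, PMF.bind_bind, PMF.bind_map, listPMF_append ds,
      PMF.map_bind, PMF.map_comp, Function.comp_def]

theorem listPMF_ofFn {α : Type} : ∀ {n : ℕ} (d : Fin n → PMF α),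
    listPMF (List.ofFn d) = (piPMF d).map List.ofFn
  | 0, d => by simp [listPMF, piPMF_zero, PMF.pure_map]
  | n + 1, d => by
    rw [List.ofFn_succ, listPMF, listPMF_ofFn, piPMF_succ, PMF.map_bind]
    simp only [PMF.map_comp, Function.comp_def, List.ofFn_succ, Fin.cons_zero, Fin.cons_succ]

theorem length_of_mem_support_listPMF {α : Type} : ∀ {ds : List (PMF α)} {l : List α},
    l ∈ (listPMF ds).support → l.length = ds.length
  | [], l, h => by simp_all [listPMF]
  | d :: ds, l, h => by
    simp only [listPMF, PMF.mem_support_bind_iff, PMF.mem_support_map_iff] at h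
    obtain ⟨a, -, l', h, rfl⟩ := h
    simp [length_of_mem_support_listPMF h]

/-! ### Closeness -/

/-- Off the bad event `B` the two mixtures have identical contributions, which cancel. What is left
on either side has total mass `μ B`, and the factor `1/2` in the distance makes up for there being
two sides. -/
theorem statDist_bind_le {α β : Type} (μ : PMF α) (f g : α → PMF β) (B : Set α)
    (h : ∀ a ∈ μ.support, a ∉ B → f a = g a) :
    statDist (μ.bind f) (μ.bind g) ≤ (μ.toOuterMeasure B).toReal := by
  classical
  let F : (α → PMF β) → β → ENNReal := fun f b => ∑' a, B.indicator μ a * f a b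
  let H : β → ENNReal := fun b => ∑' a, Bᶜ.indicator μ a * f a b
  have hsplit : ∀ (f : α → PMF β) b,
      (μ.bind f) b = (∑' a, Bᶜ.indicator μ a * f a b) + F f b := by
    intro f b
    rw [PMF.bind_apply, ← ENNReal.tsum_add]
    refine tsum_congr fun a => ?_
    by_cases ha : a ∈ B <;> simp [ha]
  have hH : ∀ b, (∑' a, Bᶜ.indicator μ a * g a b) = H b := by
    intro b
    refine tsum_congr fun a => ?_
    by_cases ha : a ∈ B
    · simp [ha]
    · by_cases hs : a ∈ μ.support
      · rw [h a hs ha]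
      · simp [ha, (μ.apply_eq_zero_iff a).2 hs]
  have hF : ∀ f, ∑' b, F f b = μ.toOuterMeasure B := by
    intro f
    rw [ENNReal.tsum_comm, PMF.toOuterMeasure_apply]
    refine tsum_congr fun a => ?_
    rw [ENNReal.tsum_mul_left, PMF.tsum_coe, mul_one]
  have hB : μ.toOuterMeasure B ≠ ⊤ := by
    rw [PMF.toOuterMeasure_apply]; exact μ.tsum_coe_indicator_ne_top B
  have hFt : ∀ f b, F f b ≠ ⊤ := fun f b =>
    ne_top_of_le_ne_top hB ((ENNReal.le_tsum b).trans_eq (hF f))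
  have hHt : ∀ b, H b ≠ ⊤ := fun b => by
    refine ne_top_of_le_ne_top (PMF.apply_ne_top (μ.bind f) b) ?_
    rw [hsplit f b]; exact le_self_add
  have hle : ∀ b, |((μ.bind f) b).toReal - ((μ.bind g) b).toReal| ≤
      (F f b).toReal + (F g b).toReal := by
    intro b
    rw [hsplit f b, hsplit g b, hH b, ENNReal.toReal_add (hHt b) (hFt f b),
      ENNReal.toReal_add (hHt b) (hFt g b), add_sub_add_left_eq_sub]
    refine (abs_sub _ _).trans ?_
    rw [abs_of_nonneg ENNReal.toReal_nonneg, abs_of_nonneg ENNReal.toReal_nonneg]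
  have hs : ∀ f, HasSum (fun b => (F f b).toReal) (μ.toOuterMeasure B).toReal := by
    intro f
    rw [← hF f, ENNReal.tsum_toReal_eq (hFt f)]
    exact (ENNReal.summable_toReal (by rw [hF f]; exact hB)).hasSum
  have h2 := (hs f).add (hs g)
  have hsum : Summable fun b => |((μ.bind f) b).toReal - ((μ.bind g) b).toReal| :=
    Summable.of_nonneg_of_le (fun _ => abs_nonneg _) hle h2.summable
  have := hsum.tsum_le_tsum hle h2.summable
  rw [h2.tsum_eq] at this
  rw [statDist]
  linarith

/-- The probability of `true`. -/
def probTrue (X : PMF Bool) : ℝ := (X true).toReal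

/-- The probabilities of `false` are determined by those of `true`, so the two summands of the
distance are equal. -/
theorem abs_probTrue_sub_le_statDist (X Y : PMF Bool) :
    |probTrue X - probTrue Y| ≤ statDist X Y := by
  have hX : ∀ X : PMF Bool, (X false).toReal = 1 - (X true).toReal := by
    intro X
    have := X.tsum_coe
    rw [tsum_bool] at this
    have h2 := congrArg ENNReal.toReal this
    rw [ENNReal.toReal_add (X.apply_ne_top _) (X.apply_ne_top _)] at h2
    simp at h2
    linarith
  rw [statDist, tsum_bool, hX X, hX Y, probTrue, probTrue]
  have : |1 - (X true).toReal - (1 - (Y true).toReal)| = |(X true).toReal - (Y true).toReal| := by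
    rw [← abs_neg]; congr 1; ring
  rw [this]; linarith

theorem probTrue_le_one (X : PMF Bool) : probTrue X ≤ 1 :=
  ENNReal.toReal_le_of_le_ofReal zero_le_one (by simpa using X.coe_le_one true)

theorem probTrue_nonneg (X : PMF Bool) : 0 ≤ probTrue X := ENNReal.toReal_nonneg

/-- An average of numbers bounded by `ε` is bounded by `ε`. This lets the hybrid argument fix all
random choices but one, to be hard-wired into a circuit. -/
theorem abs_probTrue_bind_sub_le {α : Type} (μ : PMF α) (f g : α → PMF Bool) {ε : ℝ}
    (h : ∀ a ∈ μ.support, |probTrue (f a) - probTrue (g a)| ≤ ε) :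
    |probTrue (μ.bind f) - probTrue (μ.bind g)| ≤ ε := by
  have hb : ∀ f : α → PMF Bool, HasSum (fun a => (μ a).toReal * probTrue (f a))
      (probTrue (μ.bind f)) := by
    intro f
    have hne : ∀ a, μ a * f a true ≠ ⊤ := fun a =>
      ENNReal.mul_ne_top (μ.apply_ne_top _) ((f a).apply_ne_top _)
    have hs : ∑' a, μ a * f a true ≠ ⊤ := by
      rw [← PMF.bind_apply]; exact PMF.apply_ne_top _ _
    rw [probTrue, PMF.bind_apply, ENNReal.tsum_toReal_eq hne]
    simp only [probTrue, ← ENNReal.toReal_mul]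
    exact (ENNReal.summable_toReal hs).hasSum
  have h1 : HasSum (fun a => (μ a).toReal) 1 := by
    have : (1 : ℝ) = ∑' a, (μ a).toReal := by
      rw [← ENNReal.tsum_toReal_eq fun a => μ.apply_ne_top a, μ.tsum_coe]; simp
    rw [this]
    exact (ENNReal.summable_toReal μ.tsum_coe_ne_top).hasSum
  have hd := (hb f).sub (hb g)
  have h1ε := h1.mul_right ε
  rw [one_mul] at h1ε
  have key : ∀ a, |(μ a).toReal * probTrue (f a) - (μ a).toReal * probTrue (g a)| ≤
      (μ a).toReal * ε := by
    intro a
    by_cases ha : a ∈ μ.support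
    · rw [← mul_sub, abs_mul, abs_of_nonneg ENNReal.toReal_nonneg]
      exact mul_le_mul_of_nonneg_left (h a ha) ENNReal.toReal_nonneg
    · simp [(μ.apply_eq_zero_iff a).2 ha]
  rw [abs_le]
  constructor
  · have := hasSum_le (fun a => (abs_le.1 (key a)).1) h1ε.neg hd
    exact this
  · exact hasSum_le (fun a => (abs_le.1 (key a)).2) hd h1ε

end
end ZeroSharing

namespace ZeroSharing
noncomputable section
open PMF (uniformOfFintype uniformOfFinset)

/-! ### The protocol as an explicit distribution -/

variable {p : Params}

/-- The shared value. -/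
def total (s : p.Shares) : Fin p.n → p.F := fun k => ∑ i, s i k

theorem total_add (s t : p.Shares) : total (s + t) = total s + total t := by
  funext k; simp [total, Finset.sum_add_distrib]

theorem total_sub (s t : p.Shares) : total (s - t) = total s - total t := by
  funext k; simp [total]

theorem total_single (h : Fin p.m) (v : Fin p.n → p.F) :
    total (Pi.single h v : p.Shares) = v := by
  classical
  funext k
  rw [total, Finset.sum_eq_single h]
  · simp
  · intro i _ hi; simp [Pi.single_eq_of_ne hi]
  · simp

theorem total_mul (u : Fin p.n → p.F) (s : p.Shares) :
    total (fun i => u * s i) = u * total s := by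
  funext k; simp [total, Finset.mul_sum]

theorem total_twoPartyShares (u : Fin p.n → p.F) (j : p.toShape.Other) (r : Fin p.n → p.F) :
    total (twoPartyShares u j r) = u + r := by
  funext k
  have hne := j.2
  rw [total, Finset.sum_eq_add p.pivot j.1 (Ne.symm hne)]
  · simp [twoPartyShares, hne]
  · intro i _ hi; simp [twoPartyShares, hi.1, hi.2]
  · simp
  · simp

/-- What the parties receive in an opening. -/
def openView (s : p.Shares) : Views p := fun i =>
  if i = p.leader then
    ((List.finRange p.m).filter fun j => j ≠ p.leader).flatMap fun j => p.wordsF (s j)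
  else p.wordsF fun k => ∑ j, s j k

/-- The shares of Beaver triples as words. -/
def tripleView (t : Triples p) : Views p := fun i =>
  p.wordsF (t.a i) ++ p.wordsF (t.b i) ++ p.wordsF (t.c i)

/-- What the parties receive in a multiplication. -/
def mulView (t : Triples p) (r r' : p.Shares) : Views p := fun i =>
  tripleView t i ++ (openView (r - t.a) i ++ openView (r' - t.b) i)

/-- The shares after a multiplication. -/
def mulOut (t : Triples p) (r r' : p.Shares) : p.Shares := fun i k =>
  (if i = p.leader then total (r - t.a) k * total (r' - t.b) k else 0) +
    total (r - t.a) k * t.b i k + total (r' - t.b) k * t.a i k + t.c i k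

/-- What the parties receive in the final transformation. -/
def transView (t : Triples p) (r : p.Shares) : Views p := fun i =>
  tripleView t i ++ openView (r + t.a) i

/-- The shares after the final transformation. -/
def transOut (t : Triples p) (r : p.Shares) : p.Shares := fun i k =>
  total (r + t.a) k * t.b i k - t.c i k

/-- What the parties see in the protocol for `x ∈ X_j`. -/
def memView (j : p.toShape.Other) (r : Fin p.n → p.F) (key : Fin p.n → p.Key) (h : Fin p.n → Word)
    (u : Fin p.n → p.F) : Views p := fun i =>
  if i = j.1 then p.wordsF r ++ ((List.ofFn fun k => List.ofFn (key k)) ++ List.ofFn h)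
  else if i = p.pivot then p.wordsF u else []

/-- What the parties see in the protocol for `x ∉ X_j`. -/
def notMemView (j : p.toShape.Other) (e0 e1 : Fin p.n → Bool) (r : Bool → Fin p.n → p.F)
    (u : Fin p.n → p.F) : Views p := fun i =>
  if i = j.1 then (List.ofFn fun k => [e0 k]) ++ (p.wordsF (r false) ++ p.wordsF (r true))
  else if i = p.pivot then (List.ofFn fun k => [e1 k]) ++ p.wordsF u else []

/-- Shares, views, and values. -/
abbrev Transcript (p : Params) : Type := p.Shares × Views p × (Fin p.n → p.F)

/-- The real protocol for `x ∈ X_j`. -/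
def realMem (inp : Input p) (j : p.toShape.Other) : PMF (Transcript p) :=
  (uniformOfFintype (Fin p.n → p.F)).bind fun r =>
    (bOPPRF p (fun k => inp.X j k ×ˢ {-r k}) inp.x).map fun o =>
      (twoPartyShares o.2.2 j r, memView j r o.1 o.2.1 o.2.2, o.2.2 + r)

/-- The real protocol for `x ∉ X_j`. -/
def realNotMem (inp : Input p) (j : p.toShape.Other) : PMF (Transcript p) :=
  (bssPMT p (inp.X j) inp.x).bind fun e => (bROT p e.2).map fun o =>
    (twoPartyShares o.2 j fun k => -o.1 (e.1 k) k, notMemView j e.1 e.2 o.1 o.2,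
      o.2 + fun k => -o.1 (e.1 k) k)

/-- The evaluation of a formula, given the distribution of triples and the protocols for the
literals, which consume `n` elements of a list each. -/
def evalFormula (tri : PMF (Triples p)) (litM litN : p.toShape.Other → List p.F → PMF (Transcript p)) :
    SetFormula p.toShape.Other → List p.F → PMF (Transcript p)
  | .mem j, U => litM j U
  | .notMem j, U => litN j U
  | .and A B, U =>
    (evalFormula tri litM litN A (U.take (A.literals * p.n))).bind fun x =>
      (evalFormula tri litM litN B (U.drop (A.literals * p.n))).map fun y =>
        (x.1 + y.1, fun i => x.2.1 i ++ y.2.1 i, x.2.2 + y.2.2)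
  | .or A B, U =>
    (evalFormula tri litM litN A (U.take (A.literals * p.n))).bind fun x =>
      (evalFormula tri litM litN B (U.drop (A.literals * p.n))).bind fun y =>
        tri.map fun t =>
          (mulOut t x.1 y.1, fun i => x.2.1 i ++ (y.2.1 i ++ mulView t x.1 y.1 i), x.2.2 * y.2.2)

/-- The real evaluation of a formula. -/
def realEval (inp : Input p) (Q : SetFormula p.toShape.Other) : PMF (Transcript p) :=
  evalFormula (beaver p) (fun j _ => realMem inp j) (fun j _ => realNotMem inp j) Q []

theorem run_bind {α β : Type} (x : Exec p α) (f : α → Exec p β) (v : Views p) :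
    (x >>= f).run v = (x.run v).bind fun y => (f y.1).run y.2 := rfl

theorem run_sample_bind {α β : Type} (d : PMF α) (f : α → Exec p β) (v : Views p) :
    (sample d >>= f).run v = d.bind fun a => (f a).run v := by
  rw [run_bind]
  show (d.bind fun a => PMF.pure (a, v)).bind _ = _
  rw [PMF.bind_bind]
  simp only [PMF.pure_bind]

theorem run_recordAll_bind {β : Type} (ws : Fin p.m → List Word) (f : Unit → Exec p β) (v : Views p) :
    (recordAll ws >>= f).run v = (f ()).run fun i => v i ++ ws i := by
  rw [run_bind]
  show (PMF.pure ((), fun i => v i ++ ws i)).bind _ = _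
  rw [PMF.pure_bind]

theorem run_record_bind {β : Type} (j : Fin p.m) (ws : List Word) (f : Unit → Exec p β) (v : Views p) :
    (record j ws >>= f).run v = (f ()).run fun i => v i ++ if i = j then ws else [] :=
  run_recordAll_bind _ _ _

theorem run_pure {α : Type} (a : α) (v : Views p) :
    (pure a : Exec p α).run v = PMF.pure (a, v) := rfl

theorem run_opening_bind {β : Type} (s : p.Shares) (f : (Fin p.n → p.F) → Exec p β) (v : Views p) :
    (opening s >>= f).run v = (f (total s)).run fun i => v i ++ openView s i := by
  unfold opening
  rw [bind_assoc, run_recordAll_bind, pure_bind]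
  rfl

theorem run_dealTriples_bind {β : Type} (f : Triples p → Exec p β) (v : Views p) :
    (dealTriples >>= f).run v = (beaver p).bind fun t => (f t).run fun i => v i ++ tripleView t i := by
  unfold dealTriples
  simp only [bind_assoc, run_sample_bind, run_recordAll_bind, pure_bind]
  rfl

theorem run_multiply (r r' : p.Shares) (v : Views p) :
    (multiply r r').run v =
      (beaver p).map fun t => (mulOut t r r', fun i => v i ++ mulView t r r' i) := by
  unfold multiply
  rw [run_dealTriples_bind]
  refine congrArg _ (funext fun t => ?_)
  rw [run_opening_bind, run_opening_bind, run_pure]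
  simp only [mulView, List.append_assoc]
  rfl

theorem run_transform (r : p.Shares) (v : Views p) :
    (transform r).run v =
      (beaver p).map fun t => (transOut t r, fun i => v i ++ transView t r i) := by
  unfold transform
  rw [run_dealTriples_bind]
  refine congrArg _ (funext fun t => ?_)
  rw [run_opening_bind, run_pure]
  simp only [transView, List.append_assoc]
  rfl

/-- Executions only append to the views and never read them, so the initial views split off as a
prefix. -/
theorem run_emulate (inp : Input p) (Q : SetFormula p.toShape.Other) (v : Views p) :
    (emulate inp Q).run v = (realEval inp Q).map fun x => (x.1, fun i => v i ++ x.2.1 i) := by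
  induction Q generalizing v with
  | mem j =>
    simp only [emulate, shareMem, run_sample_bind, realEval, evalFormula, realMem, PMF.map_bind,
      run_record_bind, run_pure, PMF.map_comp]
    refine congrArg _ (funext fun r => ?_)
    refine congrArg (PMF.bind _) (funext fun o => ?_)
    simp only [Function.comp_def]
    refine congrArg PMF.pure (Prod.ext rfl (funext fun i => ?_))
    -- The sender of a literal is never the pivot, so the two lists of records belong to different
    -- parties.
    have hj := j.2
    by_cases h1 : i = j.1
    · subst h1; simp [memView, hj]
    · by_cases h2 : i = p.pivot
      · subst h2; simp [memView, h1]
      · simp [memView, h1, h2]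
  | notMem j =>
    simp only [emulate, shareNotMem, run_sample_bind, realEval, evalFormula, realNotMem,
      PMF.map_bind, run_record_bind, run_pure, PMF.map_comp]
    refine congrArg _ (funext fun r => ?_)
    refine congrArg (PMF.bind _) (funext fun o => ?_)
    simp only [Function.comp_def]
    refine congrArg PMF.pure (Prod.ext rfl (funext fun i => ?_))
    have hj := j.2
    by_cases h1 : i = j.1
    · subst h1; simp [notMemView, hj]
    · by_cases h2 : i = p.pivot
      · subst h2; simp [notMemView, h1]
      · simp [notMemView, h1, h2]
  | and A B hA hB =>
    simp only [emulate, run_bind, hA, hB, realEval, evalFormula, run_pure, List.take_nil,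
      List.drop_nil, PMF.bind_map, PMF.map_bind, PMF.map_comp, Function.comp_def, List.append_assoc]
    rfl
  | or A B hA hB =>
    simp only [emulate, run_bind, hA, hB, realEval, evalFormula, run_multiply, List.take_nil,
      List.drop_nil, PMF.bind_map, PMF.map_bind, PMF.map_comp, Function.comp_def, List.append_assoc]

theorem protocol_eq (inp : Input p) :
    protocol inp = (realEval inp p.Q).bind fun x => (beaver p).map fun t =>
      (transOut t x.1, fun i => inp.words i ++ (x.2.1 i ++ transView t x.1 i)) := by
  unfold protocol
  simp only [run_bind, run_emulate, run_transform, PMF.bind_map, Function.comp_def,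
    List.append_assoc]

/-! ### Masking by Beaver triples -/

/-- Independent uniform triples. -/
def looseTriples (p : Params) : PMF (Triples p) :=
  (uniformOfFintype (p.Shares × p.Shares × p.Shares)).map fun t => ⟨t.1, t.2.1, t.2.2⟩

/-- Change the share of party `h` so that the triple is a Beaver triple. -/
def fixTriple (h : Fin p.m) (t : p.Shares × p.Shares × p.Shares) : Triples p :=
  ⟨t.1, t.2.1, t.2.2 + Pi.single h (total t.1 * total t.2.1 - total t.2.2)⟩

/-- The constraint `c = a b` is not additive, so it is reached in two moves: the homomorphism `f`
projects the sharing of `c` to a uniform sharing of `0`, and the bijection `e` adds the product of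
the totals to the share of `h`. -/
theorem beaver_eq (h : Fin p.m) :
    beaver p = (uniformOfFintype (p.Shares × p.Shares × p.Shares)).map (fixTriple h) := by
  classical
  let f : (p.Shares × p.Shares × p.Shares) →+ (p.Shares × p.Shares × p.Shares) :=
    { toFun := fun t => (t.1, t.2.1, t.2.2 - Pi.single h (total t.2.2))
      map_zero' := by
        have : total (0 : p.Shares) = 0 := by funext k; simp [total]
        simp [this]
      map_add' := by
        intro s t
        simp only [Prod.fst_add, Prod.snd_add, total_add, Pi.single_add, Prod.mk_add_mk]
        congr 2
        abel }
  let T : Finset (p.Shares × p.Shares × p.Shares) :=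
    Finset.univ.filter fun t => total t.2.2 = 0
  have h0 : total (0 : p.Shares) = 0 := by funext k; simp [total]
  have hT : T.Nonempty := ⟨0, by simp [T, h0]⟩
  have hf : (uniformOfFintype (p.Shares × p.Shares × p.Shares)).map f = uniformOfFinset T hT := by
    refine uniformOfFintype_map_hom f hT ?_ ?_
    · intro t
      simp [T, f, total_sub, total_single]
    · intro t ht
      refine ⟨t, ?_⟩
      simp only [T, Finset.mem_filter, Finset.mem_univ, true_and] at ht
      simp [f, ht]
  let e : (p.Shares × p.Shares × p.Shares) ≃ (p.Shares × p.Shares × p.Shares) :=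
    { toFun := fun t => (t.1, t.2.1, t.2.2 + Pi.single h (total t.1 * total t.2.1))
      invFun := fun t => (t.1, t.2.1, t.2.2 - Pi.single h (total t.1 * total t.2.1))
      left_inv := fun t => by simp
      right_inv := fun t => by simp }
  rw [show beaver p = ((uniformOfFinset T hT).map e).map
    fun t => (⟨t.1, t.2.1, t.2.2⟩ : Triples p) from ?_, ← hf, PMF.map_comp, PMF.map_comp]
  · congr 1
    funext t
    simp only [Function.comp_apply, fixTriple, e, f, AddMonoidHom.coe_mk, ZeroHom.coe_mk,
      Equiv.coe_fn_mk, Pi.single_sub]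
    congr 1
    abel
  · refine congrArg (PMF.map _) (uniformOfFinset_map_equiv e hT _ fun t => ?_).symm
    simp only [T, e, Finset.mem_filter, Finset.mem_univ, true_and, Equiv.coe_fn_mk]
    have hs : ∀ k, (∑ i, (t.2.2 + Pi.single h (total t.1 * total t.2.1) : p.Shares) i k) =
        total t.2.2 k + total t.1 k * total t.2.1 k := by
      intro k
      have := congrFun (total_add t.2.2 (Pi.single h (total t.1 * total t.2.1))) k
      rw [total_single] at this
      exact this
    simp only [hs]
    rw [funext_iff]
    refine forall_congr' fun k => ?_
    show _ ↔ total t.2.2 k + total t.1 k * total t.2.1 k = total t.1 k * total t.2.1 k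
    simp

/-- Beaver's identity `(r - a)(r' - b) + (r - a) b + (r' - b) a + a b = r r'`; the first term is
counted once because only the leader adds it. -/
theorem total_mulOut {t : Triples p} (ht : total t.c = total t.a * total t.b) (r r' : p.Shares) :
    total (mulOut t r r') = total r * total r' := by
  funext k
  have hc := congrFun ht k
  have ha := congrFun (total_sub r t.a) k
  have hb := congrFun (total_sub r' t.b) k
  have : total (mulOut t r r') k = total (r - t.a) k * total (r' - t.b) k +
      total (r - t.a) k * total t.b k + total (r' - t.b) k * total t.a k + total t.c k := by
    simp [total, mulOut, Finset.sum_add_distrib, Finset.mul_sum]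
  rw [this, hc, ha, hb]
  simp only [Pi.sub_apply, Pi.mul_apply]
  ring

theorem total_fixTriple (h : Fin p.m) (t : p.Shares × p.Shares × p.Shares) :
    total (fixTriple h t).c = total (fixTriple h t).a * total (fixTriple h t).b := by
  simp [fixTriple, total_add, total_single]

/-- Translating the masks by `r - z` and `r' - z'` makes every share of the opened values the same
on both sides, including what the leader sees. For a corrupted party the translation is zero because
the shares agree, and the correction of `c` touches only the honest `h`. -/
theorem couple_mul {A : Finset (Fin p.m)} {h : Fin p.m} (hA : h ∉ A) {r r' z z' : p.Shares}
    (hr : ∀ i ∈ A, r i = z i) (hr' : ∀ i ∈ A, r' i = z' i) :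
    Couple (beaver p) (looseTriples p) fun t t' =>
      (∀ i ∈ A, mulOut t r r' i = mulOut t' z z' i ∧ mulView t r r' i = mulView t' z z' i) ∧
      total (mulOut t r r') = total r * total r' := by
  let e : (p.Shares × p.Shares × p.Shares) ≃ (p.Shares × p.Shares × p.Shares) :=
    (Equiv.addRight (r - z)).prodCongr ((Equiv.addRight (r' - z')).prodCongr (Equiv.refl _))
  refine Couple.of_map (uniformOfFintype (p.Shares × p.Shares × p.Shares))
    (fixTriple h ∘ e) (fun t => ⟨t.1, t.2.1, t.2.2⟩) ?_ rfl ?_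
  · rw [beaver_eq h]
    conv_lhs => rw [← uniformOfFintype_map_equiv e]
    rw [PMF.map_comp]
  · rintro ⟨a, b, c⟩ -
    refine ⟨fun i hi => ?_, total_mulOut (total_fixTriple h _) r r'⟩
    have hih : i ≠ h := fun e => hA (e ▸ hi)
    have e1 : r - (a + (r - z)) = z - a := by abel
    have e2 : r' - (b + (r' - z')) = z' - b := by abel
    have e3 : (a + (r - z)) i = a i := by simp [hr i hi]
    have e4 : (b + (r' - z')) i = b i := by simp [hr' i hi]
    have e5 : ∀ v, (c + Pi.single h v : p.Shares) i = c i := by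
      intro v; simp [Pi.single_eq_of_ne hih]
    constructor
    · funext k
      simp only [Function.comp_apply, e, Equiv.prodCongr_apply, Prod.map, Equiv.coe_addRight,
        Equiv.refl_apply, fixTriple, mulOut, e1, e2, e3, e4, e5]
    · simp only [Function.comp_apply, e, Equiv.prodCongr_apply, Prod.map, Equiv.coe_addRight,
        Equiv.refl_apply, fixTriple, mulView, tripleView, e1, e2, e3, e4, e5]

open Classical in
/-- Uniform shares that add up to `0` in every instance in which `V` is `0`. -/
def zeroShares (V : Fin p.n → p.F) : PMF p.Shares :=
  uniformOfFinset (Finset.univ.filter fun s : p.Shares => ∀ k, V k = 0 → ∑ i, s i k = 0)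
    ⟨0, by simp⟩

/-- The triple of the final transformation, computed from its output. -/
def simTriple (z s : p.Shares) (ab : p.Shares × p.Shares) : Triples p :=
  ⟨ab.1, ab.2, fun i k => total (z + ab.1) k * ab.2 i k - s i k⟩

/-- Multiplication by a uniform `w.2` sends `V k = 0` to `0` and any other `V k` to a uniform
element. Correcting the share of `h` to this total gives exactly the sharings that the functionality
allows when the zeros of `V` are the true instances. -/
theorem zeroShares_eq (h : Fin p.m) (V : Fin p.n → p.F) :
    zeroShares V = (uniformOfFintype (p.Shares × (Fin p.n → p.F))).map fun w =>
      w.1 + (Pi.single h (V * w.2 - total w.1) : p.Shares) := by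
  classical
  have h0 : total (0 : p.Shares) = 0 := by funext k; simp [total]
  let f : (p.Shares × (Fin p.n → p.F)) →+ p.Shares :=
    { toFun := fun w => w.1 + Pi.single h (V * w.2 - total w.1)
      map_zero' := by simp [h0]
      map_add' := by
        intro s t
        simp only [Prod.fst_add, Prod.snd_add, total_add, mul_add]
        rw [show V * s.2 + V * t.2 - (total s.1 + total t.1) =
          (V * s.2 - total s.1) + (V * t.2 - total t.1) by abel, Pi.single_add]
        abel }
  symm
  refine uniformOfFintype_map_hom f _ ?_ ?_
  · intro w
    simp only [Finset.mem_filter, Finset.mem_univ, true_and]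
    intro k hk
    have : total (f w) k = 0 := by
      simp [f, total_add, total_single, hk]
    exact this
  · intro s hs
    simp only [Finset.mem_filter, Finset.mem_univ, true_and] at hs
    -- Where `V k = 0`, the inverse is `0` by convention; this is harmless since the total of `s`
    -- vanishes there.
    refine ⟨(s, fun k => (V k)⁻¹ * total s k), ?_⟩
    have : V * (fun k => (V k)⁻¹ * total s k) - total s = 0 := by
      funext k
      simp only [Pi.sub_apply, Pi.mul_apply, Pi.zero_apply]
      by_cases hk : V k = 0
      · rw [show total s k = 0 from hs k hk]; simp
      · field_simp; simp
    simp [f, this]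

/-- The output shares are `s = u b - c`, so `c = u b - s` can be recovered from an output sampled in
advance. The total of `s` is `r b`, and the honest share of `b` is left free to make the total of
`b` whatever the output requires. -/
theorem couple_trans {A : Finset (Fin p.m)} {h : Fin p.m} (hA : h ∉ A) {r z : p.Shares}
    (hr : ∀ i ∈ A, r i = z i) :
    Couple (beaver p) ((zeroShares (total r)).bind fun s =>
        (uniformOfFintype (p.Shares × p.Shares)).map fun ab => (s, ab))
      fun t o => transOut t r = o.1 ∧
        ∀ i ∈ A, transView t r i = transView (simTriple z o.1 o.2) z i := by
  classical
  -- Here `w.1` holds the uncorrected output shares and the intended total of `b`, and `w.2` the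
  -- shares of `a` and `b` that the simulation uses; only the share of `b` at `h` is adjusted.
  let f : ((p.Shares × (Fin p.n → p.F)) × (p.Shares × p.Shares)) →+
      (p.Shares × p.Shares × p.Shares) :=
    { toFun := fun w => (w.2.1, w.2.2 + Pi.single h (w.1.2 - total w.2.2), w.1.1)
      map_zero' := by
        have h0 : total (0 : p.Shares) = 0 := by funext k; simp [total]
        simp [h0]
      map_add' := by
        intro s t
        simp only [Prod.fst_add, Prod.snd_add, total_add, Prod.mk_add_mk]
        rw [show s.1.2 + t.1.2 - (total s.2.2 + total t.2.2) =
          (s.1.2 - total s.2.2) + (t.1.2 - total t.2.2) by abel, Pi.single_add]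
        congr 2
        abel }
  have hf : (uniformOfFintype ((p.Shares × (Fin p.n → p.F)) × (p.Shares × p.Shares))).map f =
      uniformOfFintype (p.Shares × p.Shares × p.Shares) := by
    refine uniformOfFintype_map_hom f _ (fun _ => Finset.mem_univ _) ?_
    rintro ⟨a, b, c⟩ -
    exact ⟨((c, total b), (a, b)), by simp [f]⟩
  -- The translation of `a` makes the openings of `r + a` and `z + a` coincide, and the last
  -- component passes from output shares to shares of `c`.
  let e : (p.Shares × p.Shares × p.Shares) ≃ (p.Shares × p.Shares × p.Shares) :=
    { toFun := fun t => (t.1 + (z - r), t.2.1, (fun i => total (z + t.1) * t.2.1 i) - t.2.2)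
      invFun := fun t => (t.1 - (z - r), t.2.1,
        (fun i => total (z + (t.1 - (z - r))) * t.2.1 i) - t.2.2)
      left_inv := fun t => by simp
      right_inv := fun t => by simp }
  refine Couple.of_map
    (uniformOfFintype ((p.Shares × (Fin p.n → p.F)) × (p.Shares × p.Shares)))
    (fixTriple h ∘ e ∘ f)
    (fun w => (w.1.1 + Pi.single h (total r * w.1.2 - total w.1.1), w.2)) ?_ ?_ ?_
  · rw [beaver_eq h, ← PMF.map_comp (f := e ∘ f), ← PMF.map_comp (f := f) (g := e), hf,
      uniformOfFintype_map_equiv e]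
  · rw [zeroShares_eq h,
      uniformOfFintype_prod (α := p.Shares × (Fin p.n → p.F)) (β := p.Shares × p.Shares),
      PMF.bind_map, PMF.map_bind]
    simp only [PMF.map_comp, Function.comp_def]
  · rintro ⟨⟨w, y⟩, ⟨a, b⟩⟩ -
    simp only [Function.comp_apply, f, e, AddMonoidHom.coe_mk, ZeroHom.coe_mk, Equiv.coe_fn_mk,
      fixTriple]
    have ez : r + (a + (z - r)) = z + a := by abel
    set b' : p.Shares := b + Pi.single h (y - total b) with hb'
    have htb : total b' = y := by simp [b', total_add, total_single]
    set u := total (z + a) with hu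
    set s : p.Shares := w + Pi.single h (total r * y - total w) with hs
    -- The correction that makes the triple valid and the one that gives the output the total `total
    -- r * y` are the same up to sign.
    have hc : (fun i => u * b' i) - w + Pi.single h (total (a + (z - r)) * total b' -
        total ((fun i => u * b' i) - w)) = (fun i => u * b' i) - s := by
      have : total (a + (z - r)) = u - total r := by
        rw [hu, ← total_sub]; congr 1; abel
      rw [this, total_sub, total_mul, htb, hs, sub_add_eq_sub_sub, sub_eq_add_neg _ (Pi.single _ _),
        ← Pi.single_neg]
      congr 2
      ring
    rw [hc]
    refine ⟨?_, fun i hi => ?_⟩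
    · funext i k
      simp only [transOut, ez, ← hu, Pi.sub_apply, Pi.mul_apply]
      ring
    · have hih : i ≠ h := fun e => hA (e ▸ hi)
      have e3 : (a + (z - r)) i = a i := by simp [hr i hi]
      have e4 : b' i = b i := by simp [b', Pi.single_eq_of_ne hih]
      have e5 : ((fun i => u * b' i) - s) i = fun k => u k * b i k - s i k := by
        funext k; simp [e4]
      simp only [transView, tripleView, simTriple, ez, e3, e4, e5, ← hu]

end
end ZeroSharing

/-! ### Independent triples, and sampling the outputs first -/

namespace ZeroSharing
noncomputable section
open PMF (uniformOfFintype uniformOfFinset)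

variable {p : Params}

/-- The evaluation of a formula with real literals and independent uniform triples. -/
def looseEval (inp : Input p) (Q : SetFormula p.toShape.Other) : PMF (Transcript p) :=
  evalFormula (looseTriples p) (fun j _ => realMem inp j) (fun j _ => realNotMem inp j) Q []

theorem realMem_value {inp : Input p} {j : p.toShape.Other} {x : Transcript p}
    (hx : x ∈ (realMem inp j).support) : total x.1 = x.2.2 := by
  simp only [realMem, PMF.mem_support_bind_iff, PMF.mem_support_map_iff] at hx
  obtain ⟨r, -, o, -, rfl⟩ := hx
  exact total_twoPartyShares _ _ _

theorem realNotMem_value {inp : Input p} {j : p.toShape.Other} {x : Transcript p}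
    (hx : x ∈ (realNotMem inp j).support) : total x.1 = x.2.2 := by
  simp only [realNotMem, PMF.mem_support_bind_iff, PMF.mem_support_map_iff] at hx
  obtain ⟨r, -, o, -, rfl⟩ := hx
  exact total_twoPartyShares _ _ _

/-- Agreement of the corrupted shares is carried along so that `couple_mul` applies at the next `∨`.
With independent triples the shares no longer add up to a meaningful value, so the true total is
tracked by the value component, which does not depend on the triples. -/
theorem couple_looseEval (inp : Input p) {A : Finset (Fin p.m)} {h : Fin p.m} (hA : h ∉ A)
    (Q : SetFormula p.toShape.Other) :
    Couple (realEval inp Q) (looseEval inp Q) fun x y =>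
      ((∀ i ∈ A, x.1 i = y.1 i) ∧ ∀ i ∈ A, x.2.1 i = y.2.1 i) ∧ total x.1 = y.2.2 := by
  unfold realEval looseEval
  induction Q with
  | mem j => exact Couple.refl_of fun x hx => ⟨⟨fun _ _ => rfl, fun _ _ => rfl⟩, realMem_value hx⟩
  | notMem j =>
    exact Couple.refl_of fun x hx => ⟨⟨fun _ _ => rfl, fun _ _ => rfl⟩, realNotMem_value hx⟩
  | and B C hB hC =>
    simp only [evalFormula, List.take_nil, List.drop_nil]
    refine hB.bind fun x y hxy => hC.map fun x' y' hxy' => ⟨⟨fun i hi => ?_, fun i hi => ?_⟩, ?_⟩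
    · simp [hxy.1.1 i hi, hxy'.1.1 i hi]
    · simp [hxy.1.2 i hi, hxy'.1.2 i hi]
    · rw [total_add, hxy.2, hxy'.2]
  | or B C hB hC =>
    simp only [evalFormula, List.take_nil, List.drop_nil]
    refine hB.bind fun x y hxy => hC.bind fun x' y' hxy' =>
      (couple_mul hA hxy.1.1 hxy'.1.1).map fun t t' ht => ⟨⟨fun i hi => ?_, fun i hi => ?_⟩, ?_⟩
    · exact (ht.1 i hi).1
    · simp only [hxy.1.2 i hi, hxy'.1.2 i hi, (ht.1 i hi).2]
    · rw [ht.2, hxy.2, hxy'.2]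

/-- The outputs are sampled first, and the views in the final transformation are computed from
them. -/
def outputFirst (inp : Input p) (Z : (Fin p.n → p.F) → PMF p.Shares) : PMF (p.Shares × Views p) :=
  (looseEval inp p.Q).bind fun y => ((Z y.2.2).bind fun s =>
    (uniformOfFintype (p.Shares × p.Shares)).map fun ab => (s, ab)).map fun o =>
      (o.1, fun i => inp.words i ++ (y.2.1 i ++ transView (simTriple y.1 o.1 o.2) y.1 i))

/-- The outputs of all parties agree, but the views only for the parties in `A`: the honest views on
the right are by-products of the simulation. -/
theorem couple_protocol (inp : Input p) {A : Finset (Fin p.m)} {h : Fin p.m} (hA : h ∉ A) :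
    Couple (protocol inp) (outputFirst inp zeroShares) fun x y =>
      x.1 = y.1 ∧ ∀ i ∈ A, x.2 i = y.2 i := by
  rw [protocol_eq, outputFirst]
  refine (couple_looseEval inp hA p.Q).bind fun x y hxy => ?_
  rw [← hxy.2]
  refine (couple_trans hA hxy.1.1).map fun t o ho => ⟨ho.1, fun i hi => ?_⟩
  simp only [hxy.1.2 i hi, ho.2 i hi]

/-! ### The values of formulas -/

/-- The value of a programmable PRF at a point. -/
def pprfValue (p : Params) (S : Finset (p.Elt × p.F)) (x : p.Elt) : PMF p.F :=
  (uniformOfFintype p.Key).bind fun k => (p.pprf.hint k S).map fun h => p.pprf.eval k h x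

/-- Keys and hints are sampled independently for each instance, so the received values are
independent too. -/
theorem bOPPRF_values (S : Fin p.n → Finset (p.Elt × p.F)) (x : Fin p.n → p.Elt) :
    (bOPPRF p S x).map (fun o => o.2.2) = piPMF fun k => pprfValue p (S k) (x k) := by
  have : bOPPRF p S x = (uniformOfFintype (Fin p.n → p.Key)).bind fun key =>
    (piPMF fun k => p.pprf.hint (key k) (S k)).map fun h =>
      (key, h, fun k => p.pprf.eval (key k) (h k) (x k)) := rfl
  rw [this, PMF.map_bind]
  simp only [PMF.map_comp, Function.comp_def, pprfValue]
  rw [← piPMF_bind, piPMF_uniform]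
  refine congrArg _ (funext fun key => ?_)
  exact piPMF_map (fun k => p.pprf.hint (key k) (S k)) fun k h => p.pprf.eval (key k) h (x k)

theorem toOuterMeasure_bind_le {α β : Type} (μ : PMF α) (f : α → PMF β) (S : Set β) {C : ENNReal}
    (h : ∀ a ∈ μ.support, (f a).toOuterMeasure S ≤ C) : (μ.bind f).toOuterMeasure S ≤ C := by
  rw [PMF.toOuterMeasure_bind_apply]
  calc ∑' a, μ a * (f a).toOuterMeasure S ≤ ∑' a, μ a * C := by
        refine ENNReal.tsum_le_tsum fun a => ?_
        by_cases ha : a ∈ μ.support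
        · gcongr; exact h a ha
        · simp [(μ.apply_eq_zero_iff a).2 ha]
    _ = C := by rw [ENNReal.tsum_mul_right, PMF.tsum_coe, one_mul]

theorem toOuterMeasure_bind_le_add {α β : Type} (μ : PMF α) (f : α → PMF β) (S : Set β) (T : Set α)
    {C : ENNReal} (h : ∀ a ∉ T, (f a).toOuterMeasure S ≤ C) :
    (μ.bind f).toOuterMeasure S ≤ μ.toOuterMeasure T + C := by
  classical
  have hone : ∀ X : PMF β, X.toOuterMeasure S ≤ 1 := fun X => by
    rw [PMF.toOuterMeasure_apply, ← X.tsum_coe]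
    exact ENNReal.tsum_le_tsum fun b => Set.indicator_le_self' (by simp) b
  rw [PMF.toOuterMeasure_bind_apply, PMF.toOuterMeasure_apply]
  calc ∑' a, μ a * (f a).toOuterMeasure S ≤ ∑' a, (T.indicator μ a + μ a * C) := by
        refine ENNReal.tsum_le_tsum fun a => ?_
        by_cases ha : a ∈ T
        · rw [Set.indicator_of_mem ha]
          exact (mul_le_of_le_one_right' (hone _)).trans le_self_add
        · rw [Set.indicator_of_notMem ha, zero_add]
          gcongr; exact h a ha
    _ = _ := by rw [ENNReal.tsum_add, ENNReal.tsum_mul_right, PMF.tsum_coe, one_mul]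

/-- For fixed `r` the value is `c` exactly when the received PPRF value is `c - r k`, and one
instance of the batch is distributed as `pprfValue`. -/
theorem realMem_value_le (inp : Input p) (j : p.toShape.Other) (k : Fin p.n) {δ : ENNReal}
    (hδ : ∀ r c, pprfValue p (inp.X j k ×ˢ {-r}) (inp.x k) c ≤ δ) (c : p.F) :
    (realMem inp j).toOuterMeasure {x | x.2.2 k = c} ≤ δ := by
  refine toOuterMeasure_bind_le _ _ _ fun r _ => ?_
  have := congrArg (fun μ => μ.map fun f => f k)
    (bOPPRF_values (fun k => inp.X j k ×ˢ {-r k}) inp.x)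
  rw [piPMF_marginal, PMF.map_comp] at this
  refine le_of_eq_of_le ?_ (hδ (r k) (c - r k))
  rw [← this, ← PMF.toOuterMeasure_apply_singleton, PMF.toOuterMeasure_map_apply,
    PMF.toOuterMeasure_map_apply]
  congr 1
  ext o
  simp [eq_sub_iff_add_eq]

open Classical in
theorem mem_support_bssPMT {X : Fin p.n → Finset p.Elt} {x : Fin p.n → p.Elt}
    {e : (Fin p.n → Bool) × (Fin p.n → Bool)} :
    e ∈ (bssPMT p X x).support ↔ ∀ k, xor (e.1 k) (e.2 k) = decide (x k ∈ X k) := by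
  refine (PMF.mem_support_uniformOfFinset_iff _ _).trans ?_
  rw [Finset.mem_filter]
  refine ⟨fun h k => (h.2 k).trans ?_, fun h => ⟨Finset.mem_univ _, fun k => (h k).trans ?_⟩⟩ <;>
  congr

/-- Membership forces the two bits to differ, so the value is the difference of the two independent
OT messages and exactly uniform. -/
theorem realNotMem_value_le (inp : Input p) (j : p.toShape.Other) (k : Fin p.n)
    (hk : inp.x k ∈ inp.X j k) (c : p.F) :
    (realNotMem inp j).toOuterMeasure {x | x.2.2 k = c} ≤ (Fintype.card p.F : ENNReal)⁻¹ := by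
  classical
  refine toOuterMeasure_bind_le _ _ _ fun e he => ?_
  have hek := mem_support_bssPMT.1 he k
  simp only [hk, decide_true] at hek
  let f : (Bool → Fin p.n → p.F) →+ p.F :=
    { toFun := fun r => r (e.2 k) k - r (e.1 k) k
      map_zero' := by simp
      map_add' := by intro r s; simp only [Pi.add_apply]; abel }
  have hf : (uniformOfFintype (Bool → Fin p.n → p.F)).map f = uniformOfFintype p.F := by
    refine uniformOfFintype_map_hom f _ (fun _ => Finset.mem_univ _) fun c _ => ?_
    -- The message chosen by the receiver is set to `c` and the other one to `0`.
    refine ⟨fun b _ => if b = e.2 k then c else 0, ?_⟩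
    have : e.1 k ≠ e.2 k := by rintro h; rw [h] at hek; simp at hek
    simp [f, this]
  rw [← PMF.uniformOfFintype_apply c, ← hf, ← PMF.toOuterMeasure_apply_singleton, bROT,
    PMF.map_comp, PMF.toOuterMeasure_map_apply, PMF.toOuterMeasure_map_apply]
  refine le_of_eq (congrArg _ ?_)
  ext r
  simp [f, sub_eq_add_neg]

/-- Distinct literals use independent randomness, so subformulas have independent values. The bound
has to be proved for every point `c`, not just `0`: at `∧` the target for one summand is shifted by
the other, and at `∨` it is divided by the other factor. -/
theorem evalFormula_value_le (inp : Input p) (tri : PMF (Triples p)) (k : Fin p.n) {δ : ENNReal}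
    (hδ : ∀ j, inp.x k ∉ inp.X j k → ∀ r c, pprfValue p (inp.X j k ×ˢ {-r}) (inp.x k) c ≤ δ)
    (hq : (Fintype.card p.F : ENNReal)⁻¹ ≤ δ) (Q : SetFormula p.toShape.Other) (U : List p.F)
    (hQ : ¬Q.Holds (inp.x k) fun j => inp.X j k) (c : p.F) :
    (evalFormula tri (fun j _ => realMem inp j) (fun j _ => realNotMem inp j) Q U).toOuterMeasure
      {x | x.2.2 k = c} ≤ (Q.orCount + 1 : ℕ) * δ := by
  induction Q generalizing U c with
  | mem j =>
    simp only [evalFormula, SetFormula.orCount, zero_add, Nat.cast_one, one_mul]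
    exact realMem_value_le inp j k (hδ j hQ) c
  | notMem j =>
    simp only [evalFormula, SetFormula.orCount, zero_add, Nat.cast_one, one_mul]
    exact (realNotMem_value_le inp j k (by simpa [SetFormula.Holds] using hQ) c).trans hq
  | and B C hB hC =>
    simp only [evalFormula]
    simp only [SetFormula.Holds, not_and_or] at hQ
    rcases hQ with hQ | hQ
    · simp only [PMF.map]
      -- The value of the second conjunct is fixed first, so that the false first conjunct has to
      -- hit one given point.
      rw [PMF.bind_comm]
      refine toOuterMeasure_bind_le _ _ _ fun y _ => ?_
      refine le_trans ?_ ((hB (U.take (B.literals * p.n)) hQ (c - y.2.2 k)).trans ?_)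
      · refine le_of_eq ?_
        refine (PMF.toOuterMeasure_map_apply _ _ _).trans (congrArg _ ?_)
        ext x; simp [eq_sub_iff_add_eq]
      · gcongr; simp [SetFormula.orCount]
    · refine toOuterMeasure_bind_le _ _ _ fun x _ => ?_
      refine le_trans ?_ ((hC (U.drop (B.literals * p.n)) hQ (c - x.2.2 k)).trans ?_)
      · refine le_of_eq ?_
        refine (PMF.toOuterMeasure_map_apply _ _ _).trans (congrArg _ ?_)
        ext y; simp [eq_sub_iff_add_eq, add_comm]
      · gcongr; simp [SetFormula.orCount]
  | or B C hB hC =>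
    simp only [evalFormula]
    simp only [SetFormula.Holds, not_or] at hQ
    have h1 := hB (U.take (B.literals * p.n)) hQ.1 0
    -- The exceptional event is that the first factor vanishes. Otherwise the second factor must
    -- equal `c / x.2.2 k`.
    refine (toOuterMeasure_bind_le_add _ _ _ {x | x.2.2 k = 0}
      (C := (C.orCount + 1 : ℕ) * δ) fun x hx => ?_).trans
      ((add_le_add_left h1 _).trans (le_of_eq ?_))
    · have hx' : x.2.2 k ≠ 0 := hx
      refine le_trans ?_ (hC (U.drop (B.literals * p.n)) hQ.2 (c / x.2.2 k))
      refine (le_of_eq ?_ : _ ≤ ((evalFormula tri (fun j _ => realMem inp j)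
        (fun j _ => realNotMem inp j) C (U.drop (B.literals * p.n))).map fun y =>
        x.2.2 k * y.2.2 k).toOuterMeasure {c}).trans (le_of_eq ?_)
      · rw [show {z : Transcript p | z.2.2 k = c} = (fun z : Transcript p => z.2.2 k) ⁻¹' {c} from rfl,
          ← PMF.toOuterMeasure_map_apply, PMF.map_bind]
        simp only [PMF.map_comp, Function.comp_def]
        exact congrArg (fun μ => PMF.toOuterMeasure μ {c})
          (congrArg (PMF.bind _) (funext fun y => PMF.map_const _ _))
      · rw [PMF.toOuterMeasure_map_apply]
        congr 1
        ext y
        simp [eq_div_iff hx', mul_comm]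
    · rw [← add_mul]
      simp only [SetFormula.orCount]
      push_cast
      ring

/-- At a programmed point the received `-r` cancels the sender's `r`; for a true negative literal
the bits coincide and the same OT message occurs with both signs. Sums of zeros and products with a
zero factor vanish. -/
theorem evalFormula_value_eq_zero (inp : Input p) (tri : PMF (Triples p)) (k : Fin p.n)
    (Q : SetFormula p.toShape.Other) (U : List p.F)
    (hQ : Q.Holds (inp.x k) fun j => inp.X j k) {x : Transcript p}
    (hx : x ∈ (evalFormula tri (fun j _ => realMem inp j)
      (fun j _ => realNotMem inp j) Q U).support) : x.2.2 k = 0 := by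
  classical
  induction Q generalizing U x with
  | mem j =>
    simp only [evalFormula, realMem, PMF.mem_support_bind_iff, PMF.mem_support_map_iff] at hx
    obtain ⟨r, -, o, ho, rfl⟩ := hx
    have : bOPPRF p (fun k => inp.X j k ×ˢ {-r k}) inp.x =
      (uniformOfFintype (Fin p.n → p.Key)).bind fun key =>
        (piPMF fun k => p.pprf.hint (key k) (inp.X j k ×ˢ {-r k})).map fun h =>
          (key, h, fun k => p.pprf.eval (key k) (h k) (inp.x k)) := rfl
    rw [this] at ho
    simp only [PMF.mem_support_bind_iff, PMF.mem_support_map_iff] at ho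
    obtain ⟨key, -, h, hh, rfl⟩ := ho
    have := p.pprf.programmed (key k) _ (h k) (inp.x k) (-r k) ?_ (mem_support_piPMF hh k) ?_
    · simp [this]
    · intro a b b' hb hb'
      simp only [Finset.mem_product, Finset.mem_singleton] at hb hb'
      rw [hb.2, hb'.2]
    · have hQ' : inp.x k ∈ inp.X j k := hQ
      simpa using hQ'
  | notMem j =>
    simp only [evalFormula, realNotMem, bROT, PMF.mem_support_bind_iff,
      PMF.mem_support_map_iff] at hx
    obtain ⟨e, he, o, ⟨r, -, rfl⟩, rfl⟩ := hx
    have hek := mem_support_bssPMT.1 he k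
    have hQ' : inp.x k ∉ inp.X j k := hQ
    have : e.1 k = e.2 k := by simpa [hQ'] using hek
    simp [this]
  | and B C hB hC =>
    simp only [evalFormula, PMF.mem_support_bind_iff, PMF.mem_support_map_iff] at hx
    obtain ⟨y, hy, z, hz, rfl⟩ := hx
    simp [hB _ hQ.1 hy, hC _ hQ.2 hz]
  | or B C hB hC =>
    simp only [evalFormula, PMF.mem_support_bind_iff, PMF.mem_support_map_iff] at hx
    obtain ⟨y, hy, z, hz, t, -, rfl⟩ := hx
    rcases hQ with hQ | hQ
    · simp [hB _ hQ hy]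
    · simp [hC _ hQ hz]

theorem zeroShares_eq_bMZS (inp : Input p) (V : Fin p.n → p.F) (h : ∀ k, V k = 0 ↔ inp.Holds k) :
    zeroShares V = bMZS inp := by
  classical
  have : ∀ {S T : Finset p.Shares} (hS : S.Nonempty) (hT : T.Nonempty), S = T →
      uniformOfFinset S hS = uniformOfFinset T hT := by
    rintro S T hS hT rfl; rfl
  refine this _ _ ?_
  ext s
  simp [h]

/-- The values of a false formula vanish with small probability. -/
theorem statDist_outputFirst_le {β : Type} (inp : Input p) {δ : ENNReal}
    (hδ : ∀ j k, inp.x k ∉ inp.X j k → ∀ r c, pprfValue p (inp.X j k ×ˢ {-r}) (inp.x k) c ≤ δ)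
    (hq : (Fintype.card p.F : ENNReal)⁻¹ ≤ δ) (hfin : δ ≠ ⊤) (f : p.Shares × Views p → PMF β) :
    statDist ((outputFirst inp zeroShares).bind f)
      ((outputFirst inp fun _ => bMZS inp).bind f) ≤ p.n * ((p.Q.orCount + 1 : ℕ) * δ.toReal) := by
  unfold outputFirst
  rw [PMF.bind_bind, PMF.bind_bind]
  -- The bad event is that a false instance has value `0`. Off it, the zeros of the value are
  -- exactly the true instances, so `zeroShares` is the ideal functionality.
  let B : Set (Transcript p) := ⋃ k, {x | ¬inp.Holds k ∧ x.2.2 k = 0}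
  refine (statDist_bind_le _ _ _ B fun y hy hB => ?_).trans ?_
  · rw [zeroShares_eq_bMZS]
    intro k
    simp only [B, Set.mem_iUnion, Set.mem_ofPred_eq, not_exists, not_and] at hB
    exact ⟨fun h => by_contra fun h' => hB k h' h,
      fun h => evalFormula_value_eq_zero inp _ k p.Q _ h hy⟩
  · have : (looseEval inp p.Q).toOuterMeasure B ≤ p.n * ((p.Q.orCount + 1 : ℕ) * δ) := by
      refine (MeasureTheory.measure_iUnion_le _).trans ?_
      rw [tsum_fintype]
      refine (Finset.sum_le_card_nsmul _ _ ((p.Q.orCount + 1 : ℕ) * δ) fun k _ => ?_).trans ?_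
      · by_cases hk : inp.Holds k
        · simp [hk]
        · simp only [hk, not_false_eq_true, true_and]
          exact evalFormula_value_le inp _ k (fun j => hδ j k) hq p.Q [] hk 0
      · simp
    refine (ENNReal.toReal_mono (by finiteness) this).trans (le_of_eq ?_)
    rw [ENNReal.toReal_mul, ENNReal.toReal_mul, ENNReal.toReal_natCast, ENNReal.toReal_natCast]

theorem outputFirst_map_fst (inp : Input p) (μ : PMF p.Shares) :
    (outputFirst inp fun _ => μ).map Prod.fst = μ := by
  unfold outputFirst
  simp only [PMF.map_bind, PMF.map_comp, Function.comp_def]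
  rw [PMF.bind_const]
  conv_rhs => rw [← PMF.bind_pure μ]
  refine congrArg _ (funext fun s => ?_)
  exact PMF.map_const _ _

theorem statDist_protocolOutput_le (inp : Input p) {δ : ENNReal}
    (hδ : ∀ j k, inp.x k ∉ inp.X j k → ∀ r c, pprfValue p (inp.X j k ×ˢ {-r}) (inp.x k) c ≤ δ)
    (hq : (Fintype.card p.F : ENNReal)⁻¹ ≤ δ) (hfin : δ ≠ ⊤) :
    statDist (protocolOutput inp) (bMZS inp) ≤ p.n * ((p.Q.orCount + 1 : ℕ) * δ.toReal) := by
  -- Correctness is the case of no corruptions: any party can serve as the honest one, and the pivot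
  -- is one that certainly exists.
  have h1 : protocolOutput inp = (outputFirst inp zeroShares).map Prod.fst :=
    (couple_protocol inp (A := ∅) (Finset.notMem_empty p.pivot)).map_eq fun _ _ h => h.1
  have h2 := statDist_outputFirst_le inp hδ hq hfin fun x => PMF.pure x.1
  have h3 := outputFirst_map_fst inp (bMZS inp)
  rw [h1]
  conv_lhs => rw [← h3]
  exact h2

end
end ZeroSharing

namespace ZeroSharing
noncomputable section
open PMF (uniformOfFintype uniformOfFinset)

/-! ### Building circuits -/

theorem runCode_cons (p : Params) (i : Instr) (is : List Instr) (mem : List Word) :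
    runCode p (i :: is) mem = (i.step p mem).bind fun w => runCode p is (mem ++ [w]) := rfl

theorem runCode_append (p : Params) (c₁ c₂ : List Instr) (mem : List Word) :
    runCode p (c₁ ++ c₂) mem = (runCode p c₁ mem).bind (runCode p c₂) := by
  induction c₁ generalizing mem with
  | nil => exact (PMF.pure_bind _ _).symm
  | cons i is ih =>
    rw [List.cons_append, runCode_cons, runCode_cons, PMF.bind_bind]
    simp only [ih]

/-- A computation that emits instructions, given the number of registers in use. -/
def Builder (α : Type) : Type := ℕ → List Instr × α

namespace Builder

variable {α β γ : Type}

protected def pure (a : α) : Builder α := fun _ => ([], a)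

protected def bind (b : Builder α) (f : α → Builder β) : Builder β := fun n =>
  ((b n).1 ++ (f (b n).2 (n + (b n).1.length)).1, (f (b n).2 (n + (b n).1.length)).2)

instance : Monad Builder where
  pure := Builder.pure
  bind := Builder.bind

/-- Emit an instruction, and return its register. -/
def emit (i : Instr) : Builder ℕ := fun n => ([i], n)

/-- Build circuits one after the other. -/
def pi : {n : ℕ} → (Fin n → Builder α) → Builder (Fin n → α)
  | 0, _ => pure Fin.elim0
  | _ + 1, f => do
    let a ← f 0
    let t ← pi fun i => f i.succ
    pure (Fin.cons a t)

end Builder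

open Builder

/-- A register contains a word. -/
def Reads (mem : List Word) (r : ℕ) (w : Word) : Prop := mem[r]? = some w

theorem Reads.mono {mem mem' : List Word} (h : mem <+: mem') {r : ℕ} {w : Word}
    (hr : Reads mem r w) : Reads mem' r w := by
  obtain ⟨t, rfl⟩ := h
  unfold Reads at *
  rw [List.getElem?_append_left, hr]
  exact (List.getElem?_eq_some_iff.1 hr).1

theorem Reads.reg {mem : List Word} {r : ℕ} {w : Word} (h : Reads mem r w) : reg mem r = w := by
  unfold Reads at h
  simp [ZeroSharing.reg, List.getD, h]

/-- Registers contain a list of words. -/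
def ReadsList (mem : List Word) (rs : List ℕ) (ws : List Word) : Prop :=
  List.Forall₂ (Reads mem) rs ws

theorem ReadsList.mono {mem mem' : List Word} (h : mem <+: mem') {rs : List ℕ} {ws : List Word}
    (hr : ReadsList mem rs ws) : ReadsList mem' rs ws :=
  List.Forall₂.imp (fun _ _ => Reads.mono h) hr

theorem ReadsList.map_reg {mem : List Word} {rs : List ℕ} {ws : List Word}
    (h : ReadsList mem rs ws) : rs.map (reg mem) = ws := by
  induction h with
  | nil => rfl
  | cons h _ ih => rw [List.map_cons, h.reg, ih]

theorem ReadsList.ofFn {mem : List Word} {n : ℕ} {f : Fin n → ℕ} {g : Fin n → Word}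
    (h : ∀ k, Reads mem (f k) (g k)) : ReadsList mem (List.ofFn f) (List.ofFn g) := by
  rw [ReadsList, List.forall₂_iff_get]
  refine ⟨by simp, fun i h1 h2 => ?_⟩
  simpa using h _

theorem ReadsList.append {mem : List Word} {rs rs' : List ℕ} {ws ws' : List Word}
    (h : ReadsList mem rs ws) (h' : ReadsList mem rs' ws') :
    ReadsList mem (rs ++ rs') (ws ++ ws') := List.rel_append h h'

theorem ReadsList.ite {mem : List Word} {c : Prop} [Decidable c] {rs rs' : List ℕ}
    {ws ws' : List Word} (h : c → ReadsList mem rs ws) (h' : ¬c → ReadsList mem rs' ws') :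
    ReadsList mem (if c then rs else rs') (if c then ws else ws') := by
  split_ifs with hc
  · exact h hc
  · exact h' hc

theorem ReadsList.flatMap {mem : List Word} {ι : Type} (l : List ι) {f : ι → List ℕ}
    {g : ι → List Word} (h : ∀ i ∈ l, ReadsList mem (f i) (g i)) :
    ReadsList mem (l.flatMap f) (l.flatMap g) := by
  induction l with
  | nil => exact List.Forall₂.nil
  | cons i l ih =>
    simp only [List.flatMap_cons]
    exact (h i (by simp)).append (ih fun i hi => h i (by simp [hi]))

/-- The code that is emitted samples from a distribution, in the sense that the results are related
to the memory. -/
def Impl (p : Params) {α β : Type} (b : Builder α) (mem : List Word) (D : PMF β)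
    (R : α → β → List Word → Prop) : Prop :=
  Couple (runCode p (b mem.length).1 mem) D fun mem' x =>
    mem <+: mem' ∧ mem'.length = mem.length + (b mem.length).1.length ∧ R (b mem.length).2 x mem'

namespace Impl

variable {p : Params} {α β α' β' : Type}

protected theorem pure {mem : List Word} {R : α → β → List Word → Prop} {a : α} {x : β}
    (h : R a x mem) : Impl p (Pure.pure a : Builder α) mem (PMF.pure x) R :=
  Couple.pure ⟨List.prefix_refl _, rfl, h⟩

/-- A builder chooses register numbers from the current memory length, so composition requires the
memory to have grown by exactly the number of emitted instructions. That is why `Impl` records the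
length. -/
protected theorem bind {b : Builder α} {mem : List Word} {D : PMF β}
    {R : α → β → List Word → Prop} {f : α → Builder α'} {g : β → PMF β'}
    {R' : α' → β' → List Word → Prop} (h : Impl p b mem D R)
    (h' : ∀ a x mem', mem <+: mem' → R a x mem' → Impl p (f a) mem' (g x) R') :
    Impl p (b >>= f) mem (D.bind g) R' := by
  have key : ∀ n, (b >>= f) n = ((b n).1 ++ (f (b n).2 (n + (b n).1.length)).1,
    (f (b n).2 (n + (b n).1.length)).2) := fun _ => rfl
  unfold Impl
  rw [key]
  simp only
  rw [runCode_append]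
  refine Couple.bind h fun mem' x hx => ?_
  have h2 := h' _ x mem' hx.1 hx.2.2
  unfold Impl at h2
  rw [hx.2.1] at h2
  refine h2.mono fun mem'' y hy => ⟨hx.1.trans hy.1, ?_, hy.2.2⟩
  rw [hy.2.1, List.length_append, add_assoc]

theorem bind_map {b : Builder α} {mem : List Word} {D : PMF β}
    {R : α → β → List Word → Prop} {f : α → α'} {g : β → β'}
    {R' : α' → β' → List Word → Prop} (h : Impl p b mem D R)
    (h' : ∀ a x mem', mem <+: mem' → R a x mem' → R' (f a) (g x) mem') :
    Impl p (b >>= fun a => Pure.pure (f a)) mem (D.map g) R' :=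
  h.bind fun a x mem' h1 h2 => Impl.pure (h' a x mem' h1 h2)

/-- A deterministic step leaves no trace in the target distribution. The support of the coupling
identifies the computed value as `x`, so the continuation need only be treated for this value. -/
theorem pure_bind {b : Builder α} {mem : List Word} {x : β}
    {R : α → β → List Word → Prop} {f : α → Builder α'} {D : PMF β'}
    {R' : α' → β' → List Word → Prop} (h : Impl p b mem (PMF.pure x) R)
    (h' : ∀ a mem', mem <+: mem' → R a x mem' → Impl p (f a) mem' D R') :
    Impl p (b >>= f) mem D R' := by
  have h2 : Impl p b mem (PMF.pure x) fun a y mem => y = x ∧ R a y mem :=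
    Couple.mono (Couple.with_support h) fun m y hy =>
      ⟨hy.1.1, hy.1.2.1, by simpa using hy.2.2, hy.1.2.2⟩
  have h3 : Impl p (b >>= f) mem ((PMF.pure x).bind fun _ => D) R' := by
    refine h2.bind ?_
    rintro a y mem' h1 ⟨rfl, h5⟩
    exact h' a mem' h1 h5
  rwa [PMF.pure_bind] at h3

theorem emit {i : Instr} {mem : List Word} {D : PMF β} {f : β → Word}
    (h : i.step p mem = D.map f) :
    Impl p (Builder.emit i) mem D fun r x mem' => Reads mem' r (f x) := by
  have hr : runCode p [i] mem = D.map fun x => mem ++ [f x] := by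
    rw [runCode_cons, h, PMF.bind_map]
    rfl
  refine Couple.of_map D (fun x => mem ++ [f x]) id hr (PMF.map_id D).symm fun x _ => ?_
  refine ⟨List.prefix_append _ _, by simp [Builder.emit], ?_⟩
  simp [Reads, Builder.emit]

theorem emit_pure {i : Instr} {mem : List Word} {x : β} {f : β → Word}
    (h : i.step p mem = PMF.pure (f x)) :
    Impl p (Builder.emit i) mem (PMF.pure x) fun r x mem' => Reads mem' r (f x) :=
  emit (by rw [h, PMF.pure_map])

/-- The relations must survive an extension of the memory, because the later components append
registers after the earlier ones are done. -/
theorem pi : ∀ {n : ℕ} {f : Fin n → Builder α} {mem : List Word} {D : Fin n → PMF β}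
    {R : Fin n → α → β → List Word → Prop},
    (∀ k a x mem mem', mem <+: mem' → R k a x mem → R k a x mem') →
    (∀ k mem', mem <+: mem' → Impl p (f k) mem' (D k) (R k)) →
    Impl p (Builder.pi f) mem (piPMF D) fun a x mem' => ∀ k, R k (a k) (x k) mem'
  | 0, f, mem, D, R, _, _ => Impl.pure fun k => k.elim0
  | n + 1, f, mem, D, R, hR, h => by
    refine Impl.bind (h 0 mem (List.prefix_refl _)) fun a x mem' h1 h2 => ?_
    refine Impl.bind_map (Impl.pi (fun k => hR k.succ) fun k mem'' h3 =>
      h k.succ mem'' (h1.trans h3)) fun t y mem'' h3 h4 k => ?_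
    refine Fin.cases ?_ (fun k => ?_) k
    · simpa using hR 0 a x mem' mem'' h3 h2
    · simpa using h4 k

theorem pi_pure {n : ℕ} {f : Fin n → Builder α} {mem : List Word} {x : Fin n → β}
    {R : Fin n → α → β → List Word → Prop}
    (hR : ∀ k a x mem mem', mem <+: mem' → R k a x mem → R k a x mem')
    (h : ∀ k mem', mem <+: mem' → Impl p (f k) mem' (PMF.pure (x k)) (R k)) :
    Impl p (Builder.pi f) mem (PMF.pure x) fun a x mem' => ∀ k, R k (a k) (x k) mem' := by
  rw [← piPMF_pure]
  exact pi hR h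

end Impl

/-! ### The size of circuits -/

/-- A bound on the cost of the emitted code, and a property of the results. -/
def Costs {α : Type} (b : Builder α) (c : ℕ) (Post : α → Prop) : Prop :=
  ∀ n, ((b n).1.map Instr.cost).sum ≤ c ∧ Post (b n).2

namespace Costs

variable {α β : Type}

protected theorem pure {a : α} {Post : α → Prop} (h : Post a) : Costs (Pure.pure a : Builder α) 0 Post :=
  fun _ => ⟨le_rfl, h⟩

protected theorem mono {b : Builder α} {c c' : ℕ} {Post Post' : α → Prop} (h : Costs b c Post)
    (hc : c ≤ c') (hP : ∀ a, Post a → Post' a) : Costs b c' Post' :=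
  fun n => ⟨(h n).1.trans hc, hP _ (h n).2⟩

protected theorem bind {b : Builder α} {f : α → Builder β} {c c' : ℕ} {Post : α → Prop}
    {Post' : β → Prop} (h : Costs b c Post) (h' : ∀ a, Post a → Costs (f a) c' Post') :
    Costs (b >>= f) (c + c') Post' := by
  intro n
  have key : (b >>= f) n = ((b n).1 ++ (f (b n).2 (n + (b n).1.length)).1,
    (f (b n).2 (n + (b n).1.length)).2) := rfl
  rw [key]
  obtain ⟨h1, h2⟩ := h n
  obtain ⟨h3, h4⟩ := h' _ h2 (n + (b n).1.length)
  refine ⟨?_, h4⟩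
  simp only [List.map_append, List.sum_append]
  omega

theorem bind_pure {b : Builder α} {f : α → β} {c : ℕ} {Post : α → Prop}
    {Post' : β → Prop} (h : Costs b c Post) (h' : ∀ a, Post a → Post' (f a)) :
    Costs (b >>= fun a => Pure.pure (f a)) c Post' :=
  h.bind fun a ha => Costs.pure (h' a ha)

theorem emit (i : Instr) {c : ℕ} (h : i.cost = c := by rfl) :
    Costs (Builder.emit i) c fun _ => True :=
  fun _ => ⟨by simp [Builder.emit, h], trivial⟩

theorem pi_sum {Post : α → Prop} : ∀ {n : ℕ} {f : Fin n → Builder α} {c : Fin n → ℕ},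
    (∀ k, Costs (f k) (c k) Post) → Costs (Builder.pi f) (∑ k, c k) fun a => ∀ k, Post (a k)
  | 0, f, _, _ => (Costs.pure fun k => k.elim0).mono (by simp) fun _ h => h
  | n + 1, f, c, h => by
    refine Costs.mono (Costs.bind (h 0) fun a ha => (pi_sum fun k => h k.succ).bind_pure
      (Post' := fun a : Fin (n + 1) → α => ∀ k, Post (a k)) fun t ht k => ?_)
      (by rw [Fin.sum_univ_succ]) fun _ h => h
    refine Fin.cases ?_ (fun k => ?_) k
    · simpa using ha
    · simpa using ht k

theorem pi {Post : α → Prop} {c n : ℕ} {f : Fin n → Builder α}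
    (h : ∀ k, Costs (f k) c Post) : Costs (Builder.pi f) (n * c) fun a => ∀ k, Post (a k) :=
  (pi_sum h).mono (by simp) fun _ h => h

end Costs

end
end ZeroSharing

namespace ZeroSharing
noncomputable section
open PMF (uniformOfFintype uniformOfFinset)

open Builder

/-! ### Circuits for secret sharing -/

section Gates

variable {p : Params}

theorem ofBits_ofFn {k : ℕ} (x : Fin k → Bool) : ofBits k (List.ofFn x) = x := by
  funext i
  simp [ofBits, List.getD]

theorem decF_wordF (a : p.F) : p.decF (p.wordF a) = a := by
  rw [Params.decF, Params.wordF, ofBits_ofFn]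
  exact Function.leftInverse_invFun p.encF.injective a

theorem wordF_injective : Function.Injective p.wordF := fun a b h => by
  rw [← decF_wordF a, h, decF_wordF]

theorem impl_add {mem : List Word} {i j : ℕ} {a b : p.F} (hi : Reads mem i (p.wordF a))
    (hj : Reads mem j (p.wordF b)) :
    Impl p (emit (.add i j)) mem (PMF.pure (a + b)) fun r x mem' => Reads mem' r (p.wordF x) :=
  Impl.emit_pure (by simp only [Instr.step, hi.reg, hj.reg, decF_wordF]; rfl)

theorem impl_mul {mem : List Word} {i j : ℕ} {a b : p.F} (hi : Reads mem i (p.wordF a))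
    (hj : Reads mem j (p.wordF b)) :
    Impl p (emit (.mul i j)) mem (PMF.pure (a * b)) fun r x mem' => Reads mem' r (p.wordF x) :=
  Impl.emit_pure (by simp only [Instr.step, hi.reg, hj.reg, decF_wordF]; rfl)

theorem impl_neg {mem : List Word} {i : ℕ} {a : p.F} (hi : Reads mem i (p.wordF a)) :
    Impl p (emit (.neg i)) mem (PMF.pure (-a)) fun r x mem' => Reads mem' r (p.wordF x) :=
  Impl.emit_pure (by simp only [Instr.step, hi.reg, decF_wordF]; rfl)

theorem impl_rand {mem : List Word} :
    Impl p (emit .rand) mem (uniformOfFintype p.F) fun r x mem' => Reads mem' r (p.wordF x) :=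
  Impl.emit rfl

/-- The difference of two field elements. -/
def subB (i j : ℕ) : Builder ℕ := do
  let nj ← emit (.neg j)
  emit (.add i nj)

theorem impl_sub {mem : List Word} {i j : ℕ} {a b : p.F} (hi : Reads mem i (p.wordF a))
    (hj : Reads mem j (p.wordF b)) :
    Impl p (subB i j) mem (PMF.pure (a - b)) fun r x mem' => Reads mem' r (p.wordF x) := by
  refine (impl_neg hj).pure_bind fun r mem' h1 h2 => ?_
  rw [sub_eq_add_neg]
  exact impl_add (hi.mono h1) h2

theorem costs_sub (i j : ℕ) : Costs (subB i j) 2 fun _ => True :=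
  Costs.bind (c := 1) (c' := 1) (Costs.emit _) fun _ _ => Costs.emit _

/-- The zero of the field. -/
def zeroB : Builder ℕ := do
  let r ← emit .rand
  subB r r

/-- The simulator does not know the encoding of the field and cannot hard-wire any element, so zero
is obtained as `a - a` for a random `a`. -/
theorem impl_zero {mem : List Word} :
    Impl p zeroB mem (PMF.pure (0 : p.F)) fun r x mem' => Reads mem' r (p.wordF x) := by
  have h : Impl p zeroB mem ((uniformOfFintype p.F).bind fun a => PMF.pure (a - a))
      fun r x mem' => Reads mem' r (p.wordF x) :=
    impl_rand.bind fun r a mem' _ h2 => impl_sub h2 h2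
  simp only [sub_self, PMF.bind_const] at h
  exact h

theorem costs_zero : Costs zeroB 3 fun _ => True :=
  (Costs.emit _).bind fun _ _ => costs_sub _ _

/-- The sum of a list of field elements. -/
def sumB (zr : ℕ) : List ℕ → Builder ℕ
  | [] => pure zr
  | r :: rs => do
    let t ← sumB zr rs
    emit (.add r t)

theorem impl_sum {mem : List Word} {zr : ℕ} (h0 : Reads mem zr (p.wordF 0)) {rs : List ℕ}
    {xs : List p.F} (h : List.Forall₂ (fun r x => Reads mem r (p.wordF x)) rs xs) :
    Impl p (sumB zr rs) mem (PMF.pure xs.sum) fun r x mem' => Reads mem' r (p.wordF x) := by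
  induction h with
  | nil => exact Impl.pure h0
  | cons h _ ih => exact ih.pure_bind fun t mem' h1 h2 => impl_add (h.mono h1) h2

theorem costs_sum (zr : ℕ) (rs : List ℕ) : Costs (sumB zr rs) rs.length fun _ => True := by
  induction rs with
  | nil => exact Costs.pure trivial
  | cons r rs ih => exact ih.bind fun _ _ => Costs.emit _

/-- Registers contain a vector. -/
def ReadsVec (mem : List Word) (r : Fin p.n → ℕ) (x : Fin p.n → p.F) : Prop :=
  ∀ k, Reads mem (r k) (p.wordF (x k))

/-- Registers contain shares. -/
def ReadsShares (mem : List Word) (r : Fin p.m → Fin p.n → ℕ) (x : p.Shares) : Prop :=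
  ∀ i, ReadsVec mem (r i) (x i)

theorem ReadsVec.mono {mem mem' : List Word} (h : mem <+: mem') {r : Fin p.n → ℕ}
    {x : Fin p.n → p.F} (hr : ReadsVec mem r x) : ReadsVec mem' r x := fun k => (hr k).mono h

theorem ReadsShares.mono {mem mem' : List Word} (h : mem <+: mem') {r : Fin p.m → Fin p.n → ℕ}
    {x : p.Shares} (hr : ReadsShares mem r x) : ReadsShares mem' r x := fun k => (hr k).mono h

theorem ReadsVec.list {mem : List Word} {r : Fin p.n → ℕ}
    {x : Fin p.n → p.F} (hr : ReadsVec mem r x) : ReadsList mem (List.ofFn r) (p.wordsF x) :=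
  ReadsList.ofFn hr

theorem impl_vec {f : Fin p.n → Builder ℕ} {mem : List Word} {x : Fin p.n → p.F}
    (h : ∀ k mem', mem <+: mem' →
      Impl p (f k) mem' (PMF.pure (x k)) fun r x mem' => Reads mem' r (p.wordF x)) :
    Impl p (Builder.pi f) mem (PMF.pure x) fun a x mem' => ReadsVec mem' a x :=
  Impl.pi_pure (R := fun _ r x mem' => Reads mem' r (p.wordF x))
    (fun _ _ _ _ _ h hr => Reads.mono h hr) h

theorem impl_shares {f : Fin p.m → Builder (Fin p.n → ℕ)} {mem : List Word} {x : p.Shares}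
    (h : ∀ i mem', mem <+: mem' →
      Impl p (f i) mem' (PMF.pure (x i)) fun a x mem' => ReadsVec mem' a x) :
    Impl p (Builder.pi f) mem (PMF.pure x) fun a x mem' => ReadsShares mem' a x :=
  Impl.pi_pure (R := fun _ r x mem' => ReadsVec mem' r x)
    (fun _ _ _ _ _ h hr => ReadsVec.mono h hr) h

end Gates

/-- A uniform vector. -/
def randVec (s : Shape) : Builder (Fin s.n → ℕ) := Builder.pi fun _ => emit .rand

/-- Uniform shares. -/
def randShares (s : Shape) : Builder (Fin s.m → Fin s.n → ℕ) := Builder.pi fun _ => randVec s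

/-- The difference of shares. -/
def subShares {s : Shape} (z a : Fin s.m → Fin s.n → ℕ) : Builder (Fin s.m → Fin s.n → ℕ) :=
  Builder.pi fun i => Builder.pi fun k => subB (z i k) (a i k)

/-- The sum of shares. -/
def addShares {s : Shape} (z a : Fin s.m → Fin s.n → ℕ) : Builder (Fin s.m → Fin s.n → ℕ) :=
  Builder.pi fun i => Builder.pi fun k => emit (.add (z i k) (a i k))

/-- The shared value. -/
def totalB {s : Shape} (zr : ℕ) (z : Fin s.m → Fin s.n → ℕ) : Builder (Fin s.n → ℕ) :=
  Builder.pi fun k => sumB zr (List.ofFn fun i => z i k)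

/-- The registers received in an opening. -/
def openRegs {s : Shape} (z : Fin s.m → Fin s.n → ℕ) (u : Fin s.n → ℕ) (i : Fin s.m) : List ℕ :=
  if i = s.leader then
    ((List.finRange s.m).filter fun j => j ≠ s.leader).flatMap fun j => List.ofFn (z j)
  else List.ofFn u

/-- The registers of shares of triples. -/
def tripleRegs {s : Shape} (a b c : Fin s.m → Fin s.n → ℕ) (i : Fin s.m) : List ℕ :=
  List.ofFn (a i) ++ List.ofFn (b i) ++ List.ofFn (c i)

/-- The product of two field elements in the code of the leader. -/
def leaderMul {s : Shape} (zr : ℕ) (i : Fin s.m) (u v : ℕ) : Builder ℕ :=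
  if i = s.leader then emit (.mul u v) else pure zr

/-- The circuit for multiplication. -/
def mulB {s : Shape} (zr : ℕ) (z z' : Fin s.m → Fin s.n → ℕ) :
    Builder ((Fin s.m → Fin s.n → ℕ) × (Fin s.m → List ℕ)) := do
  let a ← randShares s
  let b ← randShares s
  let c ← randShares s
  let d ← subShares z a
  let e ← subShares z' b
  let u ← totalB zr d
  let v ← totalB zr e
  let out ← Builder.pi fun i => Builder.pi fun k => do
    let uv ← leaderMul zr i (u k) (v k)
    let ub ← emit (.mul (u k) (b i k))
    let va ← emit (.mul (v k) (a i k))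
    let t ← emit (.add uv ub)
    let t' ← emit (.add t va)
    emit (.add t' (c i k))
  pure (out, fun i => tripleRegs a b c i ++ (openRegs d u i ++ openRegs e v i))

/-- The circuit for the final transformation with output `y`. -/
def transB {s : Shape} (zr : ℕ) (z y : Fin s.m → Fin s.n → ℕ) :
    Builder (Fin s.m → List ℕ) := do
  let a ← randShares s
  let b ← randShares s
  let d ← addShares z a
  let u ← totalB zr d
  let c ← Builder.pi fun i => Builder.pi fun k => do
    let ub ← emit (.mul (u k) (b i k))
    subB ub (y i k)
  pure fun i => tripleRegs a b c i ++ openRegs d u i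

section Gates

variable {p : Params}

theorem impl_randVec {mem : List Word} :
    Impl p (randVec p.toShape) mem (uniformOfFintype (Fin p.n → p.F))
      fun a x mem' => ReadsVec mem' a x := by
  rw [← piPMF_uniform]
  exact Impl.pi (R := fun _ r x mem' => Reads mem' r (p.wordF x))
    (fun _ _ _ _ _ h hr => Reads.mono h hr) fun _ _ _ => impl_rand

theorem impl_randShares {mem : List Word} :
    Impl p (randShares p.toShape) mem (uniformOfFintype p.Shares)
      fun a x mem' => ReadsShares mem' a x := by
  have : uniformOfFintype p.Shares = piPMF fun _ => uniformOfFintype (Fin p.n → p.F) :=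
    piPMF_uniform.symm
  rw [this]
  exact Impl.pi (R := fun _ r x mem' => ReadsVec mem' r x)
    (fun _ _ _ _ _ h hr => ReadsVec.mono h hr) fun _ _ _ => impl_randVec

theorem impl_subShares {mem : List Word} {r r' : Fin p.m → Fin p.n → ℕ} {x x' : p.Shares}
    (h : ReadsShares mem r x) (h' : ReadsShares mem r' x') :
    Impl p (subShares (s := p.toShape) r r') mem (PMF.pure (x - x'))
      fun a x mem' => ReadsShares mem' a x :=
  impl_shares fun i _ h1 => impl_vec fun k _ h2 =>
    impl_sub (((h i k).mono h1).mono h2) (((h' i k).mono h1).mono h2)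

theorem impl_addShares {mem : List Word} {r r' : Fin p.m → Fin p.n → ℕ} {x x' : p.Shares}
    (h : ReadsShares mem r x) (h' : ReadsShares mem r' x') :
    Impl p (addShares (s := p.toShape) r r') mem (PMF.pure (x + x'))
      fun a x mem' => ReadsShares mem' a x :=
  impl_shares fun i _ h1 => impl_vec fun k _ h2 =>
    impl_add (((h i k).mono h1).mono h2) (((h' i k).mono h1).mono h2)

theorem impl_total {mem : List Word} {zr : ℕ} (h0 : Reads mem zr (p.wordF 0))
    {r : Fin p.m → Fin p.n → ℕ} {x : p.Shares} (h : ReadsShares mem r x) :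
    Impl p (totalB (s := p.toShape) zr r) mem (PMF.pure (total x))
      fun a x mem' => ReadsVec mem' a x := by
  refine impl_vec fun k mem' h1 => ?_
  have : total x k = (List.ofFn fun i => x i k).sum := by rw [List.sum_ofFn]; rfl
  rw [this]
  refine impl_sum (h0.mono h1) ?_
  rw [List.forall₂_iff_get]
  refine ⟨by simp, fun i h2 h3 => ?_⟩
  simpa using (h _ k).mono h1

theorem readsList_open {mem : List Word} {r : Fin p.m → Fin p.n → ℕ} {x : p.Shares}
    (h : ReadsShares mem r x) {u : Fin p.n → ℕ} (hu : ReadsVec mem u (total x)) (i : Fin p.m) :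
    ReadsList mem (openRegs (s := p.toShape) r u i) (openView x i) := by
  unfold openRegs openView
  split_ifs
  · exact ReadsList.flatMap _ fun j _ => (h j).list
  · exact hu.list

theorem readsList_triple {mem : List Word} {a b c : Fin p.m → Fin p.n → ℕ} {t : Triples p}
    (ha : ReadsShares mem a t.a) (hb : ReadsShares mem b t.b) (hc : ReadsShares mem c t.c)
    (i : Fin p.m) :
    ReadsList mem (tripleRegs (s := p.toShape) a b c i) (tripleView t i) :=
  ((ha i).list.append (hb i).list).append (hc i).list

theorem looseTriples_eq : looseTriples p = (uniformOfFintype p.Shares).bind fun a =>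
    (uniformOfFintype p.Shares).bind fun b => (uniformOfFintype p.Shares).bind fun c =>
      PMF.pure ⟨a, b, c⟩ := by
  unfold looseTriples
  rw [uniformOfFintype_prod (α := p.Shares) (β := p.Shares × p.Shares),
    uniformOfFintype_prod (α := p.Shares) (β := p.Shares)]
  simp only [PMF.map_bind, PMF.map_comp]
  rfl

/-- The circuit carries shares of all parties, honest ones included, and samples independent
triples; words of honest parties are dropped only at the very end. -/
theorem impl_mulB {mem : List Word} {zr : ℕ} (h0 : Reads mem zr (p.wordF 0))
    {r r' : Fin p.m → Fin p.n → ℕ} {x x' : p.Shares}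
    (h : ReadsShares mem r x) (h' : ReadsShares mem r' x') :
    Impl p (mulB (s := p.toShape) zr r r') mem
      ((looseTriples p).map fun t => (mulOut t x x', mulView t x x'))
      fun a y mem' => ReadsShares mem' a.1 y.1 ∧ ∀ i, ReadsList mem' (a.2 i) (y.2 i) := by
  rw [looseTriples_eq]
  simp only [PMF.map_bind, PMF.pure_map]
  refine impl_randShares.bind fun ar a m1 p1 ha => ?_
  refine impl_randShares.bind fun br b m2 p2 hb => ?_
  refine impl_randShares.bind fun cr c m3 p3 hc => ?_
  have p13 := (p1.trans p2).trans p3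
  refine (impl_subShares (h.mono p13) (ha.mono (p2.trans p3))).pure_bind fun dr m4 p4 hd => ?_
  refine (impl_subShares (h'.mono (p13.trans p4)) (hb.mono (p3.trans p4))).pure_bind
    fun er m5 p5 he => ?_
  refine (impl_total (h0.mono ((p13.trans p4).trans p5)) (hd.mono p5)).pure_bind
    fun ur m6 p6 hu => ?_
  refine (impl_total (h0.mono (((p13.trans p4).trans p5).trans p6)) (he.mono p6)).pure_bind
    fun vr m7 p7 hv => ?_
  -- Registers are never overwritten, so all earlier facts are transported to the current memory.
  have hu := hu.mono p7
  have hd := hd.mono ((p5.trans p6).trans p7)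
  have he := he.mono (p6.trans p7)
  have p47 := (p4.trans p5).trans (p6.trans p7)
  have ha := ha.mono ((p2.trans p3).trans p47)
  have hb := hb.mono (p3.trans p47)
  have hc := hc.mono p47
  have h0 := h0.mono (p13.trans p47)
  refine Impl.pure_bind (x := mulOut ⟨a, b, c⟩ x x') (R := fun a x mem' => ReadsShares mem' a x) ?_
    fun or m8 p8 ho => Impl.pure ⟨ho, fun i => ?_⟩
  · refine impl_shares fun i n1 q1 => impl_vec fun k n2 q2 => ?_
    have q12 := q1.trans q2
    refine Impl.pure_bind (x := if i = p.leader then total (x - a) k * total (x' - b) k else 0)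
      (R := fun r x mem' => Reads mem' r (p.wordF x)) ?_ fun uvr n3 q3 huv => ?_
    · unfold leaderMul
      split_ifs
      · exact impl_mul ((hu k).mono q12) ((hv k).mono q12)
      · exact Impl.pure (h0.mono q12)
    refine (impl_mul ((hu k).mono (q12.trans q3)) ((hb i k).mono (q12.trans q3))).pure_bind
      fun ubr n4 q4 hub => ?_
    refine (impl_mul ((hv k).mono ((q12.trans q3).trans q4))
      ((ha i k).mono ((q12.trans q3).trans q4))).pure_bind fun var n5 q5 hva => ?_
    refine (impl_add (huv.mono (q4.trans q5)) (hub.mono q5)).pure_bind fun t n6 q6 ht => ?_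
    refine (impl_add ht (hva.mono q6)).pure_bind fun t' n7 q7 ht' => ?_
    exact impl_add ht' ((hc i k).mono
      ((((q12.trans q3).trans q4).trans q5).trans (q6.trans q7)))
  · exact ((readsList_triple (t := ⟨a, b, c⟩) ha hb hc i).append
      ((readsList_open hd hu i).append (readsList_open he hv i))).mono p8

/-- Only `a` and `b` are sampled; the shares of `c` are solved from the prescribed output `y`, as in
`simTriple`. -/
theorem impl_transB {mem : List Word} {zr : ℕ} (h0 : Reads mem zr (p.wordF 0))
    {r r' : Fin p.m → Fin p.n → ℕ} {z y : p.Shares}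
    (h : ReadsShares mem r z) (h' : ReadsShares mem r' y) :
    Impl p (transB (s := p.toShape) zr r r') mem
      ((uniformOfFintype (p.Shares × p.Shares)).map fun ab => transView (simTriple z y ab) z)
      fun a v mem' => ∀ i, ReadsList mem' (a i) (v i) := by
  rw [uniformOfFintype_prod (α := p.Shares) (β := p.Shares)]
  simp only [PMF.map_bind, PMF.map_comp, Function.comp_def]
  refine impl_randShares.bind fun ar a m1 p1 ha => ?_
  refine impl_randShares.bind fun br b m2 p2 hb => ?_
  simp only [Function.comp_def]
  have p12 := p1.trans p2
  refine (impl_addShares (h.mono p12) (ha.mono p2)).pure_bind fun dr m3 p3 hd => ?_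
  refine (impl_total (h0.mono (p12.trans p3)) hd).pure_bind fun ur m4 p4 hu => ?_
  refine Impl.pure_bind (x := (simTriple z y (a, b)).c)
    (R := fun a x mem' => ReadsShares mem' a x) ?_
    fun cr m5 p5 hc => Impl.pure fun i => ?_
  · refine impl_shares fun i n1 q1 => impl_vec fun k n2 q2 => ?_
    have q12 := q1.trans q2
    refine (impl_mul ((hu k).mono q12) ((hb i k).mono ((p3.trans p4).trans q12))).pure_bind
      fun t n3 q3 ht => ?_
    exact impl_sub ht ((h' i k).mono ((p12.trans (p3.trans p4)).trans (q12.trans q3)))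
  · exact (readsList_triple (t := simTriple z y (a, b))
      (ha.mono ((p2.trans p3).trans (p4.trans p5))) (hb.mono (p3.trans (p4.trans p5))) hc i).append
      ((readsList_open (hd.mono p4) hu i).mono p5)

end Gates

/-! ### The size of the circuits for secret sharing -/

theorem costs_randShares (s : Shape) : Costs (randShares s) (s.m * (s.n * 1)) fun _ => True :=
  (Costs.pi fun _ => (Costs.pi fun _ => Costs.emit _).mono le_rfl fun _ _ => trivial).mono
    le_rfl fun _ _ => trivial

theorem costs_subShares {s : Shape} (z a : Fin s.m → Fin s.n → ℕ) :
    Costs (subShares z a) (s.m * (s.n * 2)) fun _ => True :=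
  (Costs.pi fun _ => (Costs.pi fun _ => costs_sub _ _).mono le_rfl fun _ _ => trivial).mono
    le_rfl fun _ _ => trivial

theorem costs_addShares {s : Shape} (z a : Fin s.m → Fin s.n → ℕ) :
    Costs (addShares z a) (s.m * (s.n * 1)) fun _ => True :=
  (Costs.pi fun _ => (Costs.pi fun _ => Costs.emit _).mono le_rfl fun _ _ => trivial).mono
    le_rfl fun _ _ => trivial

theorem costs_total {s : Shape} (zr : ℕ) (z : Fin s.m → Fin s.n → ℕ) :
    Costs (totalB zr z) (s.n * s.m) fun _ => True :=
  (Costs.pi fun _ => (costs_sum _ _).mono (by simp) fun _ h => h).mono le_rfl fun _ _ => trivial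

theorem length_openRegs {s : Shape} (z : Fin s.m → Fin s.n → ℕ) (u : Fin s.n → ℕ) (i : Fin s.m) :
    (openRegs z u i).length ≤ s.m * s.n := by
  -- The pivot exists, so there is at least one party and `n ≤ m * n`.
  have hm : 1 ≤ s.m := by have := s.pivot.isLt; omega
  unfold openRegs
  split_ifs
  · rw [List.length_flatMap]
    simp only [List.length_ofFn, List.map_const', List.sum_replicate, smul_eq_mul]
    gcongr
    exact (List.length_filter_le _ _).trans (by simp)
  · rw [List.length_ofFn]
    nlinarith

theorem length_tripleRegs {s : Shape} (a b c : Fin s.m → Fin s.n → ℕ) (i : Fin s.m) :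
    (tripleRegs a b c i).length = 3 * s.n := by
  simp [tripleRegs]; ring

/-- In units of `m * n`: three random sharings, two subtractions at `2` each, two totals, and `6`
instructions per output entry make `15`. A view holds three vectors of a triple and two openings,
which makes `5`. -/
theorem costs_mulB {s : Shape} (zr : ℕ) (z z' : Fin s.m → Fin s.n → ℕ) :
    Costs (mulB zr z z') (15 * (s.m * s.n)) fun x => ∀ i, (x.2 i).length ≤ 5 * (s.m * s.n) := by
  have hm : 1 ≤ s.m := by have := s.pivot.isLt; omega
  refine Costs.mono ?_ (c := s.m * (s.n * 1) + (s.m * (s.n * 1) + (s.m * (s.n * 1) +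
    (s.m * (s.n * 2) + (s.m * (s.n * 2) + (s.n * s.m + (s.n * s.m + s.m * (s.n * 6))))))))
    ?_ fun _ h => h
  · refine (costs_randShares s).bind fun a _ => (costs_randShares s).bind fun b _ =>
      (costs_randShares s).bind fun c _ => (costs_subShares _ _).bind fun d _ =>
      (costs_subShares _ _).bind fun e _ => (costs_total _ _).bind fun u _ =>
      (costs_total _ _).bind fun v _ => Costs.bind_pure (Post := fun _ => True) ?_ fun o _ i => ?_
    · refine (Costs.pi (Post := fun _ => True) fun i => (Costs.pi (Post := fun _ => True) fun k =>
        ?_).mono le_rfl fun _ _ => trivial).mono le_rfl fun _ _ => trivial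
      refine Costs.bind (c := 1) (c' := 5) (Post := fun _ => True) ?_ fun _ _ => ?_
      · unfold leaderMul
        split_ifs
        · exact Costs.emit _
        · exact (Costs.pure trivial).mono (by simp) fun _ h => h
      · exact Costs.bind (c := 1) (c' := 4) (Costs.emit _) fun _ _ =>
          Costs.bind (c := 1) (c' := 3) (Costs.emit _) fun _ _ =>
          Costs.bind (c := 1) (c' := 2) (Costs.emit _) fun _ _ =>
          Costs.bind (c := 1) (c' := 1) (Costs.emit _) fun _ _ => Costs.emit _
    · simp only [List.length_append, length_tripleRegs]
      have h1 := length_openRegs d u i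
      have h2 := length_openRegs e v i
      have : s.n ≤ s.m * s.n := Nat.le_mul_of_pos_left _ hm
      omega
  · ring_nf; omega

theorem costs_transB {s : Shape} (zr : ℕ) (z y : Fin s.m → Fin s.n → ℕ) :
    Costs (transB zr z y) (7 * (s.m * s.n)) fun x => ∀ i, (x i).length ≤ 4 * (s.m * s.n) := by
  have hm : 1 ≤ s.m := by have := s.pivot.isLt; omega
  refine Costs.mono ?_ (c := s.m * (s.n * 1) + (s.m * (s.n * 1) + (s.m * (s.n * 1) +
    (s.n * s.m + s.m * (s.n * 3))))) ?_ fun _ h => h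
  · refine (costs_randShares s).bind fun a _ => (costs_randShares s).bind fun b _ =>
      (costs_addShares _ _).bind fun d _ => (costs_total _ _).bind fun u _ =>
      Costs.bind_pure (Post := fun _ => True) ?_ fun o _ i => ?_
    · exact (Costs.pi (Post := fun _ => True) fun i => (Costs.pi (Post := fun _ => True) fun k =>
        (Costs.emit _).bind fun _ _ => costs_sub _ _).mono le_rfl fun _ _ => trivial).mono
          le_rfl fun _ _ => trivial
    · simp only [List.length_append, length_tripleRegs]
      have h1 := length_openRegs d u i
      have : s.n ≤ s.m * s.n := Nat.le_mul_of_pos_left _ hm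
      omega
  · ring_nf; omega

end
end ZeroSharing

namespace ZeroSharing
noncomputable section
open PMF (uniformOfFintype uniformOfFinset)

open Builder

/-! ### The simulated distribution -/

section Semantics

variable {p : Params}

/-- The simulated protocol for `x ∈ X_j`, for a list of field elements. -/
def simMem (inp : Input p) (A : Finset (Fin p.m)) (j : p.toShape.Other) (U : List p.F) :
    PMF (Transcript p) :=
  if j.1 ∈ A then
    (uniformOfFintype (Fin p.n → p.Key)).bind fun key =>
      (piPMF fun k => p.pprf.hint (key k) (inp.X j k ×ˢ {-U.getD k 0})).map fun h =>
        (twoPartyShares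
            (fun k => if p.pivot ∈ A then p.pprf.eval (key k) (h k) (inp.x k) else 0) j
            fun k => U.getD k 0,
          memView j (fun k => U.getD k 0) key h
            fun k => if p.pivot ∈ A then p.pprf.eval (key k) (h k) (inp.x k) else 0, 0)
  else PMF.pure (twoPartyShares (fun k => U.getD k 0) j 0,
    fun i => if i = p.pivot then p.wordsF fun k => U.getD k 0 else [], 0)

open Classical in
/-- The membership bit, if it is known to the corrupted parties. -/
def knownBit (inp : Input p) (A : Finset (Fin p.m)) (j : p.toShape.Other) (k : Fin p.n) : Bool :=
  if j.1 ∈ A ∧ p.pivot ∈ A then decide (inp.x k ∈ inp.X j k) else false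

/-- The simulated protocol for `x ∉ X_j`. -/
def simNotMem (inp : Input p) (A : Finset (Fin p.m)) (j : p.toShape.Other) :
    PMF (Transcript p) :=
  (uniformOfFintype (Fin p.n → Bool)).bind fun e =>
    (uniformOfFintype (Fin p.n → p.F)).bind fun r₀ =>
      (uniformOfFintype (Fin p.n → p.F)).bind fun r₁ =>
        PMF.pure (twoPartyShares
            (fun k => if xor (e k) (knownBit inp A j k) then r₁ k else r₀ k) j
            fun k => -(if e k then r₁ k else r₀ k),
          notMemView j e (fun k => xor (e k) (knownBit inp A j k)) (fun b => if b then r₁ else r₀)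
            fun k => if xor (e k) (knownBit inp A j k) then r₁ k else r₀ k, 0)

/-- The simulated evaluation of a formula. -/
def simEval (inp : Input p) (A : Finset (Fin p.m)) (Q : SetFormula p.toShape.Other)
    (U : List p.F) : PMF (Transcript p) :=
  evalFormula (looseTriples p) (simMem inp A) (fun j _ => simNotMem inp A j) Q U

/-- The simulated views, given the outputs. -/
def simViews (inp : Input p) (A : Finset (Fin p.m)) (U : List p.F) (y : p.Shares) :
    PMF (Views p) :=
  (simEval inp A p.Q U).bind fun x => (uniformOfFintype (p.Shares × p.Shares)).map fun ab =>
    fun i => inp.words i ++ (x.2.1 i ++ transView (simTriple x.1 y ab) x.1 i)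

end Semantics

/-! ### The simulator circuit -/

/-- The registers of the inputs. -/
structure InRegs (s : Shape) where
  x : Fin s.n → ℕ
  X : s.Other → Fin s.n → List ℕ

/-- The registers of the input of a party. -/
def InRegs.words {s : Shape} (ir : InRegs s) (i : Fin s.m) : List ℕ :=
  if h : i = s.pivot then List.ofFn ir.x
  else (List.finRange s.n).flatMap fun k => ir.X ⟨i, h⟩ k

/-- The registers of shares of two parties. -/
def twoPartyRegs {s : Shape} (zr : ℕ) (u : Fin s.n → ℕ) (j : s.Other) (r : Fin s.n → ℕ) :
    Fin s.m → Fin s.n → ℕ :=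
  fun i => if i = s.pivot then u else if i = j.1 then r else fun _ => zr

/-- The evaluation of the programmable PRF, if the queries are known. -/
def evalKnown {s : Shape} (A : Finset (Fin s.m)) (zr key h x : ℕ) : Builder ℕ :=
  if s.pivot ∈ A then emit (.eval key h x) else pure zr

/-- The circuit for the protocol for `x ∈ X_j`. -/
def memB {s : Shape} (A : Finset (Fin s.m)) (ir : InRegs s) (zr : ℕ) (j : s.Other) (U : List ℕ) :
    Builder ((Fin s.m → Fin s.n → ℕ) × (Fin s.m → List ℕ)) :=
  if j.1 ∈ A then do
    let key ← Builder.pi fun _ : Fin s.n => emit .key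
    let nr ← Builder.pi fun k : Fin s.n => emit (.neg (U.getD k 0))
    let h ← Builder.pi fun k => emit (.hint (key k) ((ir.X j k).map fun e => (e, nr k)))
    let u ← Builder.pi fun k => evalKnown A zr (key k) (h k) (ir.x k)
    pure (twoPartyRegs zr u j fun k => U.getD k 0, fun i =>
      if i = j.1 then (List.ofFn fun k : Fin s.n => U.getD k 0) ++ (List.ofFn key ++ List.ofFn h)
      else if i = s.pivot then List.ofFn u else [])
  else pure (twoPartyRegs zr (fun k => U.getD k 0) j fun _ => zr,
    fun i => if i = s.pivot then List.ofFn fun k : Fin s.n => U.getD k 0 else [])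

/-- Membership in a list of words. -/
def memListB (f x : ℕ) : List ℕ → Builder ℕ
  | [] => pure f
  | e :: es => do
    let t ← memListB f x es
    let q ← emit (.eq e x)
    emit (.select q q t)

/-- The known membership bit. -/
def knownBitB {s : Shape} (A : Finset (Fin s.m)) (ir : InRegs s) (f : ℕ) (j : s.Other)
    (k : Fin s.n) : Builder ℕ :=
  if j.1 ∈ A ∧ s.pivot ∈ A then memListB f (ir.x k) (ir.X j k) else pure f

/-- The circuit for the protocol for `x ∉ X_j`. -/
def notMemB {s : Shape} (A : Finset (Fin s.m)) (ir : InRegs s) (zr : ℕ) (j : s.Other) :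
    Builder ((Fin s.m → Fin s.n → ℕ) × (Fin s.m → List ℕ)) := do
  let f ← emit (.const [false])
  let e ← Builder.pi fun _ : Fin s.n => emit .coin
  let r₀ ← randVec s
  let r₁ ← randVec s
  let mb ← Builder.pi fun k => knownBitB A ir f j k
  let e' ← Builder.pi fun k => do
    let ne ← emit (.nand (e k) (e k))
    emit (.select (mb k) ne (e k))
  let u ← Builder.pi fun k => emit (.select (e' k) (r₁ k) (r₀ k))
  let w ← Builder.pi fun k => do
    let t ← emit (.select (e k) (r₁ k) (r₀ k))
    emit (.neg t)
  pure (twoPartyRegs zr u j w, fun i =>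
    if i = j.1 then List.ofFn e ++ (List.ofFn r₀ ++ List.ofFn r₁)
    else if i = s.pivot then List.ofFn e' ++ List.ofFn u else [])

/-- The circuit for the evaluation of a formula. -/
def evalB {s : Shape} (A : Finset (Fin s.m)) (ir : InRegs s) (zr : ℕ) :
    SetFormula s.Other → List ℕ → Builder ((Fin s.m → Fin s.n → ℕ) × (Fin s.m → List ℕ))
  | .mem j, U => memB A ir zr j U
  | .notMem j, _ => notMemB A ir zr j
  | .and B C, U => do
    let x ← evalB A ir zr B (U.take (B.literals * s.n))
    let y ← evalB A ir zr C (U.drop (B.literals * s.n))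
    let z ← addShares x.1 y.1
    pure (z, fun i => x.2 i ++ y.2 i)
  | .or B C, U => do
    let x ← evalB A ir zr B (U.take (B.literals * s.n))
    let y ← evalB A ir zr C (U.drop (B.literals * s.n))
    let t ← mulB zr x.1 y.1
    pure (t.1, fun i => x.2 i ++ (y.2 i ++ t.2 i))

/-- The circuit that computes the simulated views. -/
def viewsB {s : Shape} (A : Finset (Fin s.m)) (ir : InRegs s) (sr : Fin s.m → Fin s.n → ℕ)
    (U : List ℕ) : Builder (List ℕ) := do
  let zr ← zeroB
  let x ← evalB A ir zr s.Q U
  let t ← transB zr x.1 fun i k => if i ∈ A then sr i k else zr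
  pure (((List.finRange s.m).filter fun i => i ∈ A).flatMap fun i => ir.words i ++ (x.2 i ++ t i))

/-! ### Correctness of the circuit for the simulated views -/

section Correctness

variable {p : Params}

/-- The registers contain the inputs of the corrupted parties. -/
structure ReadsInput (mem : List Word) (ir : InRegs p.toShape) (inp : Input p)
    (A : Finset (Fin p.m)) : Prop where
  x : p.pivot ∈ A → ∀ k, Reads mem (ir.x k) (List.ofFn (inp.x k))
  X : ∀ j : p.toShape.Other, j.1 ∈ A → ∀ k,
    ReadsList mem (ir.X j k) ((inp.X j k).toList.map List.ofFn)

theorem ReadsInput.mono {mem mem' : List Word} (h : mem <+: mem') {ir : InRegs p.toShape}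
    {inp : Input p} {A : Finset (Fin p.m)} (hr : ReadsInput mem ir inp A) :
    ReadsInput mem' ir inp A :=
  ⟨fun hp k => (hr.x hp k).mono h, fun j hj k => (hr.X j hj k).mono h⟩

theorem ReadsInput.words {mem : List Word} {ir : InRegs p.toShape} {inp : Input p}
    {A : Finset (Fin p.m)} (hr : ReadsInput mem ir inp A) {i : Fin p.m} (hi : i ∈ A) :
    ReadsList mem (ir.words i) (inp.words i) := by
  unfold InRegs.words Input.words
  split_ifs with h
  · subst h; exact ReadsList.ofFn (hr.x hi)
  · exact ReadsList.flatMap _ fun k _ => hr.X ⟨i, h⟩ hi k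

/-- The registers contain shares and views. -/
def ReadsTranscript (a : (Fin p.m → Fin p.n → ℕ) × (Fin p.m → List ℕ)) (x : Transcript p)
    (mem : List Word) : Prop :=
  ReadsShares mem a.1 x.1 ∧ ∀ i, ReadsList mem (a.2 i) (x.2.1 i)

theorem readsShares_twoParty {mem : List Word} {zr : ℕ} (h0 : Reads mem zr (p.wordF 0))
    {ur rr : Fin p.n → ℕ} {u r : Fin p.n → p.F} (hu : ReadsVec mem ur u) (hr : ReadsVec mem rr r)
    (j : p.toShape.Other) :
    ReadsShares mem (twoPartyRegs (s := p.toShape) zr ur j rr) (twoPartyShares u j r) := by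
  intro i
  unfold twoPartyRegs twoPartyShares
  split_ifs
  · exact hu
  · exact hr
  · exact fun _ => h0

/-- The length assumption keeps every index in range, so neither default, register number `0` or
field element `0`, is ever used. -/
theorem readsVec_getD {mem : List Word} {Ur : List ℕ} {U : List p.F}
    (hU : ReadsList mem Ur (U.map p.wordF)) (hn : p.n ≤ U.length) :
    ReadsVec mem (fun k => Ur.getD k 0) (fun k : Fin p.n => U.getD k 0) := by
  intro k
  have hk : (k : ℕ) < U.length := k.isLt.trans_le hn
  obtain ⟨h1, h2⟩ := List.forall₂_iff_get.1 hU
  rw [List.length_map] at h1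
  have := h2 k (by omega) (by simpa using hk)
  simpa [List.getD, hk, h1 ▸ hk] using this

/-- The instruction turns its list of points into a finite set, so the order in which the elements
of `X` are stored does not matter. -/
theorem hint_step {mem : List Word} {key nr : ℕ} {es : List ℕ} {κ : p.Key} {a : p.F}
    {X : Finset p.Elt} (hk : Reads mem key (List.ofFn κ)) (hr : Reads mem nr (p.wordF a))
    (he : ReadsList mem es (X.toList.map List.ofFn)) :
    (Instr.hint key (es.map fun e => (e, nr))).step p mem = p.pprf.hint κ (X ×ˢ {a}) := by
  simp only [Instr.step, hk.reg, ofBits_ofFn, List.map_map]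
  congr 1
  have : es.map ((fun q : ℕ × ℕ => (ofBits p.l (reg mem q.1), p.decF (reg mem q.2))) ∘
      fun e => (e, nr)) = X.toList.map fun x => (x, a) := by
    have h1 := congrArg (List.map fun w => (ofBits p.l w, a)) he.map_reg
    simp only [List.map_map] at h1
    rw [show (fun q : ℕ × ℕ => (ofBits p.l (reg mem q.1), p.decF (reg mem q.2))) ∘
      (fun e => (e, nr)) = (fun w => (ofBits p.l w, a)) ∘ reg mem by
        funext e; simp [hr.reg, decF_wordF], h1]
    congr 1
    funext x
    simp [ofBits_ofFn]
  rw [this]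
  ext ⟨x, b⟩
  simp [eq_comm]

theorem impl_memB {mem : List Word} {A : Finset (Fin p.m)} {ir : InRegs p.toShape} {inp : Input p}
    (hin : ReadsInput mem ir inp A) {zr : ℕ} (h0 : Reads mem zr (p.wordF 0))
    (j : p.toShape.Other) {Ur : List ℕ} {U : List p.F} (hU : ReadsList mem Ur (U.map p.wordF))
    (hn : p.n ≤ U.length) :
    Impl p (memB A ir zr j Ur) mem (simMem inp A j U) ReadsTranscript := by
  have hr := readsVec_getD hU hn
  unfold memB simMem
  by_cases hj : j.1 ∈ A
  · rw [if_pos hj, if_pos hj]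
    refine Impl.bind (R := fun a x mem' => ∀ k, Reads mem' (a k) (List.ofFn (x k))) ?_
      fun keyr key m1 p1 hkey => ?_
    · rw [← piPMF_uniform]
      exact Impl.pi (R := fun _ r x mem' => Reads mem' r (List.ofFn x))
        (fun _ _ _ _ _ h hr => Reads.mono h hr) fun _ _ _ => Impl.emit rfl
    refine Impl.pure_bind (x := fun k : Fin p.n => -U.getD k 0)
      (R := fun a x mem' => ReadsVec mem' a x) ?_ fun nrr m2 p2 hnr => ?_
    · exact impl_vec fun k m q => impl_neg ((hr k).mono (p1.trans q))
    have hkey := fun k => (hkey k).mono p2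
    refine Impl.bind (R := fun a x mem' => ∀ k, Reads mem' (a k) (x k)) ?_ fun hrr h m3 p3 hh => ?_
    · refine Impl.pi (R := fun _ r x mem' => Reads mem' r x)
        (fun _ _ _ _ _ h hr => Reads.mono h hr) fun k m q => Impl.emit (f := fun w => w) ?_
      rw [hint_step ((hkey k).mono q) ((hnr k).mono q)
        ((hin.X j hj k).mono ((p1.trans p2).trans q))]
      exact (PMF.map_id _).symm
    have p13 := (p1.trans p2).trans p3
    refine Impl.pure_bind
      (x := fun k => if p.pivot ∈ A then p.pprf.eval (key k) (h k) (inp.x k) else 0)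
      (R := fun a x mem' => ReadsVec mem' a x) ?_ fun ur m4 p4 hu => ?_
    · refine impl_vec fun k m q => ?_
      unfold evalKnown
      split_ifs with hp
      · refine Impl.emit_pure ?_
        simp only [Instr.step, ((hkey k).mono (p3.trans q)).reg, ((hh k).mono q).reg,
          ((hin.x hp k).mono (p13.trans q)).reg, ofBits_ofFn]
        rfl
      -- With an honest pivot its query is unavailable, and a zero stands in for the value that no
      -- corrupted party sees.
      · exact Impl.pure (h0.mono (p13.trans q))
    have p14 := p13.trans p4
    refine Impl.pure ⟨readsShares_twoParty (h0.mono p14) hu (hr.mono p14) j, fun i => ?_⟩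
    refine ReadsList.ite (fun _ => ?_) fun _ => ReadsList.ite (fun _ => ?_) fun _ => ?_
    · exact (hr.mono p14).list.append ((ReadsList.ofFn fun k => (hkey k).mono (p3.trans p4)).append
        (ReadsList.ofFn fun k => (hh k).mono p4))
    · exact hu.list
    · exact List.Forall₂.nil
  · rw [if_neg hj, if_neg hj]
    refine Impl.pure ⟨readsShares_twoParty h0 hr
      (show ReadsVec mem (fun _ => zr) (0 : Fin p.n → p.F) from fun _ => h0) j, fun i => ?_⟩
    refine ReadsList.ite (fun _ => ?_) fun _ => ?_
    · exact hr.list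
    · exact List.Forall₂.nil

theorem impl_select {α : Type} {mem : List Word} {c i j : ℕ} {b : Bool} {x y : α} {f : α → Word}
    (hc : Reads mem c [b]) (hi : Reads mem i (f x)) (hj : Reads mem j (f y)) :
    Impl p (emit (.select c i j)) mem (PMF.pure (if b then x else y))
      fun r x mem' => Reads mem' r (f x) := by
  refine Impl.emit_pure ?_
  simp only [Instr.step, hc.reg, hi.reg, hj.reg, List.headD_cons]
  cases b <;> rfl

open Classical in
theorem impl_memListB {mem : List Word} {f x : ℕ} {a : Word} (hf : Reads mem f [false])
    (hx : Reads mem x a) {es : List ℕ} {ws : List Word} (h : ReadsList mem es ws) :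
    Impl p (memListB f x es) mem (PMF.pure (decide (a ∈ ws))) fun r b mem' => Reads mem' r [b] := by
  induction h with
  | nil => exact Impl.pure (by simpa using hf)
  | @cons e w es ws h _ ih =>
    refine ih.pure_bind fun t m1 p1 ht => ?_
    refine Impl.pure_bind (x := decide (a = w)) (R := fun r b mem' => Reads mem' r [b])
      (Impl.emit_pure ?_) fun q m2 p2 hq => ?_
    · simp only [Instr.step, (h.mono p1).reg, (hx.mono p1).reg, eq_comm]
      rfl
    -- Selecting `q` if `q` holds and `t` otherwise is the disjunction of the two bits.
    · have := impl_select (p := p) (f := fun b => [b]) hq hq (ht.mono p2)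
      convert this using 2
      by_cases hw : a = w <;> simp [hw]

theorem impl_notMemB {mem : List Word} {A : Finset (Fin p.m)} {ir : InRegs p.toShape}
    {inp : Input p} (hin : ReadsInput mem ir inp A) {zr : ℕ} (h0 : Reads mem zr (p.wordF 0))
    (j : p.toShape.Other) :
    Impl p (notMemB A ir zr j) mem (simNotMem inp A j) ReadsTranscript := by
  unfold simNotMem
  refine Impl.pure_bind (x := ()) (R := fun r _ mem' => Reads mem' r [false])
    (Impl.emit_pure (f := fun _ => [false]) rfl) fun f m0 p0 hf => ?_
  refine Impl.bind (R := fun a x mem' => ∀ k, Reads mem' (a k) [x k]) ?_ fun er e m1 p1 he => ?_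
  · rw [← piPMF_uniform]
    exact Impl.pi (R := fun _ r x mem' => Reads mem' r [x])
      (fun _ _ _ _ _ h hr => Reads.mono h hr) fun _ _ _ => Impl.emit rfl
  refine impl_randVec.bind fun rr r₀ m2 p2 hr₀ => ?_
  refine impl_randVec.bind fun rr' r₁ m3 p3 hr₁ => ?_
  refine Impl.pure_bind (x := fun k => knownBit inp A j k)
    (R := fun a x mem' => ∀ k, Reads mem' (a k) [x k]) ?_ fun br m4 p4 hb => ?_
  · refine Impl.pi_pure (R := fun _ r x mem' => Reads mem' r [x])
      (fun _ _ _ _ _ h hr => Reads.mono h hr) fun k m q => ?_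
    unfold knownBitB knownBit
    have pq := (((p0.trans p1).trans p2).trans p3).trans q
    have hf' := hf.mono (((p1.trans p2).trans p3).trans q)
    split_ifs with hA
    · have := impl_memListB (p := p) hf' ((hin.x hA.2 k).mono pq) ((hin.X j hA.1 k).mono pq)
      simpa using this
    · exact Impl.pure hf'
  have he := fun k => (he k).mono ((p2.trans p3).trans p4)
  have hb : ∀ k, Reads m4 (br k) [knownBit inp A j k] := hb
  refine Impl.pure_bind (x := fun k => xor (e k) (knownBit inp A j k))
    (R := fun a x mem' => ∀ k, Reads mem' (a k) [x k]) ?_ fun er' m5 p5 he' => ?_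
  · refine Impl.pi_pure (R := fun _ r x mem' => Reads mem' r [x])
      (fun _ _ _ _ _ h hr => Reads.mono h hr) fun k m q => ?_
    refine Impl.pure_bind (x := !e k) (R := fun r b mem' => Reads mem' r [b])
      (Impl.emit_pure ?_) fun ne m' q' hne => ?_
    · simp only [Instr.step, ((he k).mono q).reg, List.headD_cons, Bool.and_self]
      rfl
    -- Choosing between `e` and its negation according to the known bit is their exclusive or.
    · have := impl_select (p := p) (f := fun b => [b]) ((hb k).mono (q.trans q')) hne
        ((he k).mono (q.trans q'))
      convert this using 2
      cases knownBit inp A j k <;> cases e k <;> rfl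
  have hr₀ := hr₀.mono ((p3.trans p4).trans p5)
  have hr₁ := hr₁.mono (p4.trans p5)
  have he := fun k => (he k).mono p5
  refine Impl.pure_bind (x := fun k => if xor (e k) (knownBit inp A j k) then r₁ k else r₀ k)
    (R := fun a x mem' => ReadsVec mem' a x) ?_ fun ur m6 p6 hu => ?_
  · exact impl_vec fun k m q =>
      impl_select (f := p.wordF) ((he' k).mono q) ((hr₁ k).mono q) ((hr₀ k).mono q)
  refine Impl.pure_bind (x := fun k => -(if e k then r₁ k else r₀ k))
    (R := fun a x mem' => ReadsVec mem' a x) ?_ fun wr m7 p7 hw => ?_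
  · have p6 := p6
    exact impl_vec fun k m q => Impl.pure_bind
      (impl_select (f := p.wordF) ((he k).mono (p6.trans q)) ((hr₁ k).mono (p6.trans q))
        ((hr₀ k).mono (p6.trans q))) fun t m' q' ht => impl_neg ht
  have p17 : mem <+: m7 :=
    ((((p0.trans p1).trans p2).trans p3).trans p4).trans ((p5.trans p6).trans p7)
  refine Impl.pure ⟨readsShares_twoParty (h0.mono p17) (hu.mono p7) hw j, fun i => ?_⟩
  refine ReadsList.ite (fun _ => ?_) fun _ => ReadsList.ite (fun _ => ?_) fun _ => ?_
  · exact (ReadsList.ofFn fun k => (he k).mono (p6.trans p7)).append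
      ((hr₀.mono (p6.trans p7)).list.append (hr₁.mono (p6.trans p7)).list)
  · exact (ReadsList.ofFn fun k => (he' k).mono (p6.trans p7)).append (hu.mono p7).list
  · exact List.Forall₂.nil

/-- Each literal owns a block of `n` pool entries, and negative literals simply ignore theirs. The
exact pool length makes `take` and `drop` cut the list between the blocks of the two subformulas. -/
theorem impl_evalB {mem : List Word} {A : Finset (Fin p.m)} {ir : InRegs p.toShape}
    {inp : Input p} (hin : ReadsInput mem ir inp A) {zr : ℕ} (h0 : Reads mem zr (p.wordF 0))
    (Q : SetFormula p.toShape.Other) {Ur : List ℕ} {U : List p.F}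
    (hU : ReadsList mem Ur (U.map p.wordF)) (hn : U.length = Q.literals * p.n) :
    Impl p (evalB A ir zr Q Ur) mem (simEval inp A Q U) ReadsTranscript := by
  unfold simEval
  induction Q generalizing mem Ur U with
  | mem j => exact impl_memB hin h0 j hU (by simp [hn, SetFormula.literals])
  | notMem j => exact impl_notMemB hin h0 j
  | and B C hB hC =>
    simp only [evalB, evalFormula]
    have hn' : U.length = B.literals * p.n + C.literals * p.n := by
      rw [hn, SetFormula.literals, add_mul]
    refine (hB hin h0 (Ur := Ur.take (B.literals * p.n)) (by
      rw [List.map_take]; exact List.forall₂_take _ hU) (by simp; omega)).bind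
      fun xr x m1 p1 hx => ?_
    refine (hC (hin.mono p1) (h0.mono p1) (Ur := Ur.drop (B.literals * p.n)) (by
      rw [List.map_drop]; exact ReadsList.mono p1 (List.forall₂_drop _ hU)) (by simp; omega)).bind
      fun yr y m2 p2 hy => ?_
    refine (impl_addShares (hx.1.mono p2) hy.1).pure_bind fun z m3 p3 hz => ?_
    exact Impl.pure ⟨hz, fun i => ((hx.2 i).mono (p2.trans p3)).append ((hy.2 i).mono p3)⟩
  | or B C hB hC =>
    simp only [evalB, evalFormula]
    have hn' : U.length = B.literals * p.n + C.literals * p.n := by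
      rw [hn, SetFormula.literals, add_mul]
    refine (hB hin h0 (Ur := Ur.take (B.literals * p.n)) (by
      rw [List.map_take]; exact List.forall₂_take _ hU) (by simp; omega)).bind
      fun xr x m1 p1 hx => ?_
    refine (hC (hin.mono p1) (h0.mono p1) (Ur := Ur.drop (B.literals * p.n)) (by
      rw [List.map_drop]; exact ReadsList.mono p1 (List.forall₂_drop _ hU)) (by simp; omega)).bind
      fun yr y m2 p2 hy => ?_
    have := (impl_mulB (h0.mono (p1.trans p2)) (hx.1.mono p2) hy.1).bind_map
      (f := fun t => (t.1, fun i => xr.2 i ++ (yr.2 i ++ t.2 i)))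
      (g := fun t => ((t.1, fun i => x.2.1 i ++ (y.2.1 i ++ t.2 i), x.2.2 * y.2.2) : Transcript p))
      (R' := ReadsTranscript) fun tr t m3 p3 ht => ⟨ht.1, fun i =>
        ((hx.2 i).mono (p2.trans p3)).append (((hy.2 i).mono p3).append (ht.2 i))⟩
    rw [PMF.map_comp] at this
    exact this

/-- The simulator is not given the honest outputs and puts `0` in their place; this is justified by
`couple_transView`. -/
theorem impl_viewsB {mem : List Word} {A : Finset (Fin p.m)} {ir : InRegs p.toShape}
    {inp : Input p} (hin : ReadsInput mem ir inp A) {sr : Fin p.m → Fin p.n → ℕ} {y : p.Shares}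
    (hy : ∀ i ∈ A, ReadsVec mem (sr i) (y i)) {Ur : List ℕ} {U : List p.F}
    (hU : ReadsList mem Ur (U.map p.wordF)) (hn : U.length = p.Q.literals * p.n) :
    Impl p (viewsB A ir sr Ur) mem
      ((simViews inp A U fun i k => if i ∈ A then y i k else 0).map (collect A))
      fun rs ws mem' => ReadsList mem' rs ws := by
  unfold simViews
  rw [PMF.map_bind]
  refine impl_zero.pure_bind fun zr m0 p0 h0 => ?_
  refine (impl_evalB (hin.mono p0) h0 p.Q (hU.mono p0) hn).bind fun xr x m1 p1 hx => ?_
  have p01 := p0.trans p1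
  rw [PMF.map_comp]
  have := (impl_transB (h0.mono p1) hx.1 (r' := fun i k => if i ∈ A then sr i k else zr)
    (y := fun i k => if i ∈ A then y i k else 0) (fun i k => ?_)).bind_map
    (f := fun t => ((List.finRange p.m).filter fun i => i ∈ A).flatMap fun i =>
      ir.words i ++ (xr.2 i ++ t i))
    (g := fun v => collect A fun i => inp.words i ++ (x.2.1 i ++ v i))
    (R' := fun rs ws mem' => ReadsList mem' rs ws) fun tr t m2 p2 ht =>
      ReadsList.flatMap _ fun i hi => ?_
  · rw [PMF.map_comp] at this
    exact this
  · beta_reduce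
    split_ifs with hi
    · exact (hy i hi k).mono p01
    · exact h0.mono p1
  · have hi : i ∈ A := by simpa using hi
    exact ((hin.mono (p01.trans p2)).words hi).append (((hx.2 i).mono p2).append (ht i))

end Correctness

end
end ZeroSharing

namespace ZeroSharing
noncomputable section
open PMF (uniformOfFintype uniformOfFinset)

open Builder

/-! ### The size of the simulator -/

section Size

variable {s : Shape}

theorem costs_memB (A : Finset (Fin s.m)) (ir : InRegs s) (zr : ℕ) (j : s.Other) (U : List ℕ) :
    Costs (memB A ir zr j U) (4 * s.n + ∑ k, (ir.X j k).length)
      fun x => ∀ i, (x.2 i).length ≤ 3 * s.n := by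
  unfold memB
  split_ifs
  · refine Costs.mono (c := s.n * 1 + (s.n * 1 + ((∑ k, ((ir.X j k).length + 1)) + s.n * 1))) ?_
      ?_ fun _ h => h
    · refine (Costs.pi fun _ => Costs.emit _).bind fun key _ =>
        (Costs.pi fun _ => Costs.emit _).bind fun nr _ =>
        (Costs.pi_sum fun k => Costs.emit _ (by simp [Instr.cost])).bind fun h _ =>
        Costs.bind_pure (Post := fun _ => True) ?_ fun u _ i => ?_
      · refine (Costs.pi (Post := fun _ => True) fun k => ?_).mono le_rfl fun _ _ => trivial
        unfold evalKnown
        split_ifs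
        · exact Costs.emit _
        · exact (Costs.pure trivial).mono (by simp) fun _ h => h
      · simp only
        split_ifs <;> simp <;> omega
    · rw [Finset.sum_add_distrib]
      simp
      omega
  · refine (Costs.pure fun i => ?_).mono (by simp) fun _ h => h
    simp only
    split_ifs <;> simp
    omega

theorem costs_memListB (f x : ℕ) (es : List ℕ) :
    Costs (memListB f x es) (2 * es.length) fun _ => True := by
  induction es with
  | nil => exact Costs.pure trivial
  | cons e es ih =>
    exact (ih.bind fun _ _ => Costs.bind (c := 1) (c' := 1) (Costs.emit _) fun _ _ => Costs.emit _).mono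
      (by simp; omega) fun _ h => h

theorem costs_notMemB (A : Finset (Fin s.m)) (ir : InRegs s) (zr : ℕ) (j : s.Other) :
    Costs (notMemB A ir zr j) (2 + 8 * s.n + 2 * ∑ k, (ir.X j k).length)
      fun x => ∀ i, (x.2 i).length ≤ 3 * s.n := by
  refine Costs.mono (c := 2 + (s.n * 1 + (s.n * 1 + (s.n * 1 + ((∑ k, 2 * (ir.X j k).length) +
    (s.n * 2 + (s.n * 1 + s.n * 2))))))) ?_ ?_ fun _ h => h
  · refine (Costs.emit _).bind fun f _ => (Costs.pi fun _ => Costs.emit _).bind fun e _ =>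
      (Costs.pi fun _ => Costs.emit _).bind fun r₀ _ =>
      (Costs.pi fun _ => Costs.emit _).bind fun r₁ _ =>
      (Costs.pi_sum (Post := fun _ => True) fun k => ?_).bind fun mb _ =>
      (Costs.pi (Post := fun _ => True) fun k => ?_).bind fun e' _ =>
      (Costs.pi fun _ => Costs.emit _).bind fun u _ =>
      (Costs.pi (Post := fun _ => True) fun k => ?_).bind_pure fun w _ i => ?_
    · unfold knownBitB
      split_ifs
      · exact costs_memListB _ _ _
      · exact (Costs.pure trivial).mono (by simp) fun _ h => h
    · exact Costs.bind (c := 1) (c' := 1) (Costs.emit _) fun _ _ => Costs.emit _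
    · exact Costs.bind (c := 1) (c' := 1) (Costs.emit _) fun _ _ => Costs.emit _
    · simp only
      split_ifs <;> simp <;> omega
  · rw [← Finset.mul_sum]
    omega

theorem SetFormula.literals_pos {ι : Type} (Q : SetFormula ι) : 1 ≤ Q.literals := by
  induction Q with
  | mem => exact le_rfl
  | notMem => exact le_rfl
  | and _ _ h _ => exact h.trans (Nat.le_add_right _ _)
  | or _ _ h _ => exact h.trans (Nat.le_add_right _ _)

/-- A binary formula with `L` literals has `L - 1` connectives. Each of them is charged with the
cost of a multiplication, and each literal with that of a negative one. -/
theorem costs_evalB (A : Finset (Fin s.m)) (ir : InRegs s) (zr : ℕ) (Q : SetFormula s.Other)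
    (U : List ℕ) :
    Costs (evalB A ir zr Q U)
      (Q.literals * (2 + 8 * s.n + 2 * ∑ j, ∑ k, (ir.X j k).length) +
        (Q.literals - 1) * (15 * (s.m * s.n)))
      fun x => ∀ i, (x.2 i).length ≤ Q.literals * (3 * s.n) + (Q.literals - 1) * (5 * (s.m * s.n)) := by
  -- For simplicity every literal is charged with the total size of all sets instead of its own.
  have hS : ∀ j, ∑ k, (ir.X j k).length ≤ ∑ j, ∑ k, (ir.X j k).length := fun j =>
    Finset.single_le_sum (f := fun j => ∑ k, (ir.X j k).length) (fun _ _ => Nat.zero_le _)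
      (Finset.mem_univ j)
  set N := ∑ j, ∑ k, (ir.X j k).length with hN
  clear_value N
  induction Q generalizing U with
  | mem j =>
    refine (costs_memB A ir zr j U).mono ?_ fun x h i => (h i).trans ?_
    · have := hS j
      simp only [SetFormula.literals]
      omega
    · simp [SetFormula.literals]
  | notMem j =>
    refine (costs_notMemB A ir zr j).mono ?_ fun x h i => (h i).trans ?_
    · have := hS j
      simp only [SetFormula.literals]
      omega
    · simp [SetFormula.literals]
  | and B C hB hC =>
    -- Writing the numbers of literals as `1 + b` and `1 + c` removes the truncated subtractions.
    obtain ⟨b, hb⟩ := Nat.exists_eq_add_of_le B.literals_pos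
    obtain ⟨c, hc⟩ := Nat.exists_eq_add_of_le C.literals_pos
    refine Costs.mono ((hB _).bind fun x hx => (hC _).bind fun y hy =>
      (costs_addShares _ _).bind_pure (Post' := fun z : (Fin s.m → Fin s.n → ℕ) × (Fin s.m → List ℕ) => ∀ i, (z.2 i).length ≤ _)
        fun z _ i => ?_) ?_ fun _ h => h
    · simp only [SetFormula.literals, hb, hc, List.length_append]
      refine (Nat.add_le_add (hx i) (hy i)).trans ?_
      rw [hb, hc, show 1 + b + (1 + c) - 1 = b + c + 1 by omega]
      simp only [Nat.add_sub_cancel_left]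
      nlinarith [Nat.zero_le (s.m * s.n)]
    · simp only [SetFormula.literals, hb, hc]
      rw [show 1 + b + (1 + c) - 1 = b + c + 1 by omega]
      simp only [Nat.add_sub_cancel_left]
      nlinarith [Nat.zero_le (s.m * s.n)]
  | or B C hB hC =>
    obtain ⟨b, hb⟩ := Nat.exists_eq_add_of_le B.literals_pos
    obtain ⟨c, hc⟩ := Nat.exists_eq_add_of_le C.literals_pos
    refine Costs.mono ((hB _).bind fun x hx => (hC _).bind fun y hy =>
      (costs_mulB _ _ _).bind_pure (Post' := fun z : (Fin s.m → Fin s.n → ℕ) × (Fin s.m → List ℕ) => ∀ i, (z.2 i).length ≤ _)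
        fun z hz i => ?_) ?_ fun _ h => h
    · simp only [SetFormula.literals, hb, hc, List.length_append]
      refine (Nat.add_le_add (hx i) (Nat.add_le_add (hy i) (hz i))).trans ?_
      rw [hb, hc, show 1 + b + (1 + c) - 1 = b + c + 1 by omega]
      simp only [Nat.add_sub_cancel_left]
      nlinarith [Nat.zero_le (s.m * s.n)]
    · simp only [SetFormula.literals, hb, hc]
      rw [show 1 + b + (1 + c) - 1 = b + c + 1 by omega]
      simp only [Nat.add_sub_cancel_left]
      nlinarith [Nat.zero_le (s.m * s.n)]

theorem InRegs.length_words (ir : InRegs s) (i : Fin s.m) :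
    (ir.words i).length ≤ s.n + ∑ j, ∑ k, (ir.X j k).length := by
  unfold InRegs.words
  split_ifs with h
  · simp
  · refine le_trans ?_ (Nat.le_add_left _ _)
    rw [List.length_flatMap, ← List.ofFn_eq_map, List.sum_ofFn]
    exact Finset.single_le_sum (f := fun j => ∑ k, (ir.X j k).length) (fun _ _ => Nat.zero_le _)
      (Finset.mem_univ _)

/-- A bound on the size of the circuit for the simulated views. -/
def viewsSize (x : ℕ) : ℕ := 100 * (x + 1) ^ 4

/-- The degree `4` of the bound comes from the length of the output: up to `x` parties, each with up
to `x` multiplications of at most `5 * x * x` words. -/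
theorem costs_viewsB (A : Finset (Fin s.m)) (ir : InRegs s) (sr : Fin s.m → Fin s.n → ℕ)
    (U : List ℕ) {x : ℕ} (hx : s.m + s.n + s.Q.literals + ∑ j, ∑ k, (ir.X j k).length ≤ x) :
    Costs (viewsB A ir sr U) (viewsSize x) fun l => l.length ≤ viewsSize x := by
  set N := ∑ j, ∑ k, (ir.X j k).length with hN
  have hm : s.m ≤ x := by omega
  have hn : s.n ≤ x := by omega
  have hq : s.Q.literals ≤ x := by omega
  have hq' : s.Q.literals - 1 ≤ x := by omega
  have hNx : N ≤ x := by omega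
  refine Costs.mono (c := 3 + ((s.Q.literals * (2 + 8 * s.n + 2 * N) +
    (s.Q.literals - 1) * (15 * (s.m * s.n))) + 7 * (s.m * s.n))) ?_ ?_ fun _ h => h
  · refine costs_zero.bind fun zr _ => (costs_evalB A ir zr s.Q U).bind fun y hy =>
      (costs_transB _ _ _).bind_pure (Post' := fun l : List ℕ => l.length ≤ viewsSize x) fun t ht => ?_
    rw [List.length_flatMap]
    refine (List.sum_le_card_nsmul _ (x + x + (x * (3 * x) + x * (5 * (x * x)) + 4 * (x * x)))
      fun l hl => ?_).trans ?_
    · obtain ⟨i, -, rfl⟩ := List.mem_map.1 hl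
      rw [List.length_append, List.length_append]
      refine Nat.add_le_add ((ir.length_words i).trans (Nat.add_le_add hn hNx))
        (Nat.add_le_add ((hy i).trans ?_) ((ht i).trans ?_))
      · gcongr
      · gcongr
    · rw [List.length_map, smul_eq_mul]
      have hl : ((List.finRange s.m).filter fun i => i ∈ A).length ≤ x :=
        ((List.length_filter_le _ _).trans (by simp)).trans hm
      refine (Nat.mul_le_mul_right _ hl).trans ?_
      unfold viewsSize
      ring_nf
      nlinarith [Nat.zero_le (x ^ 4), Nat.zero_le (x ^ 3), Nat.zero_le (x ^ 2), Nat.zero_le x]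
  · refine le_trans (b := 3 + ((x * (2 + 8 * x + 2 * x) + x * (15 * (x * x))) + 7 * (x * x))) ?_ ?_
    · gcongr
    · unfold viewsSize
      ring_nf
      nlinarith [Nat.zero_le (x ^ 4), Nat.zero_le (x ^ 3), Nat.zero_le (x ^ 2), Nat.zero_le x]

end Size

end
end ZeroSharing

namespace ZeroSharing
noncomputable section
open PMF (uniformOfFintype uniformOfFinset)

/-! ### The values seen by the pivot -/

theorem Couple.rfl {α : Type} {μ : PMF α} : Couple μ μ Eq := Couple.refl_of fun _ _ => Eq.refl _

/-- The independent coupling suffices when the relation holds for all possible values. It serves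
literals for which neither party is corrupted. -/
theorem Couple.of_forall {α β : Type} {μ : PMF α} {ν : PMF β} {R : α → β → Prop}
    (h : ∀ a ∈ μ.support, ∀ b ∈ ν.support, R a b) : Couple μ ν R := by
  refine ⟨μ.bind fun a => ν.map fun b => (a, b), ?_, ?_, fun e he => ?_⟩
  · rw [PMF.map_bind]
    conv_rhs => rw [← PMF.bind_pure μ]
    refine congrArg _ (funext fun a => ?_)
    rw [PMF.map_comp]
    exact PMF.map_const _ _
  · rw [PMF.map_bind]
    simp only [PMF.map_comp]
    rw [show (fun a : α => ν.map (Prod.snd ∘ fun b => (a, b))) = fun _ => ν from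
      funext fun a => PMF.map_id ν, PMF.bind_const]
  · obtain ⟨a, ha, he⟩ := (PMF.mem_support_bind_iff _ _ _).1 he
    obtain ⟨b, hb, rfl⟩ := (PMF.mem_support_map_iff _ _ _).1 he
    exact h a ha b hb

theorem uniformOfFintype_map_injective {α β : Type} [Fintype α] [Nonempty α] {f : α → β}
    (hf : Function.Injective f) {S : Finset β} (hS : S.Nonempty) (h : ∀ b, b ∈ S ↔ ∃ a, f a = b) :
    (uniformOfFintype α).map f = uniformOfFinset S hS := by
  classical
  have hc : S.card = Fintype.card α := by
    rw [← Finset.card_univ, ← Finset.card_image_of_injective _ hf]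
    congr 1
    ext b
    simp [h]
  ext b
  rw [PMF.map_apply]
  by_cases hb : b ∈ S
  · obtain ⟨a, rfl⟩ := (h b).1 hb
    rw [tsum_eq_single a]
    · simp [hb, hc]
    · intro a' ha'
      rw [if_neg]
      exact fun h => ha' (hf h).symm
  · rw [PMF.uniformOfFinset_apply_of_notMem _ hb, ENNReal.tsum_eq_zero]
    intro a
    rw [if_neg]
    rintro rfl
    exact hb ((h _).2 ⟨a, Eq.refl _⟩)

variable {p : Params}

/-- The distribution of one value in the simulation. -/
def poolDist (inp : Input p) (A : Finset (Fin p.m)) (j : p.toShape.Other) (k : Fin p.n) : PMF p.F :=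
  if j.1 ∉ A ∧ p.pivot ∈ A then
    (uniformOfFintype p.F).bind fun r => pprfValue p (inp.X j k ×ˢ {-r}) (inp.x k)
  else uniformOfFintype p.F

/-- The distributions of all values in the simulation. -/
def poolDists (inp : Input p) (A : Finset (Fin p.m)) : SetFormula p.toShape.Other → List (PMF p.F)
  | .mem j => List.ofFn (poolDist inp A j)
  | .notMem _ => List.ofFn fun _ : Fin p.n => uniformOfFintype p.F
  | .and B C => poolDists inp A B ++ poolDists inp A C
  | .or B C => poolDists inp A B ++ poolDists inp A C

theorem length_poolDists (inp : Input p) (A : Finset (Fin p.m)) (Q : SetFormula p.toShape.Other) :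
    (poolDists inp A Q).length = Q.literals * p.n := by
  induction Q with
  | mem j => simp [poolDists, SetFormula.literals]
  | notMem j => simp [poolDists, SetFormula.literals]
  | and B C hB hC => simp [poolDists, SetFormula.literals, hB, hC, add_mul]
  | or B C hB hC => simp [poolDists, SetFormula.literals, hB, hC, add_mul]

/-- Since `f` reads only the first block of the pool and `g` only the second, each block can be
sampled just before it is used. The known length `N` tells where the blocks meet. -/
theorem listPMF_append_bind {α β γ δ : Type} (ds es : List (PMF α)) {N : ℕ} (hN : ds.length = N)
    (f : List α → PMF β) (g : List α → PMF γ) (h : β → γ → PMF δ) :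
    ((listPMF (ds ++ es)).bind fun U => (f (U.take N)).bind fun x =>
      (g (U.drop N)).bind fun y => h x y) =
    ((listPMF ds).bind f).bind fun x => ((listPMF es).bind g).bind fun y => h x y := by
  rw [listPMF_append, PMF.bind_bind, PMF.bind_bind]
  refine bind_congr_of_support _ fun l hl => ?_
  have hlen : l.length = N := (length_of_mem_support_listPMF hl).trans hN
  rw [PMF.bind_map]
  simp only [Function.comp_def, List.take_left' hlen, List.drop_left' hlen, PMF.bind_bind]
  rw [PMF.bind_comm]

/-- Shares and views agree for the parties in `A`. -/
def Agree (A : Finset (Fin p.m)) (x y : Transcript p) : Prop :=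
  (∀ i ∈ A, x.1 i = y.1 i) ∧ ∀ i ∈ A, x.2.1 i = y.2.1 i

theorem getD_ofFn {α : Type} {n : ℕ} (f : Fin n → α) (d : α) (k : Fin n) :
    (List.ofFn f).getD k d = f k := by simp [List.getD]

theorem realMem_eq (inp : Input p) (j : p.toShape.Other) :
    realMem inp j = (uniformOfFintype (Fin p.n → p.F)).bind fun r =>
      (uniformOfFintype (Fin p.n → p.Key)).bind fun key =>
        (piPMF fun k => p.pprf.hint (key k) (inp.X j k ×ˢ {-r k})).map fun h =>
          (twoPartyShares (fun k => p.pprf.eval (key k) (h k) (inp.x k)) j r,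
            memView j r key h fun k => p.pprf.eval (key k) (h k) (inp.x k),
            (fun k => p.pprf.eval (key k) (h k) (inp.x k)) + r) := by
  have : ∀ r : Fin p.n → p.F, bOPPRF p (fun k => inp.X j k ×ˢ {-r k}) inp.x =
      (uniformOfFintype (Fin p.n → p.Key)).bind fun key =>
        (piPMF fun k => p.pprf.hint (key k) (inp.X j k ×ˢ {-r k})).map fun h =>
          (key, h, fun k => p.pprf.eval (key k) (h k) (inp.x k)) := fun r => Eq.refl _
  simp only [realMem, this, PMF.map_bind, PMF.map_comp, Function.comp_def]

/-- If the sender is corrupted, the pool entry plays the part of its `r`, and the pivot's value is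
needed only if the pivot is corrupted too. If only the pivot is corrupted, the entry is the value it
receives. If neither is, the parties in `A` see nothing and hold zero shares. -/
theorem couple_mem (inp : Input p) (A : Finset (Fin p.m)) (j : p.toShape.Other) :
    Couple (realMem inp j)
      ((listPMF (List.ofFn (poolDist inp A j))).bind (simMem inp A j)) (Agree A) := by
  rw [listPMF_ofFn, PMF.bind_map]
  by_cases hj : j.1 ∈ A
  · have hd : poolDist inp A j = fun _ => uniformOfFintype p.F := by
      funext k; simp [poolDist, hj]
    rw [hd, piPMF_uniform, realMem_eq]
    refine Couple.rfl.bind ?_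
    rintro r _ rfl
    simp only [Function.comp_apply, simMem, if_pos hj, getD_ofFn]
    refine Couple.rfl.bind ?_
    rintro key _ rfl
    refine Couple.rfl.map ?_
    rintro h _ rfl
    by_cases hp : p.pivot ∈ A
    · simp only [if_pos hp]
      exact ⟨fun _ _ => Eq.refl _, fun _ _ => Eq.refl _⟩
    · simp only [if_neg hp]
      refine ⟨fun i hi => ?_, fun i hi => ?_⟩
      · have hip : i ≠ p.pivot := fun h => hp (h ▸ hi)
        simp only [twoPartyShares, if_neg hip]
      · have hip : i ≠ p.pivot := fun h => hp (h ▸ hi)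
        simp only [memView, if_neg hip]
  · by_cases hp : p.pivot ∈ A
    · let μ := (uniformOfFintype (Fin p.n → p.F)).bind fun r =>
        (bOPPRF p (fun k => inp.X j k ×ˢ {-r k}) inp.x).map fun o => (r, o)
      have hμ : μ.map (fun x => x.2.2.2) = piPMF (poolDist inp A j) := by
        have hd : poolDist inp A j = fun k => (uniformOfFintype p.F).bind fun r =>
            pprfValue p (inp.X j k ×ˢ {-r}) (inp.x k) := by
          funext k; simp [poolDist, hj, hp]
        rw [hd, ← piPMF_bind, piPMF_uniform]
        simp only [μ, PMF.map_bind, PMF.map_comp, Function.comp_def]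
        refine congrArg _ (funext fun r => ?_)
        exact bOPPRF_values (fun k => inp.X j k ×ˢ {-r k}) inp.x
      refine Couple.of_map μ (fun x => (twoPartyShares x.2.2.2 j x.1,
        memView j x.1 x.2.1 x.2.2.1 x.2.2.2, x.2.2.2 + x.1))
        (fun x => (twoPartyShares x.2.2.2 j 0,
          fun i => if i = p.pivot then p.wordsF x.2.2.2 else [], 0)) ?_ ?_ ?_
      · simp only [realMem, μ, PMF.map_bind, PMF.map_comp, Function.comp_def]
      · rw [← hμ, PMF.bind_map]
        simp only [Function.comp_def, simMem, if_neg hj, getD_ofFn]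
        exact PMF.bind_pure_comp _ _
      · rintro ⟨r, o⟩ -
        refine ⟨fun i hi => ?_, fun i hi => ?_⟩
        · have hij : i ≠ j.1 := fun h => hj (h ▸ hi)
          simp only [twoPartyShares, if_neg hij]
        · have hij : i ≠ j.1 := fun h => hj (h ▸ hi)
          simp only [memView, if_neg hij]
    · refine Couple.of_forall fun x hx y hy => ?_
      simp only [realMem, PMF.mem_support_bind_iff, PMF.mem_support_map_iff] at hx
      simp only [Function.comp_def, simMem, if_neg hj, PMF.mem_support_bind_iff,
        PMF.mem_support_pure_iff] at hy
      obtain ⟨r, -, o, -, rfl⟩ := hx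
      obtain ⟨U, -, rfl⟩ := hy
      refine ⟨fun i hi => ?_, fun i hi => ?_⟩
      · have hij : i ≠ j.1 := fun h => hj (h ▸ hi)
        have hip : i ≠ p.pivot := fun h => hp (h ▸ hi)
        simp only [twoPartyShares, if_neg hij, if_neg hip]
      · have hij : i ≠ j.1 := fun h => hj (h ▸ hi)
        have hip : i ≠ p.pivot := fun h => hp (h ▸ hi)
        simp only [memView, if_neg hij, if_neg hip]

open Classical in
theorem bssPMT_eq (X : Fin p.n → Finset p.Elt) (x : Fin p.n → p.Elt) :
    bssPMT p X x = (uniformOfFintype (Fin p.n → Bool)).map fun e =>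
      (e, fun k => xor (e k) (decide (x k ∈ X k))) := by
  refine (uniformOfFintype_map_injective (fun e e' h => (Prod.mk.inj h).1) _ fun e => ?_).symm
  rw [Finset.mem_filter]
  constructor
  · rintro ⟨-, h⟩
    refine ⟨e.1, Prod.ext (Eq.refl _) (funext fun k => ?_)⟩
    have hk : xor (e.1 k) (e.2 k) = decide (x k ∈ X k) := (h k).trans (by congr)
    show xor (e.1 k) (decide (x k ∈ X k)) = e.2 k
    rw [← hk]
    simp
  · rintro ⟨e, rfl⟩
    refine ⟨Finset.mem_univ _, fun k => ?_⟩
    simp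

theorem uniformOfFintype_boolArrow {X : Type} [Fintype X] [Nonempty X] :
    uniformOfFintype (Bool → X) = (uniformOfFintype X).bind fun r₀ =>
      (uniformOfFintype X).bind fun r₁ => PMF.pure fun b => if b then r₁ else r₀ := by
  rw [← uniformOfFintype_map_equiv (Equiv.boolArrowEquivProd X).symm, uniformOfFintype_prod]
  simp only [PMF.map_bind, PMF.map_comp]
  refine congrArg _ (funext fun r₀ => ?_)
  refine congrArg (PMF.bind _) (funext fun r₁ => ?_)
  refine congrArg PMF.pure (funext fun b => ?_)
  cases b <;> rfl

open Classical in
theorem realNotMem_eq (inp : Input p) (j : p.toShape.Other) :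
    realNotMem inp j = (uniformOfFintype (Fin p.n → Bool)).bind fun e =>
      (uniformOfFintype (Fin p.n → p.F)).bind fun r₀ =>
        (uniformOfFintype (Fin p.n → p.F)).bind fun r₁ =>
          PMF.pure (twoPartyShares
            (fun k => if xor (e k) (decide (inp.x k ∈ inp.X j k)) then r₁ k else r₀ k) j
            (fun k => -(if e k then r₁ k else r₀ k)),
            notMemView j e (fun k => xor (e k) (decide (inp.x k ∈ inp.X j k)))
              (fun b => if b then r₁ else r₀)
              (fun k => if xor (e k) (decide (inp.x k ∈ inp.X j k)) then r₁ k else r₀ k),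
            (fun k => if xor (e k) (decide (inp.x k ∈ inp.X j k)) then r₁ k else r₀ k) +
              fun k => -(if e k then r₁ k else r₀ k)) := by
  have hif : ∀ (b : Bool) (r₀ r₁ : Fin p.n → p.F) k,
      (if b then r₁ else r₀) k = if b then r₁ k else r₀ k := by
    intro b r₀ r₁ k; split_ifs <;> rfl
  rw [realNotMem, bssPMT_eq, PMF.bind_map]
  simp only [bROT, Function.comp_def, uniformOfFintype_boolArrow, PMF.map_bind,
    PMF.pure_map, hif]

/-- If both parties are corrupted, the simulator knows the membership bit and the distributions
coincide. If only one is, it sees only its own bits, which are uniform, and the OT messages that go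
with them. -/
theorem couple_notMem (inp : Input p) (A : Finset (Fin p.m)) (j : p.toShape.Other) :
    Couple (realNotMem inp j) (simNotMem inp A j) (Agree A) := by
  classical
  rw [realNotMem_eq, simNotMem]
  by_cases hp : p.pivot ∈ A
  · by_cases hj : j.1 ∈ A
    · refine Couple.rfl.bind ?_
      rintro e _ rfl
      refine Couple.rfl.bind ?_
      rintro r₀ _ rfl
      refine Couple.rfl.bind ?_
      rintro r₁ _ rfl
      have : ∀ k, knownBit inp A j k = decide (inp.x k ∈ inp.X j k) := fun k => by
        simp [knownBit, hj, hp]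
      simp only [this]
      exact Couple.pure ⟨fun _ _ => Eq.refl _, fun _ _ => Eq.refl _⟩
    · have hb : ∀ k, knownBit inp A j k = false := fun k => by simp [knownBit, hj]
      -- With only the pivot corrupted, the simulated sender's bits are shifted by the membership
      -- bits, so that the pivot's bits agree.
      let c : (Fin p.n → Bool) ≃ (Fin p.n → Bool) :=
        { toFun := fun e k => xor (e k) (decide (inp.x k ∈ inp.X j k))
          invFun := fun e k => xor (e k) (decide (inp.x k ∈ inp.X j k))
          left_inv := fun e => by funext k; simp
          right_inv := fun e => by funext k; simp }
      refine Couple.bind (R := fun e e' => c e = e') (Couple.of_map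
        (uniformOfFintype (Fin p.n → Bool)) id c (PMF.map_id _).symm
        (uniformOfFintype_map_equiv c).symm fun _ _ => Eq.refl _) ?_
      rintro e _ rfl
      refine Couple.rfl.bind ?_
      rintro r₀ _ rfl
      refine Couple.rfl.bind ?_
      rintro r₁ _ rfl
      simp only [hb, Bool.xor_false]
      refine Couple.pure ⟨fun i hi => ?_, fun i hi => ?_⟩
      · have hij : i ≠ j.1 := fun h => hj (h ▸ hi)
        simp only [twoPartyShares, if_neg hij]
        rfl
      · have hij : i ≠ j.1 := fun h => hj (h ▸ hi)
        simp only [notMemView, if_neg hij]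
        rfl
  · refine Couple.rfl.bind ?_
    rintro e _ rfl
    refine Couple.rfl.bind ?_
    rintro r₀ _ rfl
    refine Couple.rfl.bind ?_
    rintro r₁ _ rfl
    refine Couple.pure ⟨fun i hi => ?_, fun i hi => ?_⟩
    · have hip : i ≠ p.pivot := fun h => hp (h ▸ hi)
      simp only [twoPartyShares, if_neg hip]
    · have hip : i ≠ p.pivot := fun h => hp (h ▸ hi)
      simp only [notMemView, if_neg hip]

/-- The translation is that of `couple_mul`; without a constraint on `c` no honest party is needed
to correct it. -/
theorem couple_looseTriples {A : Finset (Fin p.m)} {r r' z z' : p.Shares}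
    (hr : ∀ i ∈ A, r i = z i) (hr' : ∀ i ∈ A, r' i = z' i) :
    Couple (looseTriples p) (looseTriples p) fun t t' =>
      ∀ i ∈ A, mulOut t r r' i = mulOut t' z z' i ∧ mulView t r r' i = mulView t' z z' i := by
  let e : (p.Shares × p.Shares × p.Shares) ≃ (p.Shares × p.Shares × p.Shares) :=
    (Equiv.addRight (r - z)).prodCongr ((Equiv.addRight (r' - z')).prodCongr (Equiv.refl _))
  refine Couple.of_map (uniformOfFintype (p.Shares × p.Shares × p.Shares))
    ((fun t => ⟨t.1, t.2.1, t.2.2⟩) ∘ e) (fun t => ⟨t.1, t.2.1, t.2.2⟩) ?_ (Eq.refl _) ?_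
  · rw [← PMF.map_comp, uniformOfFintype_map_equiv e]
    rfl
  · rintro ⟨a, b, c⟩ - i hi
    have e1 : r - (a + (r - z)) = z - a := by abel
    have e2 : r' - (b + (r' - z')) = z' - b := by abel
    have e3 : (a + (r - z)) i = a i := by simp [hr i hi]
    have e4 : (b + (r' - z')) i = b i := by simp [hr' i hi]
    constructor
    · funext k
      simp only [Function.comp_apply, e, Equiv.prodCongr_apply, Prod.map, Equiv.coe_addRight,
        Equiv.refl_apply, mulOut, e1, e2, e3, e4]
    · simp only [Function.comp_apply, e, Equiv.prodCongr_apply, Prod.map, Equiv.coe_addRight,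
        Equiv.refl_apply, mulView, tripleView, e1, e2, e3, e4]

theorem couple_pool (inp : Input p) (A : Finset (Fin p.m))
    (Q : SetFormula p.toShape.Other) :
    Couple (looseEval inp Q) ((listPMF (poolDists inp A Q)).bind (simEval inp A Q)) (Agree A) := by
  unfold looseEval
  have hmul := @couple_looseTriples p A
  induction Q with
  | mem j => exact couple_mem inp A j
  | notMem j =>
    -- The pool block of a negative literal is sampled and discarded.
    have : ((listPMF (poolDists inp A (.notMem j))).bind (simEval inp A (.notMem j))) =
      simNotMem inp A j := PMF.bind_const _ _
    rw [this]
    exact couple_notMem inp A j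
  | and B C hB hC =>
    have := listPMF_append_bind (poolDists inp A B) (poolDists inp A C) (length_poolDists inp A B)
      (simEval inp A B) (simEval inp A C) fun x y => PMF.pure
        ((x.1 + y.1, fun i => x.2.1 i ++ y.2.1 i, x.2.2 + y.2.2) : Transcript p)
    refine cast (congrArg (fun ν => Couple _ ν (Agree A)) this.symm) ?_
    simp only [evalFormula, List.take_nil, List.drop_nil]
    refine hB.bind fun x y hxy => hC.bind fun x' y' hxy' => Couple.pure
      ⟨fun i hi => ?_, fun i hi => ?_⟩
    · simp [hxy.1 i hi, hxy'.1 i hi]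
    · simp [hxy.2 i hi, hxy'.2 i hi]
  | or B C hB hC =>
    have := listPMF_append_bind (poolDists inp A B) (poolDists inp A C) (length_poolDists inp A B)
      (simEval inp A B) (simEval inp A C) fun x y => (looseTriples p).map fun t =>
        ((mulOut t x.1 y.1, fun i => x.2.1 i ++ (y.2.1 i ++ mulView t x.1 y.1 i), x.2.2 * y.2.2) :
          Transcript p)
    refine cast (congrArg (fun ν => Couple _ ν (Agree A)) this.symm) ?_
    simp only [evalFormula, List.take_nil, List.drop_nil]
    refine hB.bind fun x y hxy => hC.bind fun x' y' hxy' => (hmul hxy.1 hxy'.1).map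
      fun t t' ht => ⟨fun i hi => (ht i hi).1, fun i hi => ?_⟩
    simp only [hxy.2 i hi, hxy'.2 i hi, (ht i hi).2]

end
end ZeroSharing

namespace ZeroSharing
noncomputable section
open PMF (uniformOfFintype uniformOfFinset)

/-! ### Hybrid distributions -/

variable {p : Params}

theorem collect_congr {A : Finset (Fin p.m)} {v w : Fin p.m → List Word}
    (h : ∀ i ∈ A, v i = w i) : collect A v = collect A w := by
  unfold collect
  refine List.flatMap_congr fun i hi => h i ?_
  simpa using hi

/-- The output of the functionality, followed by the simulation of the views of the parties in
`A` from a list of field elements with given distributions. -/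
def hybridEnsemble (inp : Input p) (A : Finset (Fin p.m)) (ds : List (PMF p.F)) : PMF (List Word) :=
  (bMZS inp).bind fun s => (listPMF ds).bind fun U =>
    ((simViews inp A U fun i k => if i ∈ A then s i k else 0).map (collect A)).map fun w =>
      w ++ collect Finset.univ fun i => p.wordsF (s i)

/-- The joint view of the parties in `A` and the outputs. -/
def ensembleWords (A : Finset (Fin p.m)) (o : p.Shares × Views p) : List Word :=
  collect A o.2 ++ collect Finset.univ fun i => p.wordsF (o.1 i)

/-- Having fewer than `m` corruptions yields the honest party required by `couple_protocol`. -/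
theorem realEnsemble_eq (inp : Input p) {A : Finset (Fin p.m)} (hA : A.card < p.m) :
    realEnsemble A inp = (outputFirst inp zeroShares).map (ensembleWords A) := by
  obtain ⟨h, hh⟩ : ∃ h, h ∉ A := by
    by_contra hc
    push Not at hc
    have : A = Finset.univ := Finset.eq_univ_iff_forall.2 hc
    simp [this] at hA
  refine Eq.trans (b := (protocol inp).map (ensembleWords A)) rfl ?_
  refine (couple_protocol inp hh).map_eq fun x y hxy => ?_
  unfold ensembleWords
  rw [hxy.1, collect_congr hxy.2]

/-- Translating `a` by `z - z'` equalizes all opened shares. The corrupted shares of `c` then depend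
only on the opened value, on `b` and on the corrupted outputs, so the honest entries of `s` are
irrelevant. -/
theorem couple_transView {A : Finset (Fin p.m)} {z z' s s' : p.Shares}
    (hz : ∀ i ∈ A, z i = z' i) (hs : ∀ i ∈ A, s i = s' i) :
    Couple (uniformOfFintype (p.Shares × p.Shares)) (uniformOfFintype (p.Shares × p.Shares))
      fun ab ab' => ∀ i ∈ A,
        transView (simTriple z s ab) z i = transView (simTriple z' s' ab') z' i := by
  let e : p.Shares × p.Shares ≃ p.Shares × p.Shares :=
    (Equiv.addRight (z - z')).prodCongr (Equiv.refl _)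
  refine Couple.of_map (uniformOfFintype (p.Shares × p.Shares)) id e (PMF.map_id _).symm
    (uniformOfFintype_map_equiv e).symm ?_
  rintro ⟨a, b⟩ - i hi
  have e1 : z' + (a + (z - z')) = z + a := by abel
  have e2 : (a + (z - z')) i = a i := by simp [hz i hi]
  simp only [id, e, Equiv.prodCongr_apply, Prod.map, Equiv.coe_addRight, Equiv.refl_apply,
    transView, simTriple, tripleView, e1, e2, hs i hi]

theorem outputFirst_map_ensembleWords (inp : Input p) (A : Finset (Fin p.m)) :
    (outputFirst inp fun _ => bMZS inp).map (ensembleWords A) =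
      hybridEnsemble inp A (poolDists inp A p.Q) := by
  unfold outputFirst hybridEnsemble
  simp only [PMF.map_bind, PMF.map_comp, simViews]
  -- The ideal output does not depend on the value of the formula, so it can be sampled before the
  -- evaluation.
  rw [PMF.bind_comm]
  refine congrArg _ (funext fun s => ?_)
  rw [← PMF.bind_bind]
  refine (PMF.map_id _).symm.trans (Eq.trans (Couple.map_eq (R := Eq) ?_ fun _ _ h => h)
    (PMF.map_id _))
  refine (couple_pool inp A p.Q).bind fun x y hxy => ?_
  refine (couple_transView hxy.1 (s := s) (s' := fun i k => if i ∈ A then s i k else 0)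
    fun i hi => ?_).map fun ab ab' h => ?_
  · funext k; simp [hi]
  · simp only [Function.comp_apply, ensembleWords]
    congr 1
    exact collect_congr fun i hi => by rw [hxy.2 i hi, h i hi]

/-- The hybrid argument: entries are exchanged one at a time while all others are held fixed. The
length condition ensures that only pools of the right length are ever tested. -/
theorem abs_probTrue_listPMF_sub_le {α : Type} (ds : List (PMF α)) (d : PMF α) {ε : ℝ}
    (f : List α → PMF Bool)
    (h : ∀ d' ∈ ds, ∀ l r : List α, l.length + r.length + 1 = ds.length →
      |probTrue (d'.bind fun a => f (l ++ a :: r)) - probTrue (d.bind fun a => f (l ++ a :: r))| ≤ ε) :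
    |probTrue ((listPMF ds).bind f) -
      probTrue ((listPMF (List.replicate ds.length d)).bind f)| ≤ ds.length * ε := by
  induction ds generalizing f with
  | nil => simp [listPMF]
  | cons e ds ih =>
    have hl : ∀ (e' : PMF α) (es : List (PMF α)), (listPMF (e' :: es)).bind f =
        e'.bind fun a => (listPMF es).bind fun r => f (a :: r) := fun e' es => by
      simp only [listPMF, PMF.bind_bind, PMF.bind_map, Function.comp_def]
    rw [List.length_cons, List.replicate_succ, hl, hl]
    have h1 : |probTrue (e.bind fun a => (listPMF ds).bind fun r => f (a :: r)) -
        probTrue (e.bind fun a => (listPMF (List.replicate ds.length d)).bind fun r =>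
          f (a :: r))| ≤ ds.length * ε := by
      refine abs_probTrue_bind_sub_le _ _ _ fun a _ => ih _ fun d' hd l r hlr => ?_
      have := h d' (by simp [hd]) (a :: l) r (by simp; omega)
      simpa using this
    have h2 : |probTrue (e.bind fun a => (listPMF (List.replicate ds.length d)).bind fun r =>
          f (a :: r)) - probTrue (d.bind fun a =>
            (listPMF (List.replicate ds.length d)).bind fun r => f (a :: r))| ≤ ε := by
      -- The already uniform tail is fixed first, so that only the head varies.
      rw [PMF.bind_comm e, PMF.bind_comm d]
      refine abs_probTrue_bind_sub_le _ _ _ fun r hr => ?_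
      have hlen := length_of_mem_support_listPMF hr
      simpa using h e (by simp) [] r (by simpa using hlen)
    have := abs_sub_le (probTrue (e.bind fun a => (listPMF ds).bind fun r => f (a :: r)))
      (probTrue (e.bind fun a => (listPMF (List.replicate ds.length d)).bind fun r => f (a :: r)))
      (probTrue (d.bind fun a => (listPMF (List.replicate ds.length d)).bind fun r => f (a :: r)))
    push_cast
    linarith

/-- The test whether a circuit accepts. -/
def Circuit.test (p : Params) (C : Circuit) (ws : List Word) : PMF Bool :=
  (C.run p ws).map fun o => decide (o.head? = some [true])

theorem Circuit.accept_eq (C : Circuit) (D : PMF (List Word)) :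
    C.accept p D = probTrue (D.bind (C.test p)) := by
  rw [Circuit.accept, PMF.map_bind]
  rfl

theorem abs_accept_real_sub_hybrid_le (inp : Input p) {A : Finset (Fin p.m)} (hA : A.card < p.m)
    {δ : ENNReal}
    (hδ : ∀ j k, inp.x k ∉ inp.X j k → ∀ r c, pprfValue p (inp.X j k ×ˢ {-r}) (inp.x k) c ≤ δ)
    (hq : (Fintype.card p.F : ENNReal)⁻¹ ≤ δ) (hfin : δ ≠ ⊤) (D : Circuit) :
    |D.accept p (hybridEnsemble inp A (poolDists inp A p.Q)) - D.accept p (realEnsemble A inp)| ≤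
      p.n * ((p.Q.orCount + 1 : ℕ) * δ.toReal) := by
  rw [realEnsemble_eq inp hA, ← outputFirst_map_ensembleWords, D.accept_eq, D.accept_eq,
    PMF.bind_map, PMF.bind_map, abs_sub_comm]
  exact (abs_probTrue_sub_le_statDist _ _).trans (statDist_outputFirst_le inp hδ hq hfin _)

end
end ZeroSharing

namespace ZeroSharing
noncomputable section
open PMF (uniformOfFintype uniformOfFinset)

open Builder

/-! ### Composition of circuits -/

/-- Rename the registers that an instruction reads. -/
def Instr.rename (f : ℕ → ℕ) : Instr → Instr
  | .const w => .const w
  | .coin => .coin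
  | .bit i t => .bit (f i) t
  | .nand i j => .nand (f i) (f j)
  | .append i j => .append (f i) (f j)
  | .eq i j => .eq (f i) (f j)
  | .select c i j => .select (f c) (f i) (f j)
  | .rand => .rand
  | .add i j => .add (f i) (f j)
  | .neg i => .neg (f i)
  | .mul i j => .mul (f i) (f j)
  | .key => .key
  | .hint k pts => .hint (f k) (pts.map fun q => (f q.1, f q.2))
  | .eval k h x => .eval (f k) (f h) (f x)

theorem Instr.cost_rename (f : ℕ → ℕ) (i : Instr) : (i.rename f).cost = i.cost := by
  cases i <;> simp [Instr.rename, Instr.cost]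

/-- Run code on the words in the registers of a list. -/
def inlineCode (nr : ℕ) : List Instr → List ℕ → Builder (List ℕ)
  | [], env => pure env
  | i :: is, env => do
    let r ← emit (i.rename fun j => env.getD j nr)
    inlineCode nr is (env ++ [r])

/-- Run a circuit on the words in the registers of a list. -/
def inlineB (C : Circuit) (args : List ℕ) : Builder (List ℕ) := do
  let nr ← emit (.const [])
  let env ← inlineCode nr C.code args
  pure (C.out.map fun j => env.getD j nr)

/-- Hard-wired words. -/
def constsB : List Word → Builder (List ℕ)
  | [] => pure []
  | w :: ws => do
    let r ← emit (.const w)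
    let rs ← constsB ws
    pure (r :: rs)

/-- Uniform field elements. -/
def randsB : ℕ → Builder (List ℕ)
  | 0 => pure []
  | N + 1 => do
    let r ← emit .rand
    let rs ← randsB N
    pure (r :: rs)

/-- The circuit that is built for inputs of a given length. -/
def Builder.toCircuit (n : ℕ) (b : Builder (List ℕ)) : Circuit := ⟨(b n).1, (b n).2⟩

theorem size_toCircuit_le {n c d : ℕ} {b : Builder (List ℕ)}
    (h : Costs b c fun l => l.length ≤ d) : (b.toCircuit n).size ≤ c + d :=
  Nat.add_le_add (h n).1 (h n).2

theorem costs_inlineCode (nr : ℕ) (is : List Instr) (env : List ℕ) :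
    Costs (inlineCode nr is env) (is.map Instr.cost).sum fun _ => True := by
  induction is generalizing env with
  | nil => exact Costs.pure trivial
  | cons i is ih =>
    rw [List.map_cons, List.sum_cons]
    exact (Costs.emit _ (Instr.cost_rename _ i)).bind fun _ _ => ih _

theorem costs_inlineB (C : Circuit) (args : List ℕ) :
    Costs (inlineB C args) (C.size + 1) fun l => l.length ≤ C.size :=
  Costs.mono (c := 1 + (C.code.map Instr.cost).sum) (Post := fun l : List ℕ => l.length ≤ C.size)
    ((Costs.emit _).bind fun nr _ => (costs_inlineCode nr C.code args).bind_pure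
      fun env _ => by simp [Circuit.size]) (by simp only [Circuit.size]; omega) fun _ h => h

theorem costs_constsB (ws : List Word) :
    Costs (constsB ws) (ws.map fun w => w.length + 1).sum fun _ => True := by
  induction ws with
  | nil => exact Costs.pure trivial
  | cons w ws ih =>
    rw [List.map_cons, List.sum_cons]
    exact (Costs.emit _).bind fun _ _ => ih.bind_pure fun _ _ => trivial

theorem costs_randsB (N : ℕ) : Costs (randsB N) N fun _ => True := by
  induction N with
  | zero => exact Costs.pure trivial
  | succ N ih =>
    exact Costs.mono (c := 1 + N) ((Costs.emit .rand).bind fun _ _ =>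
      ih.bind_pure (Post' := fun _ => True) fun _ _ => trivial) (by omega) fun _ h => h

/-! ### Correctness of composed circuits -/

section Correctness

variable {p : Params}

theorem run_toCircuit {b : Builder (List ℕ)} {mem : List Word} {n : ℕ} (hn : mem.length = n)
    {D : PMF (List Word)} (h : Impl p b mem D fun rs ws mem' => ReadsList mem' rs ws) :
    (b.toCircuit n).run p mem = D := by
  subst hn
  exact (Couple.map_eq h fun _ _ h => h.2.2.map_reg).trans (PMF.map_id D)

/-- A circuit that reads an absent register gets the empty word. The inlined code imitates this with
the extra register `nr`, which contains the empty word. -/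
theorem reg_getD {mem : List Word} {nr : ℕ} (h0 : Reads mem nr []) {env : List ℕ}
    {ws : List Word} (h : ReadsList mem env ws) (j : ℕ) :
    Reads mem (env.getD j nr) (reg ws j) := by
  unfold ZeroSharing.reg
  induction h generalizing j with
  | nil => simpa using h0
  | cons h _ ih =>
    cases j with
    | zero => simpa using h
    | succ j => simpa using ih j

theorem step_rename {mem ws : List Word} {f : ℕ → ℕ} (h : ∀ j, reg mem (f j) = reg ws j)
    (i : Instr) : (i.rename f).step p mem = i.step p ws := by
  cases i <;> simp [Instr.rename, Instr.step, h, Function.comp_def]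

theorem impl_inlineCode {nr : ℕ} (is : List Instr) {mem : List Word} (h0 : Reads mem nr [])
    {env : List ℕ} {ws : List Word} (h : ReadsList mem env ws) :
    Impl p (inlineCode nr is env) mem (runCode p is ws) fun env' ws' mem' =>
      ReadsList mem' env' ws' := by
  induction is generalizing mem env ws with
  | nil => exact Impl.pure h
  | cons i is ih =>
    rw [runCode_cons]
    refine Impl.bind (R := fun r w mem' => Reads mem' r w) (Impl.emit (f := fun w => w) ?_)
      fun r w m1 p1 hr => ih (h0.mono p1) ((h.mono p1).append (List.Forall₂.cons hr .nil))
    rw [step_rename fun j => (reg_getD h0 h j).reg]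
    exact (PMF.map_id _).symm

theorem impl_inlineB (C : Circuit) {mem : List Word} {args : List ℕ} {ws : List Word}
    (h : ReadsList mem args ws) :
    Impl p (inlineB C args) mem (C.run p ws) fun rs os mem' => ReadsList mem' rs os := by
  refine Impl.pure_bind (x := ()) (R := fun r _ mem' => Reads mem' r [])
    (Impl.emit_pure (f := fun _ => []) rfl) fun nr m1 p1 h0 => ?_
  refine Impl.bind_map (R := fun env ws' mem' => Reads mem' nr [] ∧ ReadsList mem' env ws')
    (Couple.mono (impl_inlineCode (p := p) C.code h0 (h.mono p1)) fun m x hx =>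
      ⟨hx.1, hx.2.1, h0.mono hx.1, hx.2.2⟩) fun env ws' m2 p2 h2 => ?_
  rw [ReadsList, List.forall₂_map_left_iff, List.forall₂_map_right_iff, List.forall₂_same]
  exact fun j _ => reg_getD h2.1 h2.2 j

theorem impl_constsB (ws : List Word) {mem : List Word} :
    Impl p (constsB ws) mem (PMF.pure ()) fun rs _ mem' => ReadsList mem' rs ws := by
  induction ws generalizing mem with
  | nil => exact Impl.pure .nil
  | cons w ws ih =>
    refine Impl.pure_bind (x := ()) (R := fun r _ mem' => Reads mem' r w)
      (Impl.emit_pure (f := fun _ => w) rfl) fun r m1 p1 h1 => ?_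
    exact ih.pure_bind fun rs m2 p2 h2 => Impl.pure (.cons (h1.mono p2) h2)

theorem impl_randsB (N : ℕ) {mem : List Word} :
    Impl p (randsB N) mem (listPMF (List.replicate N (uniformOfFintype p.F)))
      fun rs U mem' => ReadsList mem' rs (U.map p.wordF) := by
  induction N generalizing mem with
  | zero => exact Impl.pure .nil
  | succ N ih =>
    rw [List.replicate_succ, listPMF]
    exact impl_rand.bind fun r a m1 p1 h1 => ih.bind_map fun rs U m2 p2 h2 =>
      .cons (h1.mono p2) h2

end Correctness

/-- Run `C` with one variable input, and `D` on its output; all other inputs are hard-wired. -/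
def hardwire (C D : Circuit) (v l r o : List Word) : Circuit :=
  Builder.toCircuit 1 (do
    let vr ← constsB (v ++ l)
    let rr ← constsB r
    let cs ← inlineB C (vr ++ 0 :: rr)
    let os ← constsB o
    inlineB D (cs ++ os))

theorem run_hardwire {p : Params} (C D : Circuit) (v l r o : List Word) (w : Word) :
    (hardwire C D v l r o).run p [w] =
      (C.run p (v ++ (l ++ w :: r))).bind fun c => D.run p (c ++ o) := by
  -- Register `0` holds the only variable input; all other arguments are constants placed around it.
  have h0 : Reads [w] 0 w := rfl
  unfold hardwire
  refine run_toCircuit (mem := [w]) (Eq.refl _) ?_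
  refine (impl_constsB (p := p) _).pure_bind fun vr m1 p1 h1 => ?_
  refine (impl_constsB (p := p) _).pure_bind fun rr m2 p2 h2 => ?_
  rw [← List.append_assoc]
  refine (impl_inlineB C ((h1.mono p2).append (.cons (h0.mono (p1.trans p2)) h2))).bind
    fun cr c m3 p3 h3 => ?_
  exact (impl_constsB (p := p) _).pure_bind fun os m4 p4 h4 =>
    impl_inlineB D ((h3.mono p4).append h4)

/-- Every hard-wired word costs at most `B + 1`. The outputs of `D` are the outputs of the whole, so
`D.size` is counted both for its code and for them; the final `2` pays for the two registers with
the empty word. -/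
theorem size_hardwire_le (C D : Circuit) (v l r o : List Word) {B : ℕ}
    (hB : ∀ w ∈ v ++ l ++ r ++ o, w.length ≤ B) :
    (hardwire C D v l r o).size ≤
      (v.length + l.length + r.length + o.length) * (B + 1) + C.size + 2 * D.size + 2 := by
  have hs : ∀ ws : List Word, (∀ w ∈ ws, w.length ≤ B) →
      (ws.map fun w => w.length + 1).sum ≤ ws.length * (B + 1) := fun ws h => by
    have := List.sum_le_card_nsmul (ws.map fun w => w.length + 1) (B + 1) (by
      intro x hx
      obtain ⟨w, hw, rfl⟩ := List.mem_map.1 hx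
      exact Nat.succ_le_succ (h w hw))
    simpa using this
  have h1 := hs (v ++ l) fun w hw => hB w (by simp at hw ⊢; tauto)
  have h2 := hs r fun w hw => hB w (by simp [hw])
  have h3 := hs o fun w hw => hB w (by simp [hw])
  refine (size_toCircuit_le ((costs_constsB (v ++ l)).bind fun vr _ => (costs_constsB r).bind
    fun rr _ => (costs_inlineB C (vr ++ 0 :: rr)).bind fun cs _ => (costs_constsB o).bind
      fun os _ => costs_inlineB D (cs ++ os))).trans ?_
  rw [List.length_append] at h1
  simp only [add_mul] at *
  omega

end
end ZeroSharing

namespace ZeroSharing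
noncomputable section
open PMF (uniformOfFintype uniformOfFinset)

open Builder

/-! ### The simulator -/

section Layout

variable {s : Shape}

/-- The input words of the simulator: the elements of the pivot, the elements of the sets, and
the shares of the outputs. -/
abbrev InputSymbol (s : Shape) : Type := Fin s.n ⊕ (s.Other × Fin s.n × ℕ) ⊕ (Fin s.m × Fin s.n)

/-- The input of a party. -/
def partySymbols (N : s.Other → Fin s.n → ℕ) (i : Fin s.m) : List (InputSymbol s) :=
  if h : i = s.pivot then List.ofFn fun k => .inl k
  else (List.finRange s.n).flatMap fun k =>
    (List.range (N ⟨i, h⟩ k)).map fun t => .inr (.inl (⟨i, h⟩, k, t))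

/-- The input of the simulator. -/
def inputSymbols (A : Finset (Fin s.m)) (N : s.Other → Fin s.n → ℕ) : List (InputSymbol s) :=
  ((List.finRange s.m).filter fun i => i ∈ A).flatMap (partySymbols N) ++
    ((List.finRange s.m).filter fun i => i ∈ A).flatMap fun i =>
      List.ofFn fun k => .inr (.inr (i, k))

/-- The register of an input word. -/
def symbolReg (A : Finset (Fin s.m)) (N : s.Other → Fin s.n → ℕ) (y : InputSymbol s) : ℕ :=
  @List.idxOf _ instBEqOfDecidableEq y (inputSymbols A N)

/-- The registers of the inputs of the parties. -/
def symbolRegs (A : Finset (Fin s.m)) (N : s.Other → Fin s.n → ℕ) : InRegs s where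
  x k := symbolReg A N (.inl k)
  X j k := (List.range (N j k)).map fun t => symbolReg A N (.inr (.inl (j, k, t)))

/-- The simulation of the views from given field elements. -/
def coreCircuit (s : Shape) (A : Finset (Fin s.m)) (N : s.Other → Fin s.n → ℕ) : Circuit :=
  (viewsB A (symbolRegs A N) (fun i k => symbolReg A N (.inr (.inr (i, k))))
    ((List.range (s.Q.literals * s.n)).map fun t => (inputSymbols A N).length + t)).toCircuit
      ((inputSymbols A N).length + s.Q.literals * s.n)

/-- The simulator. -/
def simulator : Simulator := fun s A N =>
  Builder.toCircuit (inputSymbols A N).length (do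
    let Ur ← randsB (s.Q.literals * s.n)
    inlineB (coreCircuit s A N) (List.range (inputSymbols A N).length ++ Ur))

theorem size_coreCircuit_le (A : Finset (Fin s.m)) (N : s.Other → Fin s.n → ℕ) :
    (coreCircuit s A N).size ≤ 2 * viewsSize (s.m + s.n + s.Q.literals + ∑ j, ∑ k, N j k) := by
  rw [two_mul]
  exact size_toCircuit_le (costs_viewsB A _ _ _ (by simp [symbolRegs]))

theorem size_simulator_le (A : Finset (Fin s.m)) (N : s.Other → Fin s.n → ℕ) :
    (simulator s A N).size ≤ s.Q.literals * s.n + 1 +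
      4 * viewsSize (s.m + s.n + s.Q.literals + ∑ j, ∑ k, N j k) := by
  refine (size_toCircuit_le ((costs_randsB _).bind fun Ur _ =>
    costs_inlineB (coreCircuit s A N) _)).trans ?_
  have := size_coreCircuit_le A N
  omega

theorem polySize_simulator : PolySize simulator := by
  -- The square bounds the number of pool elements. The factor `400` is `4 * 100`: the core circuit
  -- has size at most `2 * viewsSize`, and inlining counts it for code and again for outputs.
  refine ⟨Polynomial.X * Polynomial.X + 1 + 400 * (Polynomial.X + 1) ^ 4, fun s A N => ?_⟩
  refine (size_simulator_le A N).trans ?_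
  simp only [Polynomial.eval_add, Polynomial.eval_mul, Polynomial.eval_X, Polynomial.eval_one,
    Polynomial.eval_pow, Polynomial.eval_ofNat, viewsSize]
  have : s.Q.literals * s.n ≤ (s.m + s.n + s.Q.literals + ∑ j, ∑ k, N j k) *
      (s.m + s.n + s.Q.literals + ∑ j, ∑ k, N j k) :=
    Nat.mul_le_mul (by omega) (by omega)
  omega

end Layout

/-! ### Correctness of the simulator -/

section Correctness

variable {p : Params}

/-- The value of an input word. -/
def symbolValue (inp : Input p) (y : p.Shares) : InputSymbol p.toShape → Word
  | .inl k => List.ofFn (inp.x k)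
  | .inr (.inl (j, k, t)) => ((inp.X j k).toList.map List.ofFn).getD t []
  | .inr (.inr (i, k)) => p.wordF (y i k)

/-- The input of the simulator. -/
def simInput (inp : Input p) (A : Finset (Fin p.m)) (y : p.Shares) : List Word :=
  collect A inp.words ++ collect A fun i => p.wordsF (y i)

theorem map_range_getD {α : Type} (l : List α) (d : α) {n : ℕ} (hn : l.length = n) :
    (List.range n).map (fun t => l.getD t d) = l := by
  subst hn
  refine List.ext_getElem (by simp) fun i h1 h2 => ?_
  simp [List.getD, h2]

/-- The layout of the input words as symbols depends only on `A` and the set sizes, so a circuit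
that knows nothing else can locate each word. -/
theorem simInput_eq (inp : Input p) (A : Finset (Fin p.m)) (y : p.Shares) :
    simInput inp A y = (inputSymbols A (inp.sizes A)).map (symbolValue inp y) := by
  unfold simInput inputSymbols collect
  rw [List.map_append, List.map_flatMap, List.map_flatMap]
  congr 1
  · refine List.flatMap_congr fun i hi => ?_
    have hi : i ∈ A := by simpa using hi
    unfold Input.words partySymbols
    split_ifs with h
    · simp [List.map_ofFn, Function.comp_def, symbolValue]
    · rw [List.map_flatMap]
      refine List.flatMap_congr fun k _ => ?_
      rw [List.map_map]
      exact (map_range_getD _ [] (by simp [Input.sizes, hi])).symm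
  · refine List.flatMap_congr fun i hi => ?_
    simp [List.map_ofFn, Function.comp_def, symbolValue, Params.wordsF]

theorem length_simInput (inp : Input p) (A : Finset (Fin p.m)) (y : p.Shares) :
    (simInput inp A y).length = (inputSymbols A (inp.sizes A)).length := by
  rw [simInput_eq, List.length_map]

/-- The index found is that of some occurrence of the symbol, and the symbol determines the word, so
no injectivity of the layout is needed. -/
theorem reads_symbolReg {inp : Input p} {A : Finset (Fin p.m)} {y : p.Shares} {mem : List Word}
    (h : simInput inp A y <+: mem) {z : InputSymbol p.toShape}
    (hz : z ∈ inputSymbols A (inp.sizes A)) :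
    Reads mem (symbolReg A (inp.sizes A) z) (symbolValue inp y z) := by
  refine Reads.mono h ?_
  -- The Boolean equality used by `symbolReg` is fixed here so that the lemmas on `idxOf` refer to
  -- the same index.
  let _ : BEq (InputSymbol p.toShape) := instBEqOfDecidableEq
  have hlt := List.idxOf_lt_length_of_mem hz
  rw [Reads, simInput_eq, symbolReg, List.getElem?_map, List.getElem?_eq_getElem hlt,
    List.getElem_idxOf hlt]
  rfl

theorem mem_inputSymbols_of_party {A : Finset (Fin p.m)} {N : p.toShape.Other → Fin p.n → ℕ}
    {i : Fin p.m} (hi : i ∈ A) {z : InputSymbol p.toShape} (hz : z ∈ partySymbols N i) :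
    z ∈ inputSymbols A N :=
  List.mem_append_left _ (List.mem_flatMap.2 ⟨i, by simpa using hi, hz⟩)

/-- Symbols of honest parties are absent from the layout. The register numbers assigned to an honest
pivot's elements are meaningless, but nothing is claimed about them. -/
theorem readsInput_symbolRegs {inp : Input p} {A : Finset (Fin p.m)} {y : p.Shares}
    {mem : List Word} (h : simInput inp A y <+: mem) :
    ReadsInput mem (symbolRegs A (inp.sizes A)) inp A where
  x hp k := reads_symbolReg h (mem_inputSymbols_of_party hp (by simp [partySymbols]))
  X j hj k := by
    have hlen : ((inp.X j k).toList.map (List.ofFn (n := p.l))).length = inp.sizes A j k := by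
      simp [Input.sizes, hj]
    rw [← map_range_getD ((inp.X j k).toList.map List.ofFn) [] hlen]
    rw [ReadsList]
    simp only [symbolRegs]
    rw [List.forall₂_map_left_iff, List.forall₂_map_right_iff, List.forall₂_same]
    intro t ht
    refine reads_symbolReg h (mem_inputSymbols_of_party hj ?_)
    rw [partySymbols, dif_neg j.2]
    exact List.mem_flatMap.2 ⟨k, List.mem_finRange k, List.mem_map.2 ⟨t, ht, rfl⟩⟩

theorem readsList_range (mem : List Word) (ws : List Word) :
    ReadsList (mem ++ ws) ((List.range ws.length).map fun t => mem.length + t) ws := by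
  rw [ReadsList, List.forall₂_iff_get]
  refine ⟨by simp, fun i h1 h2 => ?_⟩
  simp [Reads, h2]

theorem run_coreCircuit (inp : Input p) (A : Finset (Fin p.m)) (y : p.Shares) {U : List p.F}
    (hU : U.length = p.Q.literals * p.n) :
    (coreCircuit p.toShape A (inp.sizes A)).run p (simInput inp A y ++ U.map p.wordF) =
      (simViews inp A U fun i k => if i ∈ A then y i k else 0).map (collect A) := by
  have hpre : simInput inp A y <+: simInput inp A y ++ U.map p.wordF := List.prefix_append _ _
  refine run_toCircuit (by simp [length_simInput, hU])
    (impl_viewsB (readsInput_symbolRegs hpre) (fun i hi k => ?_) ?_ hU)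
  · exact reads_symbolReg hpre (List.mem_append_right _ (List.mem_flatMap.2
      ⟨i, by simpa using hi, by simp⟩))
  · have := readsList_range (simInput inp A y) (U.map p.wordF)
    rwa [List.length_map, hU, length_simInput] at this

/-- The simulator is the core circuit on a uniform pool. Keeping the pool as an input of the core
lets the hybrid argument run the same circuit on other pools. -/
theorem run_simulator (inp : Input p) (A : Finset (Fin p.m)) (y : p.Shares) :
    (simulator p.toShape A (inp.sizes A)).run p (simInput inp A y) =
      (listPMF (List.replicate (p.Q.literals * p.n) (uniformOfFintype p.F))).bind fun U =>
        (simViews inp A U fun i k => if i ∈ A then y i k else 0).map (collect A) := by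
  have h : (simulator p.toShape A (inp.sizes A)).run p (simInput inp A y) =
      (listPMF (List.replicate (p.Q.literals * p.n) (uniformOfFintype p.F))).bind fun U =>
        (coreCircuit p.toShape A (inp.sizes A)).run p (simInput inp A y ++ U.map p.wordF) := by
    refine run_toCircuit (length_simInput inp A y) ((impl_randsB _).bind fun Ur U m1 p1 h1 =>
      impl_inlineB _ (ReadsList.append ?_ h1))
    have := readsList_range [] (simInput inp A y)
    simp only [List.nil_append, List.length_nil, zero_add, List.map_id', length_simInput] at this
    exact this.mono p1
  rw [h]
  refine bind_congr_of_support _ fun U hU => run_coreCircuit inp A y ?_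
  simpa using length_of_mem_support_listPMF hU

theorem idealEnsemble_simulator (inp : Input p) (A : Finset (Fin p.m)) :
    idealEnsemble (simulator p.toShape A (inp.sizes A)) A inp =
      hybridEnsemble inp A (List.replicate (p.Q.literals * p.n) (uniformOfFintype p.F)) := by
  have h : idealEnsemble (simulator p.toShape A (inp.sizes A)) A inp =
      (bMZS inp).bind fun s => ((simulator p.toShape A (inp.sizes A)).run p (simInput inp A s)).map
        fun w => w ++ collect Finset.univ fun i => p.wordsF (s i) := rfl
  rw [h, hybridEnsemble]
  simp only [run_simulator, PMF.map_bind]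

end Correctness

end
end ZeroSharing

namespace ZeroSharing
noncomputable section
open PMF (uniformOfFintype uniformOfFinset)

/-! ### The hybrid argument -/

variable {p : Params}

/-- For circuits of size at most `b` and sets of at most `B` elements, one value of the programmed
function differs from a uniform field element by at most `ν`. -/
def ValueBound (p : Params) (b B : ℕ) (ν : ℝ) : Prop :=
  ∀ C : Circuit, C.size ≤ b → ∀ X : Finset p.Elt, X.card ≤ B → ∀ r x, x ∉ X →
    |C.accept p (pprfValues p (X ×ˢ {r}) [x]) - C.accept p (uniformValues p 1)| ≤ ν

theorem pprfValues_singleton (S : Finset (p.Elt × p.F)) (x : p.Elt) :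
    pprfValues p S [x] = (pprfValue p S x).map fun a => [p.wordF a] := by
  rw [pprfValue, PMF.map_bind]
  simp only [PMF.map_comp]
  rfl

theorem uniformValues_one : uniformValues p 1 = (uniformOfFintype p.F).map fun a => [p.wordF a] := by
  rw [← uniformOfFintype_map_equiv (Equiv.funUnique (Fin 1) p.F), PMF.map_comp, uniformValues]
  refine congrArg (fun f => PMF.map f _) (funext fun f => ?_)
  simp

theorem functional_prod_singleton {α β : Type} (X : Finset α)
    (r : β) : Functional (X ×ˢ {r}) := by
  intro x y y' h h'
  simp only [Finset.mem_product, Finset.mem_singleton] at h h'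
  rw [h.2, h'.2]

theorem pprfValue_of_mem {X : Finset p.Elt} {x : p.Elt} (hx : x ∈ X) (r : p.F) :
    pprfValue p (X ×ˢ {r}) x = PMF.pure r := by
  classical
  have h : ∀ k, (p.pprf.hint k (X ×ˢ {r})).map (fun h => p.pprf.eval k h x) = PMF.pure r := by
    intro k
    rw [map_congr_of_support (g := fun _ => r) _ fun h hh => p.pprf.programmed k _ h x r
      (functional_prod_singleton X r) hh (by simp [hx])]
    exact PMF.map_const _ _
  rw [pprfValue]
  simp only [h, PMF.bind_const]

theorem poolDist_of_mem_poolDists {inp : Input p} {A : Finset (Fin p.m)}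
    {Q : SetFormula p.toShape.Other} {d : PMF p.F} (hd : d ∈ poolDists inp A Q) :
    d = uniformOfFintype p.F ∨ ∃ j k, d =
      (uniformOfFintype p.F).bind fun r => pprfValue p (inp.X j k ×ˢ {-r}) (inp.x k) := by
  induction Q with
  | mem j =>
    simp only [poolDists, List.mem_ofFn] at hd
    obtain ⟨k, rfl⟩ := hd
    unfold poolDist
    split_ifs
    · exact Or.inr ⟨j, k, rfl⟩
    · exact Or.inl rfl
  | notMem j =>
    simp only [poolDists, List.mem_ofFn] at hd
    obtain ⟨k, rfl⟩ := hd
    exact Or.inl rfl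
  | and B C hB hC => exact (List.mem_append.1 hd).elim hB hC
  | or B C hB hC => exact (List.mem_append.1 hd).elim hB hC

theorem card_le_size (inp : Input p) (j : p.toShape.Other) (k : Fin p.n) :
    (inp.X j k).card ≤ inp.size :=
  (Finset.single_le_sum (f := fun k => (inp.X j k).card) (fun _ _ => Nat.zero_le _)
    (Finset.mem_univ k)).trans (Finset.single_le_sum (f := fun j => ∑ k, (inp.X j k).card)
      (fun _ _ => Nat.zero_le _) (Finset.mem_univ j))

/-- At a programmed point the pool value is `-r`, uniform because `r` is. At any other point the
bound holds for each fixed `r`, hence on average. -/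
theorem abs_accept_pool_sub_le {inp : Input p} {A : Finset (Fin p.m)} {b : ℕ} {ν : ℝ}
    (hν : 0 ≤ ν) (h : ValueBound p b inp.size ν) {d : PMF p.F} (hd : d ∈ poolDists inp A p.Q)
    {C : Circuit} (hC : C.size ≤ b) :
    |C.accept p (d.map fun a => [p.wordF a]) -
      C.accept p ((uniformOfFintype p.F).map fun a => [p.wordF a])| ≤ ν := by
  obtain rfl | ⟨j, k, rfl⟩ := poolDist_of_mem_poolDists hd
  · simpa using hν
  by_cases hx : inp.x k ∈ inp.X j k
  · simp only [pprfValue_of_mem hx]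
    have : ((uniformOfFintype p.F).bind fun r => PMF.pure (-r)) = uniformOfFintype p.F :=
      uniformOfFintype_map_equiv (Equiv.neg p.F)
    rw [this]
    simpa using hν
  · rw [C.accept_eq, C.accept_eq, PMF.map_bind, PMF.bind_bind,
      ← PMF.bind_const (uniformOfFintype p.F)
        (((uniformOfFintype p.F).map fun a => [p.wordF a]).bind (C.test p))]
    refine abs_probTrue_bind_sub_le _ _ _ fun r _ => ?_
    rw [← C.accept_eq, ← C.accept_eq, ← pprfValues_singleton, ← uniformValues_one]
    exact h C hC _ (card_le_size inp j k) _ _ hx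

theorem length_flatMap_le {α β : Type} (l : List α) (f : α → List β) {a B : ℕ}
    (hl : l.length ≤ a) (h : ∀ i ∈ l, (f i).length ≤ B) : (l.flatMap f).length ≤ a * B := by
  rw [List.length_flatMap]
  have := List.sum_le_card_nsmul (l.map fun i => (f i).length) B (by
    intro x hx
    obtain ⟨w, hw, rfl⟩ := List.mem_map.1 hx
    exact h w hw)
  rw [List.length_map, smul_eq_mul] at this
  exact this.trans (Nat.mul_le_mul_right _ hl)

theorem length_filter_finRange_le {m : ℕ} (A : Finset (Fin m)) :
    ((List.finRange m).filter fun i => i ∈ A).length ≤ m :=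
  (List.length_filter_le _ _).trans (by simp)

theorem sum_sizes_le (inp : Input p) (A : Finset (Fin p.m)) :
    ∑ j, ∑ k, inp.sizes A j k ≤ inp.size := by
  refine Finset.sum_le_sum fun j _ => Finset.sum_le_sum fun k _ => ?_
  unfold Input.sizes
  split_ifs <;> simp

theorem length_simInput_le (inp : Input p) (A : Finset (Fin p.m)) (y : p.Shares) :
    (simInput inp A y).length ≤ p.m * (p.n + inp.size) + p.m * p.n := by
  unfold simInput collect
  rw [List.length_append]
  refine Nat.add_le_add ?_ ?_
  · refine length_flatMap_le _ _ (length_filter_finRange_le A) fun i _ => ?_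
    unfold Input.words
    split_ifs with h
    · simp
    · rw [List.length_flatMap]
      simp only [List.length_map, Finset.length_toList]
      rw [← List.ofFn_eq_map, List.sum_ofFn]
      have := Finset.single_le_sum (f := fun j => ∑ k, (inp.X j k).card)
        (fun _ _ => Nat.zero_le _) (Finset.mem_univ (⟨i, h⟩ : p.toShape.Other))
      exact this.trans (Nat.le_add_left _ _)
  · exact length_flatMap_le _ _ (length_filter_finRange_le A) fun i _ => by simp [Params.wordsF]

theorem length_wordF (a : p.F) : (p.wordF a).length = p.fieldLen := by simp [Params.wordF]

theorem length_le_of_mem_collect {A : Finset (Fin p.m)} {y : p.Shares} {w : Word}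
    (hw : w ∈ collect A fun i => p.wordsF (y i)) : w.length ≤ p.l + p.fieldLen := by
  obtain ⟨i, -, hw⟩ := List.mem_flatMap.1 hw
  simp only [Params.wordsF, List.mem_ofFn] at hw
  obtain ⟨k, rfl⟩ := hw
  rw [length_wordF]
  exact Nat.le_add_left _ _

theorem length_le_of_mem_simInput {inp : Input p} {A : Finset (Fin p.m)} {y : p.Shares} {w : Word}
    (hw : w ∈ simInput inp A y) : w.length ≤ p.l + p.fieldLen := by
  rcases List.mem_append.1 hw with hw | hw
  · obtain ⟨i, -, hw⟩ := List.mem_flatMap.1 hw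
    unfold Input.words at hw
    split_ifs at hw with h
    · simp only [List.mem_ofFn] at hw
      obtain ⟨k, rfl⟩ := hw
      simp
    · obtain ⟨k, -, hw⟩ := List.mem_flatMap.1 hw
      obtain ⟨x, -, rfl⟩ := List.mem_map.1 hw
      simp
  · exact length_le_of_mem_collect hw

/-- A bound on the size of the circuits in the hybrid argument. -/
def hybridSize (p : Params) (N d : ℕ) : ℕ :=
  (p.m * (p.n + N) + 2 * (p.m * p.n) + p.Q.literals * p.n) * (p.l + p.fieldLen + 1) +
    2 * viewsSize (p.m + p.n + p.Q.literals + N) + 2 * d + 2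

theorem abs_accept_hybrid_sub_le {inp : Input p} {A : Finset (Fin p.m)} {D : Circuit} {b : ℕ}
    (hb : hybridSize p inp.size D.size ≤ b) {ν : ℝ} (hν : 0 ≤ ν)
    (h : ValueBound p b inp.size ν) :
    |D.accept p (hybridEnsemble inp A (poolDists inp A p.Q)) - D.accept p (hybridEnsemble inp A
      (List.replicate (p.Q.literals * p.n) (uniformOfFintype p.F)))| ≤
        (p.Q.literals * p.n : ℕ) * ν := by
  rw [D.accept_eq, D.accept_eq, hybridEnsemble, hybridEnsemble, PMF.bind_bind, PMF.bind_bind]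
  refine abs_probTrue_bind_sub_le _ _ _ fun s _ => ?_
  rw [PMF.bind_bind, PMF.bind_bind]
  have hlen := length_poolDists inp A p.Q
  rw [← hlen]
  refine abs_probTrue_listPMF_sub_le _ _ _ fun d hd l r hlr => ?_
  set o := collect Finset.univ fun i => p.wordsF (s i) with ho
  -- For a fixed ideal output and fixed other pool entries, simulating the views and then running
  -- `D` is a single circuit in the remaining pool entry.
  let T := hardwire (coreCircuit p.toShape A (inp.sizes A)) D (simInput inp A s)
    (l.map p.wordF) (r.map p.wordF) o
  have hT : ∀ d : PMF p.F, (d.bind fun a =>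
      (((simViews inp A (l ++ a :: r) fun i k => if i ∈ A then s i k else 0).map
        (collect A)).map fun w => w ++ o).bind (D.test p)) =
      (d.map fun a => [p.wordF a]).bind (T.test p) := by
    intro d
    rw [PMF.bind_map]
    refine congrArg _ (funext fun a => ?_)
    have hU : (l ++ a :: r).length = p.Q.literals * p.n := by
      rw [← hlen, ← hlr]; simp; omega
    have h1 := run_coreCircuit inp A s hU
    rw [List.map_append, List.map_cons] at h1
    simp only [Function.comp_apply, Circuit.test, T, run_hardwire, h1, PMF.bind_map, PMF.map_bind,
      Function.comp_def]
  rw [hT, hT, ← T.accept_eq, ← T.accept_eq]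
  refine abs_accept_pool_sub_le hν h hd (le_trans ?_ hb)
  have hsz := size_hardwire_le (coreCircuit p.toShape A (inp.sizes A)) D (simInput inp A s)
    (l.map p.wordF) (r.map p.wordF) o (B := p.l + p.fieldLen) (by
      intro w hw
      simp only [List.mem_append, List.mem_map] at hw
      rcases hw with ((hw | ⟨a, -, rfl⟩) | ⟨a, -, rfl⟩) | hw
      · exact length_le_of_mem_simInput hw
      · rw [length_wordF]; exact Nat.le_add_left _ _
      · rw [length_wordF]; exact Nat.le_add_left _ _
      · exact length_le_of_mem_collect hw)
  have ho' : o.length ≤ p.m * p.n :=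
    length_flatMap_le _ _ (length_filter_finRange_le _) fun i _ => by simp [Params.wordsF]
  have hin := length_simInput_le inp A s
  have hcore := size_coreCircuit_le (s := p.toShape) A (inp.sizes A)
  have hv : viewsSize (p.m + p.n + p.Q.literals + ∑ j, ∑ k, inp.sizes A j k) ≤
      viewsSize (p.m + p.n + p.Q.literals + inp.size) := by
    have := sum_sizes_le inp A
    unfold viewsSize
    gcongr
  have hmul : ((simInput inp A s).length + (l.map p.wordF).length + (r.map p.wordF).length +
      o.length) * (p.l + p.fieldLen + 1) ≤
      (p.m * (p.n + inp.size) + 2 * (p.m * p.n) + p.Q.literals * p.n) *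
        (p.l + p.fieldLen + 1) := by
    refine Nat.mul_le_mul_right _ ?_
    rw [List.length_map, List.length_map]
    omega
  refine hsz.trans ?_
  unfold hybridSize
  omega

/-! ### Bounds for fixed parameters -/

/-- The circuit that tests whether its input is a given field element. -/
def eqCircuit (p : Params) (c : p.F) : Circuit := ⟨[.const (p.wordF c), .eq 0 1], [2]⟩

open Classical in
theorem accept_eqCircuit (c : p.F) (d : PMF p.F) :
    (eqCircuit p c).accept p (d.map fun a => [p.wordF a]) = (d c).toReal := by
  have h : ∀ a : p.F, (eqCircuit p c).test p [p.wordF a] = PMF.pure (decide (a = c)) := by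
    intro a
    have : (eqCircuit p c).run p [p.wordF a] =
        PMF.pure [[decide (p.wordF a = p.wordF c)]] := by
      have hc : runCode p (eqCircuit p c).code [p.wordF a] = PMF.pure ([p.wordF a, p.wordF c] ++
          [[decide (p.wordF a = p.wordF c)]]) := by
        rw [eqCircuit, runCode_cons]
        refine (PMF.pure_bind _ _).trans ?_
        rw [runCode_cons]
        exact PMF.pure_bind _ _
      rw [Circuit.run, hc]
      exact PMF.pure_map _ _
    rw [Circuit.test, this, PMF.pure_map]
    simp [wordF_injective.eq_iff]
  rw [Circuit.accept_eq, PMF.bind_map]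
  simp only [Function.comp_def, h, probTrue]
  congr 1
  rw [PMF.bind_apply, tsum_eq_single c]
  · simp
  · intro a ha
    simp [ha]

/-- Computational pseudorandomness bounds point masses statistically, because testing equality with
a hard-wired `c` is cheap: `fieldLen + 1` for the constant, `1` for the comparison, `1` for the
output. -/
theorem pprfValue_le {X : Finset p.Elt} {b B : ℕ} (hb : p.fieldLen + 3 ≤ b) {ν : ℝ}
    (h : ValueBound p b B ν) (hX : X.card ≤ B) {x : p.Elt} (hx : x ∉ X) (r c : p.F) :
    pprfValue p (X ×ˢ {r}) x c ≤ ENNReal.ofReal ((Fintype.card p.F : ℝ)⁻¹ + ν) := by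
  have h1 := h (eqCircuit p c) (le_trans (by simp [Circuit.size, eqCircuit, Instr.cost, length_wordF]) hb)
    X hX r x hx
  rw [pprfValues_singleton, uniformValues_one, accept_eqCircuit, accept_eqCircuit] at h1
  rw [← ENNReal.ofReal_toReal (PMF.apply_ne_top _ c)]
  refine ENNReal.ofReal_le_ofReal ?_
  have h2 : ((uniformOfFintype p.F) c).toReal = (Fintype.card p.F : ℝ)⁻¹ := by simp
  rw [h2] at h1
  linarith [(abs_le.1 h1).2]

theorem inv_card_le_ofReal {ν : ℝ} (hν : 0 ≤ ν) :
    (Fintype.card p.F : ENNReal)⁻¹ ≤ ENNReal.ofReal ((Fintype.card p.F : ℝ)⁻¹ + ν) := by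
  have h : (0 : ℝ) < Fintype.card p.F := by exact_mod_cast Fintype.card_pos
  rw [← ENNReal.ofReal_natCast, ← ENNReal.ofReal_inv_of_pos h]
  exact ENNReal.ofReal_le_ofReal (by linarith)

theorem statDist_protocolOutput_le_of_valueBound (inp : Input p) {b : ℕ} {ν : ℝ} (hν : 0 ≤ ν)
    (hb : p.fieldLen + 3 ≤ b) (h : ValueBound p b inp.size ν) :
    statDist (protocolOutput inp) (bMZS inp) ≤
      p.n * ((p.Q.orCount + 1 : ℕ) * ((Fintype.card p.F : ℝ)⁻¹ + ν)) := by
  have h0 : 0 ≤ (Fintype.card p.F : ℝ)⁻¹ := by positivity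
  have := statDist_protocolOutput_le inp (δ := ENNReal.ofReal ((Fintype.card p.F : ℝ)⁻¹ + ν))
    (fun j k hx r c => pprfValue_le hb h (card_le_size inp j k) hx _ c)
    (inv_card_le_ofReal hν) ENNReal.ofReal_ne_top
  rwa [ENNReal.toReal_ofReal (by positivity)] at this

theorem abs_accept_ideal_sub_real_le (inp : Input p) {A : Finset (Fin p.m)} (hA : A.card < p.m)
    {D : Circuit} {b : ℕ} {ν : ℝ} (hν : 0 ≤ ν) (hb : p.fieldLen + 3 ≤ b)
    (hb' : hybridSize p inp.size D.size ≤ b) (h : ValueBound p b inp.size ν) :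
    |D.accept p (idealEnsemble (simulator p.toShape A (inp.sizes A)) A inp) -
      D.accept p (realEnsemble A inp)| ≤ (p.Q.literals * p.n : ℕ) * ν +
        p.n * ((p.Q.orCount + 1 : ℕ) * ((Fintype.card p.F : ℝ)⁻¹ + ν)) := by
  have h0 : 0 ≤ (Fintype.card p.F : ℝ)⁻¹ := by positivity
  have h1 := abs_accept_real_sub_hybrid_le inp hA
    (δ := ENNReal.ofReal ((Fintype.card p.F : ℝ)⁻¹ + ν))
    (fun j k hx r c => pprfValue_le hb h (card_le_size inp j k) hx _ c) (inv_card_le_ofReal hν)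
    ENNReal.ofReal_ne_top D
  rw [ENNReal.toReal_ofReal (by positivity)] at h1
  have h2 := abs_accept_hybrid_sub_le (A := A) hb' hν h
  rw [abs_sub_comm] at h2
  rw [idealEnsemble_simulator]
  exact (abs_sub_le _ _ _).trans (add_le_add h2 h1)

end
end ZeroSharing

namespace ZeroSharing
noncomputable section
open PMF (uniformOfFintype uniformOfFinset)

/-! ### Polynomial bounds and negligible functions -/

namespace PolyBdd

variable {f g : ℕ → ℕ}

protected theorem mono (hg : PolyBdd g) (h : ∀ κ, f κ ≤ g κ) : PolyBdd f := by
  obtain ⟨q, hq⟩ := hg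
  exact ⟨q, fun κ => (h κ).trans (hq κ)⟩

protected theorem const (c : ℕ) : PolyBdd fun _ => c := ⟨Polynomial.C c, fun _ => by simp⟩

protected theorem add (hf : PolyBdd f) (hg : PolyBdd g) : PolyBdd fun κ => f κ + g κ := by
  obtain ⟨q, hq⟩ := hf
  obtain ⟨q', hq'⟩ := hg
  exact ⟨q + q', fun κ => by simpa using Nat.add_le_add (hq κ) (hq' κ)⟩

protected theorem mul (hf : PolyBdd f) (hg : PolyBdd g) : PolyBdd fun κ => f κ * g κ := by
  obtain ⟨q, hq⟩ := hf
  obtain ⟨q', hq'⟩ := hg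
  exact ⟨q * q', fun κ => by simpa using Nat.mul_le_mul (hq κ) (hq' κ)⟩

protected theorem pow (hf : PolyBdd f) (t : ℕ) : PolyBdd fun κ => f κ ^ t := by
  obtain ⟨q, hq⟩ := hf
  exact ⟨q ^ t, fun κ => by simpa using Nat.pow_le_pow_left (hq κ) t⟩

protected theorem viewsSize (hf : PolyBdd f) : PolyBdd fun κ => viewsSize (f κ) :=
  (PolyBdd.const 100).mul ((hf.add (.const 1)).pow 4)

end PolyBdd

theorem PolyParams.hybridSize {P : ℕ → Params} (hP : PolyParams P) {N d : ℕ → ℕ} (hN : PolyBdd N)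
    (hd : PolyBdd d) : PolyBdd fun κ => hybridSize (P κ) (N κ) (d κ) :=
  ((((((hP.m.mul (hP.n.add hN)).add ((PolyBdd.const 2).mul (hP.m.mul hP.n))).add
    (hP.literals.mul hP.n)).mul ((hP.l.add hP.fieldLen).add (.const 1))).add
    ((PolyBdd.const 2).mul (((hP.m.add hP.n).add hP.literals).add hN).viewsSize)).add
    ((PolyBdd.const 2).mul hd)).add (.const 2)

namespace Negligible

variable {ν μ : ℕ → ℝ}

protected theorem mono (hμ : Negligible μ) (h0 : ∀ κ, 0 ≤ ν κ) (h : ∀ κ, ν κ ≤ μ κ) :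
    Negligible ν :=
  Asymptotics.SuperpolynomialDecay.trans_abs_le hμ fun κ => by
    rw [abs_of_nonneg (h0 κ), abs_of_nonneg ((h0 κ).trans (h κ))]
    exact h κ

protected theorem add (hν : Negligible ν) (hμ : Negligible μ) : Negligible fun κ => ν κ + μ κ :=
  Asymptotics.SuperpolynomialDecay.add hν hμ

theorem polyBdd_mul (hν : Negligible ν) (h0 : ∀ κ, 0 ≤ ν κ) {f : ℕ → ℕ} (hf : PolyBdd f) :
    Negligible fun κ => (f κ : ℝ) * ν κ := by
  obtain ⟨q, hq⟩ := hf
  have h := Asymptotics.SuperpolynomialDecay.polynomial_mul hν (q.map (Nat.castRingHom ℝ))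
  refine Negligible.mono (μ := fun κ => (q.map (Nat.castRingHom ℝ)).eval (κ : ℝ) * ν κ) h
    (fun κ => mul_nonneg (Nat.cast_nonneg _) (h0 κ)) fun κ =>
      mul_le_mul_of_nonneg_right ?_ (h0 κ)
  rw [Polynomial.eval_natCast_map]
  exact Nat.cast_le.2 (hq κ)

end Negligible

/-! ### Pseudorandomness -/

/-- Pseudorandomness speaks of one test per security parameter, while the hybrid argument needs a
bound for all circuits of a given size. A test whose advantage is at least half the supremum
controls all the others, which explains the factor `2`; the supremum need not be attained. -/
theorem exists_best_test (p : Params) (b B : ℕ) :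
    ∃ (D : Circuit) (S : Finset (p.Elt × p.F)) (q : List p.Elt),
      D.size ≤ b ∧ Functional S ∧ S.card ≤ B ∧ q.Nodup ∧ q.length ≤ 1 ∧
      (∀ x ∈ q, ∀ y, (x, y) ∉ S) ∧ ValueBound p b B
        (2 * |D.accept p (pprfValues p S q) - D.accept p (uniformValues p q.length)|) := by
  let adv : Circuit → Finset p.Elt → p.F → p.Elt → ℝ := fun C X r x =>
    |C.accept p (pprfValues p (X ×ˢ {r}) [x]) - C.accept p (uniformValues p 1)|
  let T : Set ℝ := {a | ∃ C : Circuit, C.size ≤ b ∧ ∃ X : Finset p.Elt, X.card ≤ B ∧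
    ∃ r x, x ∉ X ∧ adv C X r x = a}
  have hT : ∀ a ∈ T, a ≤ sSup T := fun a ha => by
    refine le_csSup ⟨1, ?_⟩ ha
    rintro _ ⟨C, -, X, -, r, x, -, rfl⟩
    simp only [adv, Circuit.accept_eq]
    refine abs_sub_le_of_nonneg_of_le ?_ ?_ ?_ ?_ <;>
    first | exact probTrue_nonneg _ | exact probTrue_le_one _
  -- Were there nothing to test, the empty circuit with no queries would do vacuously.
  rcases T.eq_empty_or_nonempty with he | hne
  · refine ⟨⟨[], []⟩, ∅, [], by simp [Circuit.size], fun x y y' h => by simp at h, by simp,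
      List.nodup_nil, by simp, by simp, fun C hC X hX r x hx => ?_⟩
    exact absurd (show adv C X r x ∈ T from ⟨C, hC, X, hX, r, x, hx, rfl⟩) (by simp [he])
  · obtain ⟨a, ha, hle⟩ : ∃ a ∈ T, sSup T ≤ 2 * a := by
      by_cases h0 : 0 < sSup T
      · obtain ⟨a, ha, hlt⟩ := exists_lt_of_lt_csSup hne (half_lt_self h0)
        exact ⟨a, ha, by linarith⟩
      -- If the supremum is not positive, any element will do, since advantages are nonnegative.
      · obtain ⟨a, ha⟩ := hne
        refine ⟨a, ha, ?_⟩
        have : 0 ≤ a := by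
          obtain ⟨C, -, X, -, r, x, -, rfl⟩ := ha
          exact abs_nonneg _
        linarith
    obtain ⟨D, hD, X, hX, r, x, hx, rfl⟩ := ha
    refine ⟨D, X ×ˢ {r}, [x], hD, functional_prod_singleton X r, by simpa using hX,
      List.nodup_singleton x, by simp, ?_, fun C hC Y hY s y hy => ?_⟩
    · intro z hz y hy
      rw [List.mem_singleton.1 hz] at hy
      exact hx (Finset.mem_product.1 hy).1
    · exact (hT _ ⟨C, hC, Y, hY, s, y, hy, rfl⟩).trans hle

/-- The nearly best tests form one polynomial-size family, with at most one query each, to which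
pseudorandomness applies. -/
theorem IsPPRF.exists_valueBound {P : ℕ → Params} (hP : IsPPRF P) {b B : ℕ → ℕ} (hb : PolyBdd b)
    (hB : PolyBdd B) :
    ∃ ν : ℕ → ℝ, Negligible ν ∧ (∀ κ, 0 ≤ ν κ) ∧ ∀ κ, ValueBound (P κ) (b κ) (B κ) (ν κ) := by
  choose D S q hD hF hS hq hlen hnot h using fun κ => exists_best_test (P κ) (b κ) (B κ)
  have hneg := hP.1 S q hF (hB.mono hS) hq ((PolyBdd.const 1).mono hlen) hnot D (hb.mono hD)
  exact ⟨_, (hneg.polyBdd_mul (fun _ => abs_nonneg _) (PolyBdd.const 2)), fun κ => by positivity,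
    fun κ => by simpa using h κ⟩

theorem SetFormula.orCount_lt_literals {ι : Type} (Q : SetFormula ι) :
    Q.orCount + 1 ≤ Q.literals := by
  induction Q <;> simp only [SetFormula.orCount, SetFormula.literals] <;> omega

theorem PolyParams.orCount {P : ℕ → Params} (hP : PolyParams P) :
    PolyBdd fun κ => (P κ).Q.orCount + 1 :=
  hP.literals.mono fun κ => (P κ).Q.orCount_lt_literals

/-! ### The asymptotic security and correctness statements -/

theorem securelyComputes_simulator {P : ℕ → Params} {σ : ℕ → ℕ} (hP : PolyParams P)
    (hF : IsPPRF P) (hσ : Negligible fun κ => ((2 : ℝ) ^ σ κ)⁻¹)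
    (hq : ∀ κ, 2 ^ σ κ ≤ Fintype.card (P κ).F) : SecurelyComputes simulator P := by
  intro A inp hA hN D hD
  have hb : PolyBdd fun κ => hybridSize (P κ) (inp κ).size (D κ).size + ((P κ).fieldLen + 3) :=
    (hP.hybridSize hN hD).add (hP.fieldLen.add (.const 3))
  obtain ⟨ν, hν, h0, hval⟩ := hF.exists_valueBound hb hN
  -- Both the hybrid loss and the union bound over false instances are polynomial multiples of `ν`
  -- and `2 ^ (-σ)`; negligibility absorbs the factors `literals`, `n` and `orCount + 1`.
  have h1 := (hν.add hσ).polyBdd_mul (fun κ => add_nonneg (h0 κ) (by positivity))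
    ((hP.literals.mul hP.n).add (hP.n.mul hP.orCount))
  refine h1.mono (fun _ => abs_nonneg _) fun κ => ?_
  refine (abs_accept_ideal_sub_real_le (inp κ) (hA κ) (h0 κ) (Nat.le_add_left _ _)
    (Nat.le_add_right _ _) (hval κ)).trans ?_
  have hinv : (Fintype.card (P κ).F : ℝ)⁻¹ ≤ ((2 : ℝ) ^ σ κ)⁻¹ := by
    refine inv_anti₀ (by positivity) ?_
    exact_mod_cast hq κ
  have hpos : (0 : ℝ) ≤ ((2 : ℝ) ^ σ κ)⁻¹ := by positivity
  have hL : ((((P κ).Q.literals * (P κ).n : ℕ) : ℝ)) * ν κ ≤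
      (((P κ).Q.literals * (P κ).n : ℕ) : ℝ) * (ν κ + ((2 : ℝ) ^ σ κ)⁻¹) := by
    gcongr; linarith
  have hR : ((P κ).n : ℝ) * (((P κ).Q.orCount + 1 : ℕ) *
      ((Fintype.card (P κ).F : ℝ)⁻¹ + ν κ)) ≤
      ((P κ).n : ℝ) * (((P κ).Q.orCount + 1 : ℕ) * (ν κ + ((2 : ℝ) ^ σ κ)⁻¹)) := by
    rw [add_comm (ν κ)]
    gcongr
  refine (add_le_add hL hR).trans (le_of_eq ?_)
  push_cast
  ring

theorem exists_statDist_protocolOutput_le {P : ℕ → Params} (hP : PolyParams P) (hF : IsPPRF P)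
    (inp : ∀ κ, Input (P κ)) (hN : PolyBdd fun κ => (inp κ).size) :
    ∃ ν : ℕ → ℝ, Negligible ν ∧ ∀ κ, statDist (protocolOutput (inp κ)) (bMZS (inp κ)) ≤
      ν κ + (((P κ).Q.orCount + 1) * (P κ).n : ℝ) / Fintype.card (P κ).F := by
  obtain ⟨ν, hν, h0, hval⟩ := hF.exists_valueBound (hP.fieldLen.add (.const 3)) hN
  -- The PPRF advantage times `n * (orCount + 1)` is the negligible part; the point mass `1 / |F|`
  -- of the uniform distribution gives the other term.
  refine ⟨_, hν.polyBdd_mul h0 (hP.n.mul hP.orCount), fun κ => ?_⟩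
  refine (statDist_protocolOutput_le_of_valueBound (inp κ) (h0 κ) le_rfl (hval κ)).trans
    (le_of_eq ?_)
  push_cast
  ring

end
end ZeroSharing

theorem mainTheorem5 :
    (∃ Sim : ZeroSharing.Simulator, ZeroSharing.PolySize Sim ∧
      ∀ (P : ℕ → ZeroSharing.Params) (σ : ℕ → ℕ),
        ZeroSharing.PolyParams P → ZeroSharing.IsPPRF P →
        (ZeroSharing.Negligible fun κ => ((2 : ℝ) ^ σ κ)⁻¹) →
        (∀ κ, (P κ).Q.orCount * (P κ).n * 2 ^ σ κ ≤ Fintype.card (P κ).F) →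
        (∀ κ, 2 ^ σ κ ≤ Fintype.card (P κ).F) →
        ZeroSharing.SecurelyComputes Sim P) ∧
    ∀ P : ℕ → ZeroSharing.Params, ZeroSharing.PolyParams P → ZeroSharing.IsPPRF P →
      ∀ inp : ∀ κ, ZeroSharing.Input (P κ), ZeroSharing.PolyBdd (fun κ => (inp κ).size) →
        ∃ ν : ℕ → ℝ, ZeroSharing.Negligible ν ∧ ∀ κ,
          ZeroSharing.statDist (ZeroSharing.protocolOutput (inp κ)) (ZeroSharing.bMZS (inp κ)) ≤
            ν κ + (((P κ).Q.orCount + 1) * (P κ).n : ℝ) / Fintype.card (P κ).F :=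
  ⟨⟨ZeroSharing.simulator, ZeroSharing.polySize_simulator, fun _ _ hP hF hσ _ hq =>
    ZeroSharing.securelyComputes_simulator hP hF hσ hq⟩,
    fun _ hP hF inp hN => ZeroSharing.exists_statDist_protocolOutput_le hP hF inp hN⟩
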